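/- Let $\Bbbk$ be an uncountable algebraically closed field of characteristic $0$, let $n \ge 0$, $A = \Bbbk[x_1,\dots,x_n]$, $\mathcal V = \mathrm{Der}_{\Bbbk}(A)$, and let $\mathcal D \subset \mathrm{End}_{\Bbbk}(A)$ be the Weyl algebra, generated by $A$ and $\mathcal V$. Let $\mathcal L_+ = \mathfrak m \mathcal L$, where $\mathcal L = \mathrm{Der}_{\Bbbk}(\Bbbk[X_1,\dots,X_n])$ and $\mathfrak m = (X_1,\dots,X_n)$. An $A\mathcal V$-module is a module over the smash product $A \# U(\mathcal V)$. For a finitely generated $\Bbbk$-algebra $R$ and a finitely generated $R$-module $M$, put $\mathrm{GKdim}_R(M) = \limsup_{m\to\infty} \log_m \dim_{\Bbbk}(C^m M_0)$, where $C \ni 1$ is a finite-dimensional generating subspace of $R$ and $M_0$ is a finite-dimensional generating subspace of $M$ (the value does not depend on these choices). For $R = A \# U(\mathcal V)$ or $R = \mathcal D$, an $R$-module $M$ is holonomic if it is finitely generated and $M = 0$ or $\mathrm{GKdim}_R(M) = n$. For a $\mathcal D$-module $P$ and an $\mathcal L_+$-module $Q$, the space $P \otimes Q = P \otimes_{\Bbbk}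 Q$ is an $A\mathcal V$-module with the action $$x^k (p \otimes q) = x^k p \otimes q, \qquad x^k \tfrac{\partial}{\partial x_i} (p \otimes q) = \bigl(x^k \tfrac{\partial}{\partial x_i} p\bigr) \otimes q + \sum_{0 < m \le k} \binom{k}{m} \bigl(x^{k-m} p\bigr) \otimes \bigl(X^m \tfrac{\partial}{\partial X_i} q\bigr)$$ for multi-indices $k \in \mathbb Z_{\ge 0}^n$ and $1 \le i \le n$. **Proposition.** Let $M$ be a holonomic $A\mathcal V$-module. Then there exist an $A\mathcal V$-submodule $N \subset M$, with $N \ne 0$ if $M \ne 0$, a simple holonomic $\mathcal D$-module $P$ and a finite-dimensional $\mathcal L_+$-module $Q$ such that $N \cong P \otimes Q$ as $A\mathcal V$-modules. -/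

import Mathlib

open scoped TensorProduct

universe u v

noncomputable section

namespace AVMod

/-! ### The smash product `A # U(V)` -/

section SmashProduct

attribute [local instance 100] LieRing.ofAssociativeRing

variable (k : Type u) [Field k] (A : Type u) [CommRing A] [Algebra k A]

/-- The Lie algebra `V = Der(A)` of `k`-linear derivations of `A`. -/
abbrev VF : Type u := Derivation k A A

/-- The enveloping algebra `U(V)`. -/
abbrev UV : Type u := UniversalEnvelopingAlgebra k (VF k A)

/-- The action of `U(V)` on `A` extending the tautological action of derivations. -/
def envAct : UV k A →ₐ[k] Module.End k A :=
  UniversalEnvelopingAlgebra.lift k (LieModule.toEnd k (VF k A) A)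

/-- The coproduct of `U(V)`, the algebra morphism with `Δ η = η ⊗ 1 + 1 ⊗ η` for `η ∈ V`. -/
def envComul : UV k A →ₐ[k] UV k A ⊗[k] UV k A :=
  UniversalEnvelopingAlgebra.lift k
    { toFun := fun η => UniversalEnvelopingAlgebra.ι k η ⊗ₜ[k] (1 : UV k A) +
        (1 : UV k A) ⊗ₜ[k] UniversalEnvelopingAlgebra.ι k η
      map_add' := fun x y => by
        simp only [map_add, TensorProduct.add_tmul, TensorProduct.tmul_add]; abel
      map_smul' := fun c x => by
        simp only [map_smul, TensorProduct.smul_tmul', TensorProduct.tmul_smul, smul_add,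
          RingHom.id_apply]
      map_lie' := fun {x y} => by
        simp only [LieHom.map_lie, LieRing.of_associative_ring_bracket, mul_add, add_mul,
          Algebra.TensorProduct.tmul_mul_tmul, one_mul, mul_one, TensorProduct.sub_tmul,
          TensorProduct.tmul_sub]
        abel }

/-- `u ↦ (g ⊗ v ↦ ∑ u⁽¹⁾(g) ⊗ u⁽²⁾ v)` in Sweedler notation `Δ u = ∑ u⁽¹⁾ ⊗ u⁽²⁾`. -/
def diagAct : UV k A →ₐ[k] Module.End k (A ⊗[k] UV k A) :=
  ((Module.endTensorEndAlgHom (R := k) (A := k) (M := A) (N := UV k A)).comp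
    (Algebra.TensorProduct.map (envAct k A) (Algebra.lmul k (UV k A)))).comp (envComul k A)

/-- Multiplication by `f ∈ A` on the first factor of `A ⊗ U(V)`. -/
def polyAct : A →ₐ[k] Module.End k (A ⊗[k] UV k A) :=
  (Module.endTensorEndAlgHom (R := k) (A := k) (M := A) (N := UV k A)).comp
    (Algebra.TensorProduct.includeLeft.comp (Algebra.lmul k A))

/-- The product of the smash product:
`(f ⊗ u) (g ⊗ v) = ∑ f u⁽¹⁾(g) ⊗ u⁽²⁾ v`. -/
def smashMul : A ⊗[k] UV k A →ₗ[k] Module.End k (A ⊗[k] UV k A) :=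
  TensorProduct.lift
    ((LinearMap.mul k (Module.End k (A ⊗[k] UV k A))).compl₁₂
      (polyAct k A).toLinearMap (diagAct k A).toLinearMap)

variable {k A}

lemma smashMul_tmul (f : A) (u : UV k A) :
    smashMul k A (f ⊗ₜ u) = polyAct k A f * diagAct k A u := by
  simp [smashMul]

lemma polyAct_tmul (f g : A) (v : UV k A) :
    polyAct k A f (g ⊗ₜ v) = (f * g) ⊗ₜ v := by
  simp [polyAct, Module.endTensorEndAlgHom_apply]

lemma diagAct_ι (η : VF k A) (g : A) (v : UV k A) :
    diagAct k A (UniversalEnvelopingAlgebra.ι k η) (g ⊗ₜ v) =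
      η g ⊗ₜ v + g ⊗ₜ (UniversalEnvelopingAlgebra.ι k η * v) := by
  simp only [diagAct, envComul, envAct, AlgHom.comp_apply,
    UniversalEnvelopingAlgebra.lift_ι_apply, LieHom.coe_mk]
  erw [map_add, map_add]
  rw [Algebra.TensorProduct.map_tmul, Algebra.TensorProduct.map_tmul]
  rw [Module.endTensorEndAlgHom_apply, Module.endTensorEndAlgHom_apply]
  rw [UniversalEnvelopingAlgebra.lift_ι_apply]
  simp [-UniversalEnvelopingAlgebra.ι_apply]

lemma smashMul_polyAct (f : A) (b : A ⊗[k] UV k A) :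
    smashMul k A (polyAct k A f b) = polyAct k A f * smashMul k A b := by
  induction b with
  | zero => simp
  | add x y hx hy => simp only [map_add, hx, hy, mul_add]
  | tmul g v => rw [polyAct_tmul, smashMul_tmul, smashMul_tmul, map_mul, mul_assoc]

lemma diagAct_ι_polyAct (η : VF k A) (g : A) :
    diagAct k A (UniversalEnvelopingAlgebra.ι k η) * polyAct k A g =
      polyAct k A (η g) + polyAct k A g * diagAct k A (UniversalEnvelopingAlgebra.ι k η) := by
  apply TensorProduct.ext'
  intro h v
  simp only [Module.End.mul_apply, LinearMap.add_apply, polyAct_tmul, diagAct_ι, map_add,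
    Derivation.leibniz, TensorProduct.add_tmul, smul_eq_mul]
  rw [mul_comm h]; abel

lemma smashMul_diagAct_ι (η : VF k A) (b : A ⊗[k] UV k A) :
    smashMul k A (diagAct k A (UniversalEnvelopingAlgebra.ι k η) b) =
      diagAct k A (UniversalEnvelopingAlgebra.ι k η) * smashMul k A b := by
  induction b with
  | zero => simp
  | add x y hx hy => simp only [map_add, hx, hy, mul_add]
  | tmul g v =>
    rw [diagAct_ι, map_add, smashMul_tmul, smashMul_tmul, smashMul_tmul, ← mul_assoc,
      diagAct_ι_polyAct, map_mul, add_mul, mul_assoc]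

lemma env_induction {p : UV k A → Prop} (h1 : p 1)
    (hadd : ∀ x y, p x → p y → p (x + y)) (hsmul : ∀ (c : k) x, p x → p (c • x))
    (hι : ∀ (η : VF k A) x, p x → p (UniversalEnvelopingAlgebra.ι k η * x)) (u : UV k A) :
    p u := by
  let S : Submodule k (UV k A) :=
    { carrier := {u | p u}
      add_mem' := fun {a b} ha hb => hadd a b ha hb
      zero_mem' := by simpa using hsmul 0 1 h1
      smul_mem' := fun c x hx => hsmul c x hx }
  let T : Subalgebra k (UV k A) :=
    { carrier := {a | ∀ x ∈ S, a * x ∈ S}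
      mul_mem' := fun {a b} ha hb x hx => by rw [mul_assoc]; exact ha _ (hb _ hx)
      add_mem' := fun {a b} ha hb x hx => by
        rw [add_mul]; exact S.add_mem (ha _ hx) (hb _ hx)
      algebraMap_mem' := fun c x hx => by
        rw [← Algebra.smul_def]; exact S.smul_mem c hx }
  let F : UV k A →ₐ[k] T := UniversalEnvelopingAlgebra.lift k
    { toFun := fun η => ⟨UniversalEnvelopingAlgebra.ι k η, fun x hx => hι η x hx⟩
      map_add' := fun x y => by apply Subtype.ext; simp
      map_smul' := fun c x => by apply Subtype.ext; simp
      map_lie' := fun {x y} => by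
        apply Subtype.ext
        simp [LieHom.map_lie, LieRing.of_associative_ring_bracket] }
  have hF : T.val.comp F = AlgHom.id k _ := by
    apply UniversalEnvelopingAlgebra.hom_ext
    ext η
    simp only [LieHom.comp_apply, AlgHom.coe_toLieHom, AlgHom.comp_apply, AlgHom.id_apply, F,
      UniversalEnvelopingAlgebra.lift_ι_apply]
    rfl
  have hu : (T.val.comp F) u = u := by rw [hF]; rfl
  have := (F u).2 1 h1
  rw [mul_one] at this
  rw [← hu]
  exact this

lemma smashMul_diagAct (u : UV k A) (b : A ⊗[k] UV k A) :
    smashMul k A (diagAct k A u b) = diagAct k A u * smashMul k A b := by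
  induction u using env_induction generalizing b with
  | h1 => simp
  | hadd x y hx hy => simp only [map_add, LinearMap.add_apply, hx, hy, add_mul]
  | hsmul c x hx => simp only [map_smul, LinearMap.smul_apply, hx, smul_mul_assoc]
  | hι η x hx =>
    simp only [map_mul, Module.End.mul_apply, smashMul_diagAct_ι, hx, mul_assoc]

lemma smashMul_smashMul (a b : A ⊗[k] UV k A) :
    smashMul k A (smashMul k A a b) = smashMul k A a * smashMul k A b := by
  induction a with
  | zero => simp
  | add x y hx hy => simp only [map_add, LinearMap.add_apply, hx, hy, add_mul]
  | tmul f u =>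
    rw [smashMul_tmul, Module.End.mul_apply, smashMul_polyAct, smashMul_diagAct, mul_assoc]

lemma smashMul_one_left : smashMul k A ((1 : A) ⊗ₜ (1 : UV k A)) = 1 := by
  rw [smashMul_tmul, map_one, map_one, one_mul]

lemma smashMul_one_right (a : A ⊗[k] UV k A) :
    smashMul k A a ((1 : A) ⊗ₜ (1 : UV k A)) = a := by
  have key : ∀ u : UV k A, diagAct k A u ((1 : A) ⊗ₜ (1 : UV k A)) = (1 : A) ⊗ₜ u := by
    intro u
    induction u using env_induction with
    | h1 => simp
    | hadd x y hx hy => simp only [map_add, LinearMap.add_apply, hx, hy, TensorProduct.tmul_add]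
    | hsmul c x hx => simp only [map_smul, LinearMap.smul_apply, hx, TensorProduct.tmul_smul]
    | hι η x hx =>
      rw [map_mul, Module.End.mul_apply, hx, diagAct_ι]
      simp
  induction a with
  | zero => simp
  | add x y hx hy => simp only [map_add, LinearMap.add_apply, hx, hy]
  | tmul f u =>
    rw [smashMul_tmul, Module.End.mul_apply, key, polyAct_tmul, mul_one]

variable (k A)

/-- The smash product `A # U(V)`, on the vector space `A ⊗ U(V)`. -/
def Smash : Type u := A ⊗[k] UV k A

instance : AddCommGroup (Smash k A) := inferInstanceAs (AddCommGroup (A ⊗[k] UV k A))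

instance : Module k (Smash k A) := inferInstanceAs (Module k (A ⊗[k] UV k A))

instance : Ring (Smash k A) :=
  { (inferInstance : AddCommGroup (Smash k A)) with
    mul := fun a b => smashMul k A a b
    one := (1 : A) ⊗ₜ[k] (1 : UV k A)
    mul_assoc := fun a b c =>
      congrArg (fun φ : Module.End k (A ⊗[k] UV k A) => φ c) (smashMul_smashMul a b)
    one_mul := fun a =>
      congrArg (fun φ : Module.End k (A ⊗[k] UV k A) => φ a) smashMul_one_left
    mul_one := fun a => smashMul_one_right a
    left_distrib := fun a b c => map_add (smashMul k A a) b c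
    right_distrib := fun a b c =>
      congrArg (fun φ : Module.End k (A ⊗[k] UV k A) => φ c) (map_add (smashMul k A) a b)
    zero_mul := fun a =>
      congrArg (fun φ : Module.End k (A ⊗[k] UV k A) => φ a) (map_zero (smashMul k A))
    mul_zero := fun a => map_zero (smashMul k A a) }

instance : Algebra k (Smash k A) :=
  Algebra.ofModule
    (fun c a b =>
      congrArg (fun φ : Module.End k (A ⊗[k] UV k A) => φ b) (map_smul (smashMul k A) c a))
    (fun c a b => map_smul (smashMul k A a) c b)

variable {k A}

/-- The element `f # 1`. -/
def Smash.ofFun (f : A) : Smash k A := f ⊗ₜ[k] (1 : UV k A)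

/-- The element `1 # η`. -/
def Smash.ofVF (η : VF k A) : Smash k A :=
  (1 : A) ⊗ₜ[k] (UniversalEnvelopingAlgebra.ι k η : UV k A)

/-- The element `f # u`. -/
def Smash.mk (f : A) (u : UV k A) : Smash k A := f ⊗ₜ[k] u

/-- `(f # η) (g # u) = f η(g) # u + f g # η u`. -/
theorem Smash.mk_mul_mk (f g : A) (η : VF k A) (u : UV k A) :
    Smash.mk f (UniversalEnvelopingAlgebra.ι k η) * Smash.mk g u =
      Smash.mk (f * η g) u + Smash.mk (f * g) (UniversalEnvelopingAlgebra.ι k η * u) := by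
  change smashMul k A (f ⊗ₜ _) (g ⊗ₜ u) = (f * η g) ⊗ₜ u + (f * g) ⊗ₜ (_ * u)
  rw [smashMul_tmul, Module.End.mul_apply, diagAct_ι, map_add, polyAct_tmul, polyAct_tmul]
  rfl

end SmashProduct

/-! ### Gelfand–Kirillov dimension and holonomic modules -/

section GK

variable (k : Type u) [Field k] (R : Type u) [Ring R] [Algebra k R]
  (M : Type v) [AddCommGroup M] [Module k M] [Module R M] [IsScalarTower k R M]

/-- `GKdim_R(M) = d`: for a finite-dimensional generating subspace `C ∋ 1` of the algebra `R` and a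
finite-dimensional generating subspace `M₀` of `M`, the upper limit of `log_m (dim C^m M₀)` is `d`.
The upper limit does not depend on the choice of `C` and `M₀`. -/
def HasGKDim (d : EReal) : Prop :=
  ∃ (C : Submodule k R) (M₀ : Submodule k M),
    FiniteDimensional k C ∧ (1 : R) ∈ C ∧ Algebra.adjoin k (C : Set R) = ⊤ ∧
    FiniteDimensional k M₀ ∧ Submodule.span R (M₀ : Set M) = ⊤ ∧
    Filter.limsup
      (fun m : ℕ => ((Real.logb m (Module.finrank k ↥(C ^ m • M₀)) : ℝ) : EReal))
      Filter.atTop = d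

/-- A finitely generated `R`-module `M` is holonomic (for `R = D` or `R = A # U(V)` in `n`
variables) if `M = 0` or `GKdim_R(M) = n`. -/
def IsHolonomic (n : ℕ) : Prop :=
  Module.Finite R M ∧ (Subsingleton M ∨ HasGKDim k R M ((n : ℝ) : EReal))

end GK

/-! ### Affine space -/

section Affine

variable (k : Type u) [Field k] (n : ℕ)

/-- `A = k[x₁, …, xₙ]`. -/
abbrev Poly : Type u := MvPolynomial (Fin n) k

/-- The algebra `A # U(V)` for the affine space; its modules are the `AV`-modules. -/
abbrev AVAlg : Type u := Smash k (Poly k n)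

/-- The Weyl algebra `D`: the subalgebra of `End_k(A)` generated by multiplications by elements
of `A` and by derivations of `A`. -/
def Weyl : Subalgebra k (Module.End k (Poly k n)) :=
  Algebra.adjoin k
    (Set.range (fun f : Poly k n => LinearMap.mulLeft k f) ∪
      Set.range (fun η : VF k (Poly k n) => (η : Poly k n →ₗ[k] Poly k n)))

variable {k n}

/-- `f ∈ A` as an element of `D`. -/
def Weyl.ofFun (f : Poly k n) : Weyl k n :=
  ⟨LinearMap.mulLeft k f, Algebra.subset_adjoin (Or.inl ⟨f, rfl⟩)⟩

/-- `η ∈ V` as an element of `D`. -/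
def Weyl.ofVF (η : VF k (Poly k n)) : Weyl k n :=
  ⟨(η : Poly k n →ₗ[k] Poly k n), Algebra.subset_adjoin (Or.inr ⟨η, rfl⟩)⟩

variable (k n)

/-- The maximal ideal generated by the variables. -/
def maxIdeal : Ideal (Poly k n) := Ideal.span (Set.range MvPolynomial.X)

variable {k n}

lemma apply_mem_maxIdeal {η : VF k (Poly k n)}
    (h : η ∈ maxIdeal k n • (⊤ : Submodule (Poly k n) (VF k (Poly k n)))) (f : Poly k n) :
    η f ∈ maxIdeal k n := by
  induction h using Submodule.smul_induction_on' with
  | smul r hr η _ => exact Ideal.mul_mem_right _ _ hr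
  | add x _ y _ hx hy => exact Ideal.add_mem _ hx hy

variable (k n)

/-- `L₊ = 𝔪 L`, where `L` is the Lie algebra of derivations of `k[X₁, …, Xₙ]`. -/
def LPlus : LieSubalgebra k (VF k (Poly k n)) where
  __ := (maxIdeal k n • (⊤ : Submodule (Poly k n) (VF k (Poly k n)))).restrictScalars k
  lie_mem' := by
    intro η μ hη hμ
    change ⁅η, μ⁆ ∈ maxIdeal k n • (⊤ : Submodule (Poly k n) (VF k (Poly k n)))
    change η ∈ maxIdeal k n • (⊤ : Submodule (Poly k n) (VF k (Poly k n))) at hη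
    change μ ∈ maxIdeal k n • (⊤ : Submodule (Poly k n) (VF k (Poly k n))) at hμ
    induction hη using Submodule.smul_induction_on' with
    | smul r hr η _ =>
      have : ⁅r • η, μ⁆ = r • ⁅η, μ⁆ - μ r • η := by
        ext i
        simp only [Derivation.commutator_apply, Derivation.smul_apply, Derivation.sub_apply,
          Derivation.leibniz, smul_eq_mul, mul_sub, mul_comm (μ r)]
        congr 1
        abel
      rw [this]
      exact Submodule.sub_mem _ (Submodule.smul_mem_smul hr trivial)
        (Submodule.smul_mem_smul (apply_mem_maxIdeal hμ r) trivial)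
    | add x _ y _ hx hy =>
      have : ⁅x + y, μ⁆ = ⁅x, μ⁆ + ⁅y, μ⁆ := by
        ext i
        simp [Derivation.commutator_apply]
        abel
      rw [this]
      exact Submodule.add_mem _ hx hy

variable {n}

/-- The monomial `x^a`. -/
abbrev mono (a : Fin n →₀ ℕ) : Poly k n := MvPolynomial.monomial a 1

/-- The vector field `x^a ∂/∂xᵢ`. -/
def monoVF (a : Fin n →₀ ℕ) (i : Fin n) : VF k (Poly k n) :=
  mono k a • MvPolynomial.pderiv i

lemma mono_mem_maxIdeal (a : Fin n →₀ ℕ) (ha : a ≠ 0) : mono k a ∈ maxIdeal k n := by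
  obtain ⟨j, hj⟩ := Finsupp.ne_iff.1 ha
  have h1 : Finsupp.single j 1 ≤ a := by
    rw [Finsupp.single_le_iff]; exact Nat.one_le_iff_ne_zero.2 hj
  have : mono k a = mono k (a - Finsupp.single j 1) * MvPolynomial.X j := by
    rw [MvPolynomial.X, MvPolynomial.monomial_mul, tsub_add_cancel_of_le h1, one_mul]
  rw [this]
  exact Ideal.mul_mem_left _ _ (Ideal.subset_span ⟨j, rfl⟩)

lemma monoVF_mem (a : Fin n →₀ ℕ) (ha : a ≠ 0) (i : Fin n) : monoVF k a i ∈ LPlus k n := by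
  have h : mono k a • MvPolynomial.pderiv i ∈
      maxIdeal k n • (⊤ : Submodule (Poly k n) (VF k (Poly k n))) :=
    Submodule.smul_mem_smul (mono_mem_maxIdeal k a ha) Submodule.mem_top
  exact h

/-- The element `X^a ∂/∂Xᵢ` of `L₊`, for `a ≠ 0`. -/
def monoLPlus (a : Fin n →₀ ℕ) (ha : a ≠ 0) (i : Fin n) : LPlus k n :=
  ⟨monoVF k a i, monoVF_mem k a ha i⟩

/-- The multi-index binomial coefficient `∏ᵢ (aᵢ choose bᵢ)`. -/
def multiChoose (a b : Fin n →₀ ℕ) : ℕ := ∏ i, (a i).choose (b i)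

variable (n)

/-- An isomorphism of `AV`-modules from `P ⊗ Q` to `N`, where the `D`-module `P` and the
`L₊`-module `Q` are tensored over `k` and `P ⊗ Q` carries the `AV`-action
`x^a (p ⊗ q) = x^a p ⊗ q`,
`(x^a ∂ᵢ) (p ⊗ q) = (x^a ∂ᵢ p) ⊗ q + ∑_{0 < b ≤ a} (a choose b) (x^(a-b) p) ⊗ (X^b ∂/∂Xᵢ q)`.
The `x^a` and `x^a ∂ᵢ` are bases of `A` and `V`, which generate the algebra `A # U(V)`. -/
structure TensorIso (P : Type*) [AddCommGroup P] [Module k P] [Module (Weyl k n) P]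
    (Q : Type*) [AddCommGroup Q] [Module k Q] [LieRingModule (LPlus k n) Q]
    (N : Type*) [AddCommGroup N] [Module k N] [Module (AVAlg k n) N]
    extends P ⊗[k] Q ≃ₗ[k] N where
  map_mono : ∀ (a : Fin n →₀ ℕ) (p : P) (q : Q),
    toFun ((Weyl.ofFun (mono k a) • p) ⊗ₜ q) =
      (Smash.ofFun (mono k a) : AVAlg k n) • toFun (p ⊗ₜ q)
  map_monoVF : ∀ (a : Fin n →₀ ℕ) (i : Fin n) (p : P) (q : Q),
    toFun ((Weyl.ofVF (monoVF k a i) • p) ⊗ₜ q +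
        ∑ b ∈ (Finset.Ioc 0 a).attach,
          multiChoose a b.1 •
            ((Weyl.ofFun (mono k (a - b.1)) • p) ⊗ₜ
              ⁅monoLPlus k b.1 (Finset.mem_Ioc.1 b.2).1.ne' i, q⁆)) =
      (Smash.ofVF (monoVF k a i) : AVAlg k n) • toFun (p ⊗ₜ q)

end Affine

end AVMod

end

noncomputable section

namespace AVMod

/-! ### Growth of images of polynomial spaces -/

section Growth

open MvPolynomial MonomialOrder

variable {σ : Type*} [Fintype σ] {k : Type*} [Field k] {W : Type*} [AddCommGroup W] [Module k W]

/-! The smash product contains two commuting pieces. The elements `x^a # 1` and `1 # ∂ᵢ` satisfy the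
Weyl relations, so `D` maps to `A # U(V)` (`weylToSmash`). Substituting the differences `1 ⊗ x - x ⊗
1` into the coefficients of a vector field gives a map `jetMap` that is a Lie homomorphism on `L₊`
and whose values there commute with the copy of `D`. The binomial expansion of `x = x' + (x - x')`
recovers every `x^a ∂ᵢ` from the two pieces (`vfHom_monoVF`). So `M` is a `D`-module on which `L₊`
acts by `D`-endomorphisms, and it suffices to find a simple submodule `D v` and a finite-dimensional
`L₊`-stable space `Q ∋ v` annihilated by `Ann v`.

The vector `v`. Leading monomials of symbols of operators killing a vector are closed under
multiplication by variables, so the growth of `F_m v` (Bernstein filtration) is either `O(m ^ d)` or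
at least of order `m ^ (d + 1)` (`growth_dichotomy`). Together with Bernstein's inequality this
bounds the growth of every nonzero vector of every `D`-module below by `δ m ^ n`, with `δ` depending
on `n` only. In `M` the Gelfand–Kirillov dimension keeps growth below order `m ^ (n + 1/2)`, hence
it is `O(m ^ n)`. A vector whose leading coefficient is within `δ / 4` of the infimum generates a
simple module, since passing to a proper nonzero submodule would lower the coefficient by about `δ`
(`exists_simple_vector`).

The space `Q`. Let `J` be spanned by `1` and the images of finitely many generators of `L₊`. All
vectors of `J^m v` are annihilated by `I = Ann v`. As `k` is uncountable and algebraically closed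
and `D` has countable dimension, `End_D (D ⧸ I) = k`, so `(D ⧸ I) ⊗ Q → M` is injective for every
space `Q` annihilated by `I` (`actMap_injective`). Therefore `dim F_m v * dim J^m v` is at most the
dimension of the space reached from `v` by words of length `2 m` in all generators, which is `O(m ^
(n + 1/2))`, and `dim J^m v = O(m ^ (1/2))`. A strictly increasing chain `J^m v` would have
dimension at least `m + 1`, so it stops, at an `L₊`-stable `Q`. The image of `(D ⧸ I) ⊗ Q` is the
required submodule. -/

/-- The exponents of leading monomials of nonzero elements of the kernel of `T`. -/
def leadExp [LinearOrder σ] (T : MvPolynomial σ k →ₗ[k] W) : Set (σ →₀ ℕ) :=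
  {s | ∃ p, p ≠ 0 ∧ T p = 0 ∧ degLex.degree p = s}

/-- Shifting a kernel element by any variable gives, up to terms of lower degree, a kernel
element. -/
def ShiftStable (T : MvPolynomial σ k →ₗ[k] W) : Prop :=
  ∀ i p, T p = 0 → ∃ r : MvPolynomial σ k, r.totalDegree ≤ p.totalDegree ∧ T (X i * p + r) = 0

lemma degLex_lt_of_degree_lt [LinearOrder σ] {s t : σ →₀ ℕ} (h : s.degree < t.degree) :
    degLex.toSyn s < degLex.toSyn t := by
  rw [degLex_lt_iff, Finsupp.DegLex.lt_iff]
  exact Or.inl h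

/-- The order is graded, so the correction `r`, whose total degree is at most that of `p`, cannot
reach the leading monomial of `X i * p`. -/
lemma leadExp_add_single [LinearOrder σ] {T : MvPolynomial σ k →ₗ[k] W} (hT : ShiftStable T)
    {s : σ →₀ ℕ} (hs : s ∈ leadExp T) (i : σ) : s + Finsupp.single i 1 ∈ leadExp T := by
  obtain ⟨p, hp, hTp, rfl⟩ := hs
  obtain ⟨r, hr, hTr⟩ := hT i p hTp
  have hX : (X i : MvPolynomial σ k) ≠ 0 := X_ne_zero i
  have hd : degLex.degree (X i * p) = degLex.degree p + Finsupp.single i 1 := by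
    rw [degree_mul hX hp, degree_X, add_comm]
  have hlt : degLex.toSyn (degLex.degree r) < degLex.toSyn (degLex.degree (X i * p)) := by
    apply degLex_lt_of_degree_lt
    rw [degree_degLexDegree, hd, map_add, degree_degLexDegree]
    simp; omega
  have hdeg := degree_add_of_lt hlt
  refine ⟨X i * p + r, ?_, hTr, by rw [hdeg, hd]⟩
  intro h0
  have h1 : degLex.leadingCoeff (X i * p + r) = degLex.leadingCoeff (X i * p) :=
    leadingCoeff_add_of_lt hlt
  rw [h0, leadingCoeff_zero, eq_comm, leadingCoeff_eq_zero_iff] at h1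
  exact mul_ne_zero hX hp h1

/-- The kernel of `T` need not be an ideal, but its leading exponents still form an upper set, as
for a monomial ideal. -/
lemma leadExp_mono [LinearOrder σ] {T : MvPolynomial σ k →ₗ[k] W} (hT : ShiftStable T)
    {s t : σ →₀ ℕ} (hs : s ∈ leadExp T) (h : s ≤ t) : t ∈ leadExp T := by
  obtain ⟨u, rfl⟩ := exists_add_of_le h
  clear h
  induction u using Finsupp.induction_linear generalizing s with
  | zero => simpa using hs
  | add f g hf hg => rw [← add_assoc]; exact hg (hf hs)
  | single i a =>
    induction a with
    | zero => simpa using hs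
    | succ a ih => rw [Finsupp.single_add, ← add_assoc]; exact leadExp_add_single hT ih i

/-- Gröbner-style reduction: a leading monomial of a kernel element is, under `T`, a combination of
smaller monomials. The graded order keeps the degree at most `m` throughout. -/
lemma map_monomial_mem_span [LinearOrder σ] (T : MvPolynomial σ k →ₗ[k] W) (m : ℕ)
    (s : σ →₀ ℕ) (hs : s.degree ≤ m) :
    T (monomial s 1) ∈ Submodule.span k
      ((fun t => T (monomial t 1)) '' {t | t ∉ leadExp T ∧ t.degree ≤ m}) := by
  induction hx : degLex.toSyn s using WellFoundedLT.induction generalizing s with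
  | ind x ih =>
  by_cases hmem : s ∈ leadExp T
  swap
  · exact Submodule.subset_span ⟨s, ⟨hmem, hs⟩, rfl⟩
  obtain ⟨p, hp, hTp, rfl⟩ := hmem
  set s := degLex.degree p
  have hc : p.coeff s ≠ 0 := by
    rw [← mem_support_iff]; exact degree_mem_support hp
  have hsum : T p = ∑ t ∈ p.support, p.coeff t • T (monomial t 1) := by
    conv_lhs => rw [p.as_sum]
    rw [map_sum]
    refine Finset.sum_congr rfl fun t _ => ?_
    rw [← map_smul, smul_monomial, smul_eq_mul, mul_one]
  rw [hTp, ← Finset.add_sum_erase _ _ (degree_mem_support hp)] at hsum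
  have h2 : T (monomial s 1) = -((p.coeff s)⁻¹ •
      ∑ t ∈ p.support.erase s, p.coeff t • T (monomial t 1)) := by
    rw [eq_neg_of_add_eq_zero_right hsum.symm, smul_neg, neg_neg, smul_smul, inv_mul_cancel₀ hc,
      one_smul]
  rw [h2]
  refine Submodule.neg_mem _ (Submodule.smul_mem _ _ (Submodule.sum_mem _ fun t ht => ?_))
  obtain ⟨hts, htp⟩ := Finset.mem_erase.1 ht
  have hle := degLex.le_degree htp
  refine Submodule.smul_mem _ _ (ih (degLex.toSyn t) ?_ t ?_ rfl)
  · rw [← hx]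
    exact lt_of_le_of_ne hle fun h => hts (degLex.toSyn.injective h)
  · exact (Finsupp.DegLex.monotone_degree hle).trans hs

variable (T : MvPolynomial σ k →ₗ[k] W)

/-- The dimension of the image under `T` of the space of polynomials of degree at most `m`. -/
def growth (m : ℕ) : ℕ := Module.finrank k (Submodule.map T (restrictTotalDegree σ k m))

/-- The image of polynomials of bounded degree under `T` has either dimension `O(m ^ d)` or `T` is
injective on the polynomials in some `d + 1` variables. -/
theorem growth_dichotomy (hT : ShiftStable T) (d : ℕ) :
    (∃ I : Finset σ, I.card = d + 1 ∧ ∀ p ∈ supported k (I : Set σ), T p = 0 → p = 0) ∨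
      ∃ C : ℕ, ∀ m, growth T m ≤ C * (m + 1) ^ d := by
  classical
  let : LinearOrder σ := LinearOrder.lift' (Fintype.equivFin σ) (Fintype.equivFin σ).injective
  by_cases hI : ∃ I : Finset σ, I.card = d + 1 ∧ ∀ p ∈ supported k (I : Set σ), T p = 0 → p = 0
  · exact Or.inl hI
  right
  push Not at hI
  choose! p hps hTp hp0 using hI
  -- One bound for all leading exponents of the chosen kernel elements `p I`; there are finitely
  -- many sets `I`.
  obtain ⟨K, hK⟩ : ∃ K : ℕ, ∀ I : Finset σ, ∀ i, degLex.degree (p I) i ≤ K := by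
    refine ⟨∑ I : Finset σ, ∑ i, degLex.degree (p I) i, fun I i => ?_⟩
    calc degLex.degree (p I) i ≤ ∑ i, degLex.degree (p I) i :=
          Finset.single_le_sum (f := fun i => degLex.degree (p I) i)
            (fun _ _ => Nat.zero_le _) (Finset.mem_univ i)
      _ ≤ _ := Finset.single_le_sum (f := fun I => ∑ i, degLex.degree (p I) i)
            (fun _ _ => Nat.zero_le _) (Finset.mem_univ I)
  -- If `d + 1` coordinates of `s`, forming a set `I`, exceeded `K`, then `s` would dominate the
  -- leading exponent of `p I`, which involves only variables in `I`.
  have hstd : ∀ s : σ →₀ ℕ, s ∉ leadExp T → (Finset.univ.filter fun i => K < s i).card ≤ d := by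
    intro s hs
    by_contra! hcard
    obtain ⟨I, hIs, hIc⟩ := Finset.exists_subset_card_eq (Nat.succ_le_of_lt hcard)
    refine hs (leadExp_mono hT ⟨p I, hp0 I hIc, hTp I hIc, rfl⟩ fun i => ?_)
    by_cases hi : i ∈ I
    · exact (hK I i).trans (Finset.mem_filter.1 (hIs hi)).2.le
    · have h1 := hps I hIc
      have h2 := degLex.degree_mem_support (hp0 I hIc)
      have h3 : degLex.degree (p I) i = 0 := by
        by_contra h3
        have : i ∈ (p I).vars := (mem_vars_iff_mem_support i).2 ⟨_, h2, Finsupp.mem_support_iff.2 h3⟩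
        exact hi (mem_supported.1 h1 this)
      rw [h3]; exact Nat.zero_le _
  -- Count standard exponents of degree at most `m`: choose the set `J` of at most `d` large
  -- coordinates, which range up to `m`; the others range up to `K`.
  refine ⟨2 ^ Fintype.card σ * (K + 1) ^ Fintype.card σ, fun m => ?_⟩
  let B : Finset (σ → ℕ) := (Finset.univ.filter fun J : Finset σ => J.card ≤ d).biUnion fun J =>
    Fintype.piFinset fun i => if i ∈ J then Finset.range (m + 1) else Finset.range (K + 1)
  have hB : B.card ≤ 2 ^ Fintype.card σ * (K + 1) ^ Fintype.card σ * (m + 1) ^ d := by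
    refine Finset.card_biUnion_le.trans ?_
    have h1 : ∀ J ∈ (Finset.univ.filter fun J : Finset σ => J.card ≤ d),
        (Fintype.piFinset fun i => if i ∈ J then Finset.range (m + 1)
          else Finset.range (K + 1)).card ≤ (K + 1) ^ Fintype.card σ * (m + 1) ^ d := by
      intro J hJ
      rw [Fintype.card_piFinset]
      have : ∀ i, (if i ∈ J then Finset.range (m + 1) else Finset.range (K + 1)).card ≤
          (K + 1) * (if i ∈ J then m + 1 else 1) := by
        intro i
        split_ifs <;> simp
      refine (Finset.prod_le_prod' fun i _ => this i).trans ?_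
      rw [Finset.prod_mul_distrib, Finset.prod_const, Finset.card_univ, Finset.prod_ite_mem,
        Finset.univ_inter, Finset.prod_const]
      exact Nat.mul_le_mul_left _ (Nat.pow_le_pow_right (Nat.succ_pos _) (Finset.mem_filter.1 hJ).2)
    refine (Finset.sum_le_card_nsmul _ _ _ h1).trans ?_
    rw [smul_eq_mul, mul_assoc]
    refine Nat.mul_le_mul_right _ ((Finset.card_filter_le _ _).trans ?_)
    simp
  refine le_trans ?_ hB
  have hspan : Submodule.map T (restrictTotalDegree σ k m) ≤
      Submodule.span k (B.image fun f => T (monomial (Finsupp.equivFunOnFinite.symm f) 1) :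
        Finset W) := by
    rintro _ ⟨q, hq, rfl⟩
    rw [q.as_sum, map_sum]
    refine Submodule.sum_mem _ fun s hs => ?_
    have hsd : s.degree ≤ m :=
      (le_totalDegree hs).trans ((mem_restrictTotalDegree _ _ _).1 hq)
    have : monomial s (coeff s q) = coeff s q • (monomial s (1 : k)) := by
      rw [smul_monomial, smul_eq_mul, mul_one]
    rw [this, map_smul]
    refine Submodule.smul_mem _ _ (Submodule.span_mono ?_ (map_monomial_mem_span T m s hsd))
    rintro _ ⟨t, ⟨ht, htm⟩, rfl⟩
    refine Finset.mem_coe.2 (Finset.mem_image.2 ⟨Finsupp.equivFunOnFinite t, ?_, by simp⟩)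
    refine Finset.mem_biUnion.2 ⟨Finset.univ.filter fun i => K < t i,
      Finset.mem_filter.2 ⟨Finset.mem_univ _, hstd t ht⟩, Fintype.mem_piFinset.2 fun i => ?_⟩
    have hti : t i ≤ m := (Finsupp.le_degree i t).trans htm
    split_ifs with h
    · simp; omega
    · simp at h ⊢; omega
  exact (Submodule.finrank_mono hspan).trans
    ((finrank_span_finset_le_card _).trans Finset.card_image_le)

/-- The growth is at least that of the polynomial ring in `d` variables if `T` is injective on it.
-/
theorem le_growth (I : Finset σ) (hI : ∀ p ∈ supported k (I : Set σ), T p = 0 → p = 0) (m : ℕ) :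
    (m / (I.card + 1) + 1) ^ I.card ≤ growth T m := by
  classical
  -- Exponents in the box `[0, q]^I` have degree at most `|I| q ≤ m`; the `+ 1` keeps the divisor
  -- positive for empty `I`.
  let q := m / (I.card + 1)
  let e : (I → Fin (q + 1)) → (σ →₀ ℕ) := fun f =>
    Finsupp.equivFunOnFinite.symm fun i => if h : i ∈ I then (f ⟨i, h⟩ : ℕ) else 0
  have he : Function.Injective e := by
    intro f g hfg
    funext i
    have := DFunLike.congr_fun hfg (i : σ)
    simp only [e, Finsupp.equivFunOnFinite_symm_apply_apply, i.2, dite_true] at this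
    exact Fin.ext this
  have hdeg : ∀ f, (e f).degree ≤ m := by
    intro f
    have h1 : (e f).degree = ∑ i, e f i := Finsupp.degree_eq_sum _
    have h2 : ∀ i, e f i ≤ if i ∈ I then q else 0 := by
      intro i
      simp only [e, Finsupp.equivFunOnFinite_symm_apply_apply]
      split_ifs with h
      · exact Nat.lt_succ_iff.1 (f ⟨i, h⟩).2
      · exact le_rfl
    rw [h1]
    refine (Finset.sum_le_sum fun i _ => h2 i).trans ?_
    rw [Finset.sum_ite_mem, Finset.univ_inter, Finset.sum_const, smul_eq_mul]
    calc I.card * q ≤ (I.card + 1) * q := Nat.mul_le_mul_right _ (Nat.le_succ _)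
      _ ≤ m := Nat.mul_div_le _ _
  have hli : LinearIndependent k fun f => T (monomial (e f) 1) := by
    rw [linearIndependent_iff']
    intro s g hg f hf
    have h0 : ∑ f ∈ s, g f • monomial (e f) (1 : k) = 0 := by
      apply hI
      · refine Subalgebra.sum_mem _ fun f _ => Subalgebra.smul_mem _ ?_ _
        rw [mem_supported]
        intro i hi
        rw [vars_monomial one_ne_zero] at hi
        by_contra h
        rw [Finset.mem_coe] at h
        simp [e, h] at hi
      · rw [map_sum, ← hg]
        simp
    have h1 := congrArg (coeff (e f)) h0
    rw [coeff_sum, coeff_zero, Finset.sum_eq_single f] at h1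
    · simpa using h1
    · intro f' _ hne
      rw [coeff_smul, coeff_monomial, if_neg fun h => hne (he h), smul_zero]
    · intro h; exact absurd hf h
  let w : (I → Fin (q + 1)) → Submodule.map T (restrictTotalDegree σ k m) := fun f =>
    ⟨T (monomial (e f) 1), _, (mem_restrictTotalDegree _ _ _).2
      ((totalDegree_monomial_le _ _).trans (hdeg f)), rfl⟩
  have hw : LinearIndependent k w :=
    LinearIndependent.of_comp (Submodule.subtype _) hli
  have := hw.fintype_card_le_finrank
  simpa [growth] using this

end Growth

end AVMod

namespace AVMod

/-! ### Normal ordering of differential operators -/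

section NormalOrder

open MvPolynomial

variable {k : Type u} [Field k] {n : ℕ}

/-- The derivation `1 ⊗ ∂ᵢ` of `A ⊗ A`. -/
def pderivRight (i : Fin n) : Poly k n ⊗[k] Poly k n →ₗ[k] Poly k n ⊗[k] Poly k n :=
  LinearMap.lTensor _ (pderiv i : VF k (Poly k n)).toLinearMap

/-- The derivation `∂ᵢ ⊗ 1` of `A ⊗ A`. -/
def pderivLeft (i : Fin n) : Poly k n ⊗[k] Poly k n →ₗ[k] Poly k n ⊗[k] Poly k n :=
  LinearMap.rTensor _ (pderiv i : VF k (Poly k n)).toLinearMap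

@[simp] lemma pderivRight_tmul (i : Fin n) (f g : Poly k n) :
    pderivRight i (f ⊗ₜ[k] g) = f ⊗ₜ pderiv i g := rfl

@[simp] lemma pderivLeft_tmul (i : Fin n) (f g : Poly k n) :
    pderivLeft i (f ⊗ₜ[k] g) = pderiv i f ⊗ₜ g := rfl

lemma pderivRight_mul (i : Fin n) (x y : Poly k n ⊗[k] Poly k n) :
    pderivRight i (x * y) = pderivRight i x * y + x * pderivRight i y := by
  induction x with
  | zero => simp
  | add x x' hx hx' => simp only [add_mul, map_add, hx, hx']; abel
  | tmul f g =>
    induction y with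
    | zero => simp
    | add y y' hy hy' => simp only [mul_add, map_add, hy, hy']; abel
    | tmul f' g' =>
      simp only [Algebra.TensorProduct.tmul_mul_tmul, pderivRight_tmul, Derivation.leibniz,
        TensorProduct.tmul_add, smul_eq_mul]
      rw [mul_comm g', add_comm]

lemma pderivLeft_mul (i : Fin n) (x y : Poly k n ⊗[k] Poly k n) :
    pderivLeft i (x * y) = pderivLeft i x * y + x * pderivLeft i y := by
  induction x with
  | zero => simp
  | add x x' hx hx' => simp only [add_mul, map_add, hx, hx']; abel
  | tmul f g =>
    induction y with
    | zero => simp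
    | add y y' hy hy' => simp only [mul_add, map_add, hy, hy']; abel
    | tmul f' g' =>
      simp only [Algebra.TensorProduct.tmul_mul_tmul, pderivLeft_tmul, Derivation.leibniz,
        TensorProduct.add_tmul, smul_eq_mul]
      rw [mul_comm f', add_comm]

variable (k n) in
/-- A polynomial in `2 n` variables as an element of `A ⊗ A`. -/
def splitVars : MvPolynomial (Fin n ⊕ Fin n) k →ₐ[k] Poly k n ⊗[k] Poly k n :=
  aeval (Sum.elim (fun i => X i ⊗ₜ 1) (fun i => 1 ⊗ₜ X i))

@[simp] lemma splitVars_X_inl (i : Fin n) : splitVars k n (X (Sum.inl i)) = X i ⊗ₜ 1 := by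
  simp [splitVars]

@[simp] lemma splitVars_X_inr (i : Fin n) : splitVars k n (X (Sum.inr i)) = 1 ⊗ₜ X i := by
  simp [splitVars]

@[simp] lemma splitVars_C (c : k) : splitVars k n (C c) = C c ⊗ₜ 1 := by
  simp only [splitVars, aeval_C]
  rfl

lemma splitVars_pderiv_inl (i : Fin n) (p : MvPolynomial (Fin n ⊕ Fin n) k) :
    splitVars k n (pderiv (Sum.inl i) p) = pderivLeft i (splitVars k n p) := by
  induction p using MvPolynomial.induction_on with
  | C c => simp
  | add p q hp hq => simp only [map_add, hp, hq]
  | mul_X p j hp =>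
    rw [pderiv_mul, map_add, map_mul, map_mul, map_mul, hp, pderivLeft_mul]
    congr 2
    rcases j with j | j
    · by_cases h : j = i
      · subst h; simp [Algebra.TensorProduct.one_def]
      · simp [pderiv_X_of_ne h, pderiv_X_of_ne (i := Sum.inl i) (j := Sum.inl j) (by simpa using h)]
    · simp [pderiv_X_of_ne (i := Sum.inl i) (j := Sum.inr j) (by simp)]

lemma splitVars_pderiv_inr (i : Fin n) (p : MvPolynomial (Fin n ⊕ Fin n) k) :
    splitVars k n (pderiv (Sum.inr i) p) = pderivRight i (splitVars k n p) := by
  induction p using MvPolynomial.induction_on with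
  | C c => simp
  | add p q hp hq => simp only [map_add, hp, hq]
  | mul_X p j hp =>
    rw [pderiv_mul, map_add, map_mul, map_mul, map_mul, hp, pderivRight_mul]
    congr 2
    rcases j with j | j
    · simp [pderiv_X_of_ne (i := Sum.inr i) (j := Sum.inl j) (by simp)]
    · by_cases h : j = i
      · subst h; simp [Algebra.TensorProduct.one_def]
      · simp [pderiv_X_of_ne h, pderiv_X_of_ne (i := Sum.inr i) (j := Sum.inr j) (by simpa using h)]

lemma totalDegree_pderiv_le {σ : Type*} (j : σ) (p : MvPolynomial σ k) :
    (pderiv j p).totalDegree ≤ p.totalDegree - 1 := by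
  classical
  conv_lhs => rw [p.as_sum, map_sum]
  refine totalDegree_finsetSum_le fun s hs => ?_
  rw [pderiv_monomial]
  by_cases h : s j = 0
  · simp [h]
  · refine (totalDegree_monomial_le _ _).trans ?_
    have h1 : s.degree ≤ p.totalDegree := le_totalDegree hs
    have h2 : s - Finsupp.single j 1 + Finsupp.single j 1 = s :=
      tsub_add_cancel_of_le (by rw [Finsupp.single_le_iff]; omega)
    have h3 := congrArg Finsupp.degree h2
    rw [map_add, Finsupp.degree_single] at h3
    change (s - Finsupp.single j 1).degree ≤ _
    omega

/-- The coefficient at `s ≠ 0` appears in `pderiv j p` multiplied by `s j`, which is invertible in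
characteristic zero when `s j ≠ 0`. -/
lemma eq_C_of_pderiv_eq_zero [CharZero k] {σ : Type*} {p : MvPolynomial σ k}
    (h : ∀ j, pderiv j p = 0) : ∃ c, p = C c := by
  classical
  refine ⟨p.coeff 0, MvPolynomial.ext _ _ fun s => ?_⟩
  rw [coeff_C]
  split_ifs with hs
  · rw [hs]
  obtain ⟨j, hj⟩ := Finsupp.ne_iff.1 (Ne.symm hs)
  have h2 : s - Finsupp.single j 1 + Finsupp.single j 1 = s :=
    tsub_add_cancel_of_le (by
      rw [Finsupp.single_le_iff]; exact Nat.one_le_iff_ne_zero.2 hj)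
  have h1 := congrArg (coeff (s - Finsupp.single j 1)) (h j)
  rw [coeff_zero, coeff_pderiv, h2] at h1
  rcases mul_eq_zero.1 h1 with h3 | h3
  · exact h3
  · exfalso
    have : (((s - Finsupp.single j 1 : σ →₀ ℕ) j + 1 : ℕ) : k) = 0 := by push_cast; exact h3
    rw [Nat.cast_eq_zero] at this
    omega

/-- A polynomial vanishes if it has a property that is inherited by derivatives and that no nonzero
constant has. -/
lemma eq_zero_of_pderiv_induction [CharZero k] {σ : Type*} {P : ℕ → MvPolynomial σ k → Prop}
    (hP : ∀ m p j, P (m + 1) p → P m (pderiv j p)) (hC : ∀ m c, P m (C c) → c = 0)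
    (m : ℕ) (p : MvPolynomial σ k) (hp : p.totalDegree ≤ m) (h : P m p) : p = 0 := by
  induction m generalizing p with
  | zero =>
    rw [Nat.le_zero, totalDegree_eq_zero_iff_eq_C] at hp
    rw [hp] at h ⊢
    rw [hC _ _ h, C_0]
  | succ m ih =>
    obtain ⟨c, rfl⟩ := eq_C_of_pderiv_eq_zero (p := p) fun j =>
      ih _ ((totalDegree_pderiv_le j p).trans (by omega)) (hP m p j h)
    rw [hC _ _ h, C_0]

variable {R : Type*} [Ring R] [Algebra k R]

/-- The defining relations of the Weyl algebra for a homomorphism `φ` from `A` and elements `dᵢ`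
that play the role of the partial derivatives. -/
structure WeylRel (φ : Poly k n →ₐ[k] R) (d : Fin n → R) : Prop where
  comm : ∀ i j, d i * d j = d j * d i
  rel : ∀ i f, d i * φ f = φ f * d i + φ (pderiv i f)

open scoped IsMulCommutative in
/-- Evaluation of polynomials at commuting elements of a noncommutative algebra. -/
def commAeval (d : Fin n → R) (h : ∀ i j, d i * d j = d j * d i) : Poly k n →ₐ[k] R :=
  have := Algebra.isMulCommutative_adjoin k (s := Set.range d) (by
    rintro _ ⟨i, rfl⟩ _ ⟨j, rfl⟩; exact h i j)
  (Algebra.adjoin k (Set.range d)).val.comp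
    (aeval fun i => (⟨d i, Algebra.subset_adjoin ⟨i, rfl⟩⟩ : Algebra.adjoin k (Set.range d)))

open scoped IsMulCommutative in
@[simp] lemma commAeval_X (d : Fin n → R) (h : ∀ i j, d i * d j = d j * d i) (i : Fin n) :
    commAeval (k := k) d h (X i) = d i := by
  have := Algebra.isMulCommutative_adjoin k (s := Set.range d) (by
    rintro _ ⟨i, rfl⟩ _ ⟨j, rfl⟩; exact h i j)
  simp only [commAeval, AlgHom.comp_apply]
  rw [aeval_X]
  rfl

namespace WeylRel

variable {φ : Poly k n →ₐ[k] R} {d : Fin n → R} (h : WeylRel φ d)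

/-- The map `f ⊗ g ↦ f(x) g(∂)`. -/
def tensorMap : Poly k n ⊗[k] Poly k n →ₗ[k] R :=
  TensorProduct.lift ((LinearMap.mul k R).compl₁₂ φ.toLinearMap (commAeval d h.comm).toLinearMap)

lemma tensorMap_tmul (f g : Poly k n) : h.tensorMap (f ⊗ₜ g) = φ f * commAeval d h.comm g := by
  simp [tensorMap]

/-- The operator whose normally ordered symbol is a given polynomial in `2 n` variables. -/
def normalOrder : MvPolynomial (Fin n ⊕ Fin n) k →ₗ[k] R :=
  h.tensorMap ∘ₗ (splitVars k n).toLinearMap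

lemma normalOrder_apply (p) : h.normalOrder p = h.tensorMap (splitVars k n p) := rfl

lemma normalOrder_C (c : k) : h.normalOrder (C c) = algebraMap k R c := by
  rw [normalOrder_apply, splitVars_C, tensorMap_tmul, map_one, mul_one]
  exact φ.commutes c

lemma normalOrder_one : h.normalOrder 1 = 1 := by
  rw [← C_1, normalOrder_C, map_one]

lemma normalOrder_X_inl_mul (i : Fin n) (p) :
    h.normalOrder (X (Sum.inl i) * p) = φ (X i) * h.normalOrder p := by
  rw [normalOrder_apply, normalOrder_apply, map_mul, splitVars_X_inl]
  generalize splitVars k n p = x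
  induction x with
  | zero => simp
  | add x y hx hy => simp only [mul_add, map_add, hx, hy]
  | tmul f g =>
    simp only [Algebra.TensorProduct.tmul_mul_tmul, tensorMap_tmul, map_mul, one_mul, mul_assoc]

lemma commAeval_mul_comm (i : Fin n) (g : Poly k n) :
    d i * commAeval d h.comm g = commAeval d h.comm g * d i := by
  have := congrArg (commAeval d h.comm) (mul_comm (X i) g)
  simpa only [map_mul, commAeval_X] using this

/-- Moving `d i` to the right past the functions costs the derivative of the symbol in the
`x`-variable. This correction has lower degree, which is what the growth arguments need. -/
lemma mul_normalOrder (i : Fin n) (p) :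
    d i * h.normalOrder p = h.normalOrder (X (Sum.inr i) * p + pderiv (Sum.inl i) p) := by
  rw [map_add, normalOrder_apply, normalOrder_apply, normalOrder_apply, map_mul, splitVars_X_inr,
    splitVars_pderiv_inl]
  generalize splitVars k n p = x
  induction x with
  | zero => simp
  | add x y hx hy => simp only [mul_add, map_add, hx, hy]; abel
  | tmul f g =>
    simp only [Algebra.TensorProduct.tmul_mul_tmul, tensorMap_tmul, map_mul, one_mul,
      pderivLeft_tmul, commAeval_X]
    rw [← mul_assoc, h.rel, add_mul, mul_assoc]

lemma normalOrder_mul (i : Fin n) (p) :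
    h.normalOrder p * d i = h.normalOrder (X (Sum.inr i) * p) := by
  rw [normalOrder_apply, normalOrder_apply, map_mul, splitVars_X_inr]
  generalize splitVars k n p = x
  induction x with
  | zero => simp
  | add x y hx hy => simp only [mul_add, add_mul, map_add, hx, hy]
  | tmul f g =>
    simp only [Algebra.TensorProduct.tmul_mul_tmul, tensorMap_tmul, map_mul, one_mul, commAeval_X,
      mul_assoc, h.commAeval_mul_comm]

lemma commAeval_mul_map_X (i : Fin n) (g : Poly k n) :
    commAeval d h.comm g * φ (X i) =
      φ (X i) * commAeval d h.comm g + commAeval d h.comm (pderiv i g) := by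
  induction g using MvPolynomial.induction_on with
  | C c =>
    have : commAeval d h.comm (C c : Poly k n) = algebraMap k R c := (commAeval d h.comm).commutes c
    rw [pderiv_C, map_zero, add_zero, this, Algebra.commutes]
  | add p q hp hq => simp only [map_add, add_mul, mul_add, hp, hq]; abel
  | mul_X p j hp =>
    have hX : d j * φ (X i) = φ (X i) * d j + commAeval d h.comm (pderiv i (X j) : Poly k n) := by
      rw [h.rel]
      by_cases hij : i = j
      · subst hij; simp
      · rw [pderiv_X_of_ne hij, pderiv_X_of_ne (Ne.symm hij), map_zero, map_zero]
    rw [pderiv_mul, map_add, map_mul, map_mul, map_mul, commAeval_X, mul_assoc, hX, mul_add,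
      ← mul_assoc, hp, add_mul, mul_assoc]
    abel

lemma normalOrder_mul_map_X (i : Fin n) (p) :
    h.normalOrder p * φ (X i) =
      φ (X i) * h.normalOrder p + h.normalOrder (pderiv (Sum.inr i) p) := by
  simp only [normalOrder_apply, splitVars_pderiv_inr]
  generalize splitVars k n p = x
  induction x with
  | zero => simp
  | add x y hx hy => simp only [mul_add, add_mul, map_add, hx, hy]; abel
  | tmul f g =>
    simp only [tensorMap_tmul, pderivRight_tmul]
    rw [mul_assoc, h.commAeval_mul_map_X, mul_add, ← mul_assoc, ← mul_assoc, ← map_mul, ← map_mul,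
      mul_comm f]

/-- Normally ordered operators form the subalgebra generated by the `φ xᵢ` and the `dᵢ`. -/
lemma exists_normalOrder_eq {a : R}
    (ha : a ∈ Algebra.adjoin k (Set.range (fun i => φ (X i)) ∪ Set.range d)) :
    ∃ p, h.normalOrder p = a := by
  suffices H : ∀ p, ∃ q, h.normalOrder q = a * h.normalOrder p by
    obtain ⟨q, hq⟩ := H 1
    exact ⟨q, by rw [hq, normalOrder_one, mul_one]⟩
  induction ha using Algebra.adjoin_induction with
  | mem x hx =>
    rintro p
    rcases hx with ⟨i, rfl⟩ | ⟨i, rfl⟩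
    · exact ⟨_, h.normalOrder_X_inl_mul i p⟩
    · exact ⟨_, (h.mul_normalOrder i p).symm⟩
  | algebraMap c => exact fun p => ⟨c • p, by rw [map_smul, Algebra.smul_def]⟩
  | add x y _ _ hx hy =>
    intro p
    obtain ⟨q, hq⟩ := hx p
    obtain ⟨r, hr⟩ := hy p
    exact ⟨q + r, by rw [map_add, hq, hr, add_mul]⟩
  | mul x y _ _ hx hy =>
    intro p
    obtain ⟨q, hq⟩ := hy p
    obtain ⟨r, hr⟩ := hx q
    exact ⟨r, by rw [hr, hq, mul_assoc]⟩

/-- Commutators with generators differentiate symbols; this turns statements about operators into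
inductions on polynomials. -/
lemma normalOrder_pderiv_inr (i : Fin n) (p) : h.normalOrder (pderiv (Sum.inr i) p) =
    h.normalOrder p * φ (X i) - φ (X i) * h.normalOrder p := by
  rw [normalOrder_mul_map_X]; abel

lemma normalOrder_pderiv_inl (i : Fin n) (p) : h.normalOrder (pderiv (Sum.inl i) p) =
    d i * h.normalOrder p - h.normalOrder p * d i := by
  rw [mul_normalOrder, normalOrder_mul, map_add]; abel

/-- A symbol of the zero operator stays one under all partial derivatives, and the scalars embed in
the nontrivial algebra `R`. -/
lemma normalOrder_injective [CharZero k] [Nontrivial R] : Function.Injective h.normalOrder := by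
  rw [injective_iff_map_eq_zero]
  intro p hp
  refine eq_zero_of_pderiv_induction (P := fun _ p => h.normalOrder p = 0) ?_ ?_ _ p le_rfl hp
  · rintro m p (i | i) hp
    · rw [normalOrder_pderiv_inl, hp]; simp
    · rw [normalOrder_pderiv_inr, hp]; simp
  · intro m c hc
    rw [normalOrder_C] at hc
    exact (map_eq_zero _).1 hc

end WeylRel

/-! ### Presentation of the Weyl algebra -/

variable (k n) in
/-- The inclusion of `A` into the Weyl algebra. -/
def Weyl.funHom : Poly k n →ₐ[k] Weyl k n where
  toFun := Weyl.ofFun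
  map_one' := by ext f; simp [Weyl.ofFun]
  map_mul' f g := by ext f; simp [Weyl.ofFun]
  map_zero' := by ext f; simp [Weyl.ofFun]
  map_add' f g := by ext f; simp [Weyl.ofFun, add_mul]
  commutes' c := by
    apply Subtype.ext
    apply LinearMap.ext
    intro f
    exact (Algebra.smul_def c f).symm

variable (k) in
/-- The partial derivatives as elements of the Weyl algebra. -/
def Weyl.deriv (i : Fin n) : Weyl k n := Weyl.ofVF (pderiv i)

lemma Weyl.funHom_apply (f : Poly k n) : Weyl.funHom k n f = Weyl.ofFun f := rfl

lemma derivation_sum_apply {ι : Type*} (s : Finset ι) (D : ι → VF k (Poly k n)) (f : Poly k n) :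
    (∑ i ∈ s, D i) f = ∑ i ∈ s, D i f := by
  classical
  induction s using Finset.induction_on with
  | empty => simp
  | insert i s hi ih => rw [Finset.sum_insert hi, Finset.sum_insert hi, Derivation.add_apply, ih]

lemma derivation_eq_sum (η : VF k (Poly k n)) :
    η = ∑ i, η (X i) • (pderiv i : VF k (Poly k n)) := by
  apply MvPolynomial.derivation_ext
  intro j
  rw [derivation_sum_apply, Finset.sum_eq_single j]
  · simp
  · intro i _ hij
    simp [pderiv_X_of_ne hij.symm]
  · simp

lemma pderiv_comm (i j : Fin n) (f : Poly k n) :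
    pderiv i (pderiv j f) = pderiv j (pderiv i f) := by
  have : ⁅(pderiv i : VF k (Poly k n)), (pderiv j : VF k (Poly k n))⁆ = 0 := by
    apply MvPolynomial.derivation_ext
    intro l
    rw [Derivation.commutator_apply, pderiv_X, pderiv_X]
    simp only [Pi.single_apply]
    split_ifs <;> simp
  have h2 := congrArg (fun D : VF k (Poly k n) => D f) this
  simp only [Derivation.commutator_apply] at h2
  exact sub_eq_zero.1 h2

lemma Weyl.ofVF_smul (f : Poly k n) (η : VF k (Poly k n)) :
    Weyl.ofVF (f • η) = Weyl.ofFun f * Weyl.ofVF η := by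
  ext g; simp [Weyl.ofFun, Weyl.ofVF]

lemma weylRel : WeylRel (Weyl.funHom k n) (Weyl.deriv k) where
  comm i j := by
    apply Subtype.ext
    apply LinearMap.ext
    intro f
    exact pderiv_comm i j f
  rel i f := by
    apply Subtype.ext
    apply LinearMap.ext
    intro g
    change pderiv i (f * g) = f * pderiv i g + pderiv i f * g
    rw [pderiv_mul, add_comm]

/-- Every derivation is `∑ η(xᵢ) ∂ᵢ`, so coordinates and partial derivatives already generate. -/
lemma Weyl.mem_adjoin (a : Weyl k n) :
    a ∈ Algebra.adjoin k (Set.range (fun i => Weyl.funHom k n (X i)) ∪ Set.range (Weyl.deriv k)) := by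
  set B := Algebra.adjoin k
    (Set.range (fun i => Weyl.funHom k n (X i)) ∪ Set.range (Weyl.deriv k))
  have hfun : ∀ f, Weyl.ofFun f ∈ B := by
    intro f
    rw [← Weyl.funHom_apply]
    induction f using MvPolynomial.induction_on with
    | C c => exact (AlgHom.commutes (Weyl.funHom k n) c) ▸ B.algebraMap_mem c
    | add p q hp hq => rw [map_add]; exact B.add_mem hp hq
    | mul_X p i hp =>
      rw [map_mul]
      exact B.mul_mem hp (Algebra.subset_adjoin (Or.inl ⟨i, rfl⟩))
  have hvf : ∀ η, Weyl.ofVF η ∈ B := by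
    intro η
    have : Weyl.ofVF η = ∑ i, Weyl.ofFun (η (X i)) * Weyl.deriv k i := by
      apply Subtype.ext
      apply LinearMap.ext
      intro f
      conv_lhs => rw [derivation_eq_sum η]
      simp only [Weyl.ofVF, Weyl.ofFun, Weyl.deriv]
      push_cast
      simp [derivation_sum_apply]
    rw [this]
    exact B.sum_mem fun i _ => B.mul_mem (hfun _) (Algebra.subset_adjoin (Or.inr ⟨i, rfl⟩))
  have hle : Weyl k n ≤ B.map (Weyl k n).val := by
    refine Algebra.adjoin_le ?_
    rintro _ (⟨f, rfl⟩ | ⟨η, rfl⟩)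
    · exact ⟨_, hfun f, rfl⟩
    · exact ⟨_, hvf η, rfl⟩
  obtain ⟨b, hb, hba⟩ := hle a.2
  rwa [← Subtype.ext hba]

variable (k n) in
/-- The element of the Weyl algebra with a given normally ordered symbol. -/
abbrev Weyl.normalOrder : MvPolynomial (Fin n ⊕ Fin n) k →ₗ[k] Weyl k n := weylRel.normalOrder

lemma Weyl.normalOrder_surjective : Function.Surjective (Weyl.normalOrder k n) :=
  fun a => weylRel.exists_normalOrder_eq (Weyl.mem_adjoin a)

variable [CharZero k]

variable (k n) in
/-- Normal ordering as a linear isomorphism. -/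
def Weyl.symbolEquiv : MvPolynomial (Fin n ⊕ Fin n) k ≃ₗ[k] Weyl k n :=
  LinearEquiv.ofBijective (Weyl.normalOrder k n)
    ⟨weylRel.normalOrder_injective, Weyl.normalOrder_surjective⟩

/-- The universal property of the Weyl algebra. -/
theorem WeylRel.exists_algHom {φ : Poly k n →ₐ[k] R} {d : Fin n → R} (h : WeylRel φ d) :
    ∃ F : Weyl k n →ₐ[k] R, (∀ f, F (Weyl.ofFun f) = φ f) ∧ ∀ i, F (Weyl.deriv k i) = d i := by
  -- Send an operator to the element of `R` with the same symbol. Left multiplication by generators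
  -- has the same formula on symbols on both sides, which gives multiplicativity.
  let F : Weyl k n →ₗ[k] R := h.normalOrder ∘ₗ (Weyl.symbolEquiv k n).symm.toLinearMap
  have hF : ∀ p, F (Weyl.normalOrder k n p) = h.normalOrder p := fun p =>
    congrArg h.normalOrder ((Weyl.symbolEquiv k n).symm_apply_apply p)
  have h1 : F 1 = 1 := by
    have := hF 1
    rwa [WeylRel.normalOrder_one, WeylRel.normalOrder_one] at this
  have hX : ∀ i a, F (Weyl.funHom k n (X i) * a) = φ (X i) * F a := by
    intro i a
    obtain ⟨p, rfl⟩ := Weyl.normalOrder_surjective a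
    rw [← weylRel.normalOrder_X_inl_mul, hF, hF, h.normalOrder_X_inl_mul]
  have hd : ∀ i a, F (Weyl.deriv k i * a) = d i * F a := by
    intro i a
    obtain ⟨p, rfl⟩ := Weyl.normalOrder_surjective a
    rw [weylRel.mul_normalOrder, hF, hF, h.mul_normalOrder]
  -- The condition on `a`, for all `b` at once, passes to sums and products, so it need only be
  -- checked on generators.
  have hmul : ∀ a b, F (a * b) = F a * F b := by
    intro a
    induction Weyl.mem_adjoin a using Algebra.adjoin_induction with
    | mem x hx =>
      intro b
      rcases hx with ⟨i, rfl⟩ | ⟨i, rfl⟩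
      · have h2 := hX i 1
        rw [mul_one, h1, mul_one] at h2
        change F (Weyl.funHom k n (X i) * b) = F (Weyl.funHom k n (X i)) * F b
        rw [hX, h2]
      · have h2 := hd i 1
        rw [mul_one, h1, mul_one] at h2
        rw [hd, h2]
    | algebraMap c =>
      intro b
      rw [← Algebra.smul_def, map_smul, Algebra.algebraMap_eq_smul_one, map_smul, h1,
        smul_mul_assoc, one_mul]
    | add x y _ _ hx hy => intro b; rw [add_mul, map_add, hx, hy, map_add, add_mul]
    | mul x y _ _ hx hy => intro b; rw [mul_assoc, hx, hy, hx, mul_assoc]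
  let F' : Weyl k n →ₐ[k] R := AlgHom.ofLinearMap F h1 hmul
  refine ⟨F', fun f => ?_, fun i => ?_⟩
  · have : F'.comp (Weyl.funHom k n) = φ := by
      apply MvPolynomial.algHom_ext
      intro i
      have h2 := hX i 1
      rwa [mul_one, h1, mul_one] at h2
    exact DFunLike.congr_fun this f
  · have h2 := hd i 1
    rwa [mul_one, h1, mul_one] at h2

variable (k n) in
/-- The Weyl algebra as a ring of its own. -/
def WeylRing : Type u := Weyl k n

end NormalOrder

/-! ### The Weyl algebra as a separate type, with its normal ordering -/

section WeylRing

open MvPolynomial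

variable (k : Type u) [Field k] (n : ℕ)

instance : Ring (WeylRing k n) := inferInstanceAs (Ring (Weyl k n))

instance : Algebra k (WeylRing k n) := inferInstanceAs (Algebra k (Weyl k n))

/-- The inclusion of `A` into the Weyl algebra. -/
def WeylRing.funHom : Poly k n →ₐ[k] WeylRing k n := Weyl.funHom k n

variable {n}

/-- The partial derivatives as elements of the Weyl algebra. -/
def WeylRing.deriv (i : Fin n) : WeylRing k n := Weyl.deriv k i

variable {k}

lemma weylRing_rel : WeylRel (WeylRing.funHom k n) (WeylRing.deriv k) := ⟨weylRel.comm, weylRel.rel⟩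

lemma WeylRing.mem_adjoin (a : WeylRing k n) : a ∈ Algebra.adjoin k
    (Set.range (fun i => WeylRing.funHom k n (X i)) ∪ Set.range (WeylRing.deriv k)) :=
  Weyl.mem_adjoin a

variable (k n) in
/-- The element of the Weyl algebra with a given normally ordered symbol. -/
abbrev WeylRing.normalOrder : MvPolynomial (Fin n ⊕ Fin n) k →ₗ[k] WeylRing k n :=
  weylRing_rel.normalOrder

lemma WeylRing.normalOrder_surjective : Function.Surjective (WeylRing.normalOrder k n) :=
  fun a => weylRing_rel.exists_normalOrder_eq (WeylRing.mem_adjoin a)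

theorem WeylRel.exists_weylRing_algHom [CharZero k] {R : Type*} [Ring R] [Algebra k R]
    {φ : Poly k n →ₐ[k] R} {d : Fin n → R} (h : WeylRel φ d) :
    ∃ F : WeylRing k n →ₐ[k] R,
      (∀ f, F (WeylRing.funHom k n f) = φ f) ∧ ∀ i, F (WeylRing.deriv k i) = d i :=
  h.exists_algHom

end WeylRing

end AVMod

namespace AVMod

/-! ### Growth of modules over the Weyl algebra -/

section WeylGrowth

open MvPolynomial Filter

variable (k : Type u) [Field k] (n : ℕ)

/-- The span of `1`, the variables and the partial derivatives in the Weyl algebra. -/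
def WeylRing.gens : Submodule k (WeylRing k n) :=
  Submodule.span k
    ({1} ∪ (Set.range (fun i => WeylRing.funHom k n (X i)) ∪ Set.range (WeylRing.deriv k)))

/-- The Bernstein filtration: operators with normally ordered symbol of degree at most `m`. -/
def WeylRing.bernstein (m : ℕ) : Submodule k (WeylRing k n) :=
  Submodule.map (WeylRing.normalOrder k n) (restrictTotalDegree _ k m)

variable {k n}

lemma WeylRing.one_mem_gens : (1 : WeylRing k n) ∈ WeylRing.gens k n :=
  Submodule.subset_span (Or.inl rfl)

lemma WeylRing.fun_mem_gens (i : Fin n) : WeylRing.funHom k n (X i) ∈ WeylRing.gens k n :=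
  Submodule.subset_span (Or.inr (Or.inl ⟨i, rfl⟩))

lemma WeylRing.deriv_mem_gens (i : Fin n) : WeylRing.deriv k i ∈ WeylRing.gens k n :=
  Submodule.subset_span (Or.inr (Or.inr ⟨i, rfl⟩))

instance : FiniteDimensional k (WeylRing.gens k n) :=
  FiniteDimensional.span_of_finite k
    ((Set.finite_singleton _).union ((Set.finite_range _).union (Set.finite_range _)))

lemma WeylRing.adjoin_gens : Algebra.adjoin k (WeylRing.gens k n : Set (WeylRing k n)) = ⊤ := by
  refine eq_top_iff.2 fun a _ => ?_
  exact Algebra.adjoin_mono (fun x hx => Submodule.subset_span (Or.inr hx)) (WeylRing.mem_adjoin a)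

lemma WeylRing.normalOrder_mem_bernstein {p : MvPolynomial (Fin n ⊕ Fin n) k} {m : ℕ}
    (h : p.totalDegree ≤ m) : WeylRing.normalOrder k n p ∈ WeylRing.bernstein k n m :=
  ⟨p, (mem_restrictTotalDegree _ _ _).2 h, rfl⟩

lemma WeylRing.exists_mem_bernstein (a : WeylRing k n) : ∃ r, a ∈ WeylRing.bernstein k n r := by
  obtain ⟨p, rfl⟩ := WeylRing.normalOrder_surjective a
  exact ⟨_, WeylRing.normalOrder_mem_bernstein le_rfl⟩

lemma totalDegree_X_mul_le {σ : Type*} (j : σ) (p : MvPolynomial σ k) :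
    (X j * p).totalDegree ≤ p.totalDegree + 1 := by
  refine (totalDegree_mul _ _).trans ?_
  rw [totalDegree_X]; omega

/-- Filtering by degree of symbols and by word length in the generators agree, because reordering
only produces terms of lower degree. This ties symbol counts to the spaces `C ^ m • M₀` of the
Gelfand–Kirillov dimension. -/
lemma WeylRing.gens_mul_bernstein (m : ℕ) :
    WeylRing.gens k n * WeylRing.bernstein k n m = WeylRing.bernstein k n (m + 1) := by
  apply le_antisymm
  · rw [Submodule.mul_le]
    rintro a ha _ ⟨p, hp, rfl⟩
    replace hp := (mem_restrictTotalDegree _ _ _).1 hp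
    induction ha using Submodule.span_induction with
    | mem x hx =>
      rcases hx with rfl | ⟨i, rfl⟩ | ⟨i, rfl⟩
      · rw [one_mul]
        exact WeylRing.normalOrder_mem_bernstein (by omega)
      · change WeylRing.funHom k n (X i) * _ ∈ _
        rw [← weylRing_rel.normalOrder_X_inl_mul]
        exact WeylRing.normalOrder_mem_bernstein ((totalDegree_X_mul_le _ _).trans (by omega))
      · rw [weylRing_rel.mul_normalOrder]
        refine WeylRing.normalOrder_mem_bernstein ((totalDegree_add _ _).trans (max_le ?_ ?_))
        · exact (totalDegree_X_mul_le _ _).trans (by omega)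
        · exact (totalDegree_pderiv_le _ _).trans (by omega)
    | zero => rw [zero_mul]; exact Submodule.zero_mem _
    | add x y _ _ hx hy => rw [add_mul]; exact Submodule.add_mem _ hx hy
    | smul c x _ hx => rw [smul_mul_assoc]; exact Submodule.smul_mem _ _ hx
  · rintro _ ⟨p, hp, rfl⟩
    replace hp := (mem_restrictTotalDegree _ _ _).1 hp
    rw [p.as_sum, map_sum]
    refine Submodule.sum_mem _ fun s hs => ?_
    have hsd : s.degree ≤ m + 1 := (le_totalDegree hs).trans hp
    generalize coeff s p = c
    by_cases hsm : s.degree ≤ m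
    · rw [← one_mul (WeylRing.normalOrder k n _)]
      exact Submodule.mul_mem_mul WeylRing.one_mem_gens
        (WeylRing.normalOrder_mem_bernstein ((totalDegree_monomial_le _ _).trans hsm))
    obtain ⟨j, hj⟩ : ∃ j, s j ≠ 0 := by
      by_contra! h
      have : s = 0 := Finsupp.ext h
      simp [this] at hsm
    have h2 : Finsupp.single j 1 + (s - Finsupp.single j 1) = s :=
      add_tsub_cancel_of_le (by rw [Finsupp.single_le_iff]; omega)
    have h3 := congrArg Finsupp.degree h2
    rw [map_add, Finsupp.degree_single] at h3
    set t := s - Finsupp.single j 1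
    have hmon : monomial s c = X j * monomial t c := by
      rw [X, monomial_mul, h2, one_mul]
    have htd : (monomial t c).totalDegree ≤ m :=
      (totalDegree_monomial_le _ _).trans (by change t.degree ≤ m; omega)
    rw [hmon]
    rcases j with i | i
    · rw [WeylRel.normalOrder_X_inl_mul]
      exact Submodule.mul_mem_mul (WeylRing.fun_mem_gens i) (WeylRing.normalOrder_mem_bernstein htd)
    -- The product of `∂ᵢ` with the operator of symbol `monomial t c` is the wanted operator plus
    -- one whose symbol is a derivative; the latter is subtracted using `1 ∈ gens`.
    · have h4 := weylRing_rel.mul_normalOrder i (monomial t c)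
      rw [map_add] at h4
      rw [← sub_eq_of_eq_add h4, ← one_mul (WeylRing.normalOrder k n (pderiv _ _))]
      refine Submodule.sub_mem _ ?_ ?_
      · exact Submodule.mul_mem_mul (WeylRing.deriv_mem_gens i) (WeylRing.normalOrder_mem_bernstein htd)
      · exact Submodule.mul_mem_mul WeylRing.one_mem_gens
          (WeylRing.normalOrder_mem_bernstein ((totalDegree_pderiv_le _ _).trans (by omega)))

lemma WeylRing.bernstein_zero : WeylRing.bernstein k n 0 = 1 := by
  apply le_antisymm
  · rintro _ ⟨p, hp, rfl⟩
    replace hp := (mem_restrictTotalDegree _ _ _).1 hp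
    rw [Nat.le_zero, totalDegree_eq_zero_iff_eq_C] at hp
    rw [hp, WeylRel.normalOrder_C]
    exact Submodule.algebraMap_mem _
  · rw [Submodule.one_le, ← weylRing_rel.normalOrder_one]
    exact WeylRing.normalOrder_mem_bernstein (by simp)

lemma WeylRing.gens_pow (m : ℕ) : WeylRing.gens k n ^ m = WeylRing.bernstein k n m := by
  induction m with
  | zero => rw [pow_zero, WeylRing.bernstein_zero]
  | succ m ih => rw [pow_succ', ih, WeylRing.gens_mul_bernstein]

lemma WeylRing.bernstein_mul (a b : ℕ) :
    WeylRing.bernstein k n a * WeylRing.bernstein k n b = WeylRing.bernstein k n (a + b) := by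
  rw [← WeylRing.gens_pow, ← WeylRing.gens_pow, ← WeylRing.gens_pow, pow_add]

lemma WeylRing.bernstein_mono {a b : ℕ} (h : a ≤ b) : WeylRing.bernstein k n a ≤ WeylRing.bernstein k n b := by
  refine Submodule.map_mono fun p hp => ?_
  rw [mem_restrictTotalDegree] at hp ⊢
  exact hp.trans h

variable {V : Type*} [AddCommGroup V] [Module k V] [Module (WeylRing k n) V]
  [IsScalarTower k (WeylRing k n) V]

variable (k n) in
/-- The map from symbols to a module given by acting on a vector. -/
def orbitMap (v : V) : MvPolynomial (Fin n ⊕ Fin n) k →ₗ[k] V :=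
  (LinearMap.toSpanSingleton (WeylRing k n) V v).restrictScalars k ∘ₗ WeylRing.normalOrder k n

lemma orbitMap_apply (v : V) (p) : orbitMap k n v p = WeylRing.normalOrder k n p • v := rfl

variable (k n) in
/-- The translates of a vector under the Bernstein filtration. -/
def orbit (v : V) (m : ℕ) : Submodule k V :=
  Submodule.map (orbitMap k n v) (restrictTotalDegree _ k m)

instance (v : V) (m : ℕ) : FiniteDimensional k (orbit k n v m) :=
  Module.Finite.map _ _

lemma growth_orbitMap (v : V) (m : ℕ) :
    growth (orbitMap k n v) m = Module.finrank k (orbit k n v m) := rfl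

lemma mem_orbit {v x : V} {m : ℕ} : x ∈ orbit k n v m ↔ ∃ a ∈ WeylRing.bernstein k n m, a • v = x := by
  constructor
  · rintro ⟨p, hp, rfl⟩
    exact ⟨_, ⟨p, hp, rfl⟩, rfl⟩
  · rintro ⟨_, ⟨p, hp, rfl⟩, rfl⟩
    exact ⟨p, hp, rfl⟩

lemma orbit_eq_smul (v : V) (m : ℕ) :
    orbit k n v m = WeylRing.gens k n ^ m • Submodule.span k {v} := by
  rw [WeylRing.gens_pow]
  apply le_antisymm
  · intro x hx
    obtain ⟨a, ha, rfl⟩ := mem_orbit.1 hx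
    exact Submodule.smul_mem_smul ha (Submodule.mem_span_singleton_self v)
  · rw [Submodule.smul_le]
    intro a ha x hx
    obtain ⟨c, rfl⟩ := Submodule.mem_span_singleton.1 hx
    rw [smul_algebra_smul_comm]
    exact Submodule.smul_mem _ _ (mem_orbit.2 ⟨a, ha, rfl⟩)

lemma smul_mem_orbit {v x : V} {a b : ℕ} {y : WeylRing k n} (hy : y ∈ WeylRing.bernstein k n a)
    (hx : x ∈ orbit k n v b) : y • x ∈ orbit k n v (a + b) := by
  obtain ⟨z, hz, rfl⟩ := mem_orbit.1 hx
  rw [smul_smul]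
  refine mem_orbit.2 ⟨y * z, ?_, rfl⟩
  rw [← WeylRing.bernstein_mul]
  exact Submodule.mul_mem_mul hy hz

/-- The kernel consists of the symbols of the left ideal `Ann v`. Multiplying by a generator from
the left multiplies the symbol by a variable, up to a derivative in the case of `∂ᵢ`. -/
lemma shiftStable_orbitMap (v : V) : ShiftStable (orbitMap k n v) := by
  rintro (i | i) p hp
  · refine ⟨0, by simp, ?_⟩
    rw [add_zero, orbitMap_apply, WeylRel.normalOrder_X_inl_mul, mul_smul, ← orbitMap_apply, hp,
      smul_zero]
  · refine ⟨pderiv (Sum.inl i) p, (totalDegree_pderiv_le _ _).trans (Nat.sub_le _ _), ?_⟩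
    rw [orbitMap_apply, ← WeylRel.mul_normalOrder, mul_smul, ← orbitMap_apply, hp, smul_zero]

/-- A version of Bernstein's inequality. -/
lemma finrank_le_growth_mul_growth [CharZero k] {v : V} (hv : v ≠ 0) (m : ℕ) :
    Module.finrank k (restrictTotalDegree (Fin n ⊕ Fin n) k m) ≤
      growth (orbitMap k n v) m * growth (orbitMap k n v) (m + m) := by
  -- Operators of degree at most `m` embed into `Hom(F_m v, F_{2m} v)`; comparing dimensions gives
  -- the inequality.
  let L : restrictTotalDegree (Fin n ⊕ Fin n) k m →ₗ[k]
      (orbit k n v m →ₗ[k] orbit k n v (m + m)) :=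
    LinearMap.mk₂ k
      (fun p x => ⟨WeylRing.normalOrder k n p • (x : V), smul_mem_orbit ⟨p, p.2, rfl⟩ x.2⟩)
      (fun p q x => by ext; simp [add_smul])
      (fun c p x => by ext; simp)
      (fun p x y => by ext; simp)
      (fun c p x => by ext; simp [smul_algebra_smul_comm])
  have hL : Function.Injective L := by
    rw [injective_iff_map_eq_zero]
    rintro ⟨p, hp⟩ h0
    rw [mem_restrictTotalDegree] at hp
    apply Subtype.ext
    -- If an operator kills `F_{m+1} v`, its commutators with generators kill `F_m v`. Each
    -- derivative of the symbol thus costs one filtration step, and at the end a constant kills `v ≠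
    -- 0`.
    refine eq_zero_of_pderiv_induction
      (P := fun m p => ∀ q : MvPolynomial (Fin n ⊕ Fin n) k, q.totalDegree ≤ m →
        WeylRing.normalOrder k n p • WeylRing.normalOrder k n q • v = 0) ?_ ?_ m p hp ?_
    · rintro m p (i | i) H q hq
      · rw [WeylRel.normalOrder_pderiv_inl, sub_smul, mul_smul, H q (by omega), smul_zero,
          mul_smul, ← mul_smul (WeylRing.deriv k i), WeylRel.mul_normalOrder, H, sub_zero]
        refine (totalDegree_add _ _).trans (max_le ?_ ?_)
        · exact (totalDegree_X_mul_le _ _).trans (by omega)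
        · exact (totalDegree_pderiv_le _ _).trans (by omega)
      · rw [WeylRel.normalOrder_pderiv_inr, sub_smul, mul_smul, mul_smul, H q (by omega),
          smul_zero, sub_zero, ← mul_smul (WeylRing.funHom k n _), ← WeylRel.normalOrder_X_inl_mul, H]
        exact (totalDegree_X_mul_le _ _).trans (by omega)
    · intro m c H
      have h1 := H 1 (by simp)
      rw [WeylRel.normalOrder_one, one_smul, WeylRel.normalOrder_C, algebraMap_smul] at h1
      exact (smul_eq_zero.1 h1).resolve_right hv
    · intro q hq
      have h1 := congrArg (fun f => ((f ⟨WeylRing.normalOrder k n q • v,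
        q, (mem_restrictTotalDegree _ _ _).2 hq, rfl⟩ : orbit k n v (m + m)) : V)) h0
      exact h1
  have := LinearMap.finrank_le_finrank_of_injective hL
  rwa [Module.finrank_linearMap] at this

/-- Any nonzero vector of a module over the Weyl algebra has growth of order at least `n`, with a
uniform constant. -/
lemma pow_le_growth [CharZero k] {v : V} (hv : v ≠ 0) (m : ℕ) :
    (m / (n + 1) + 1) ^ n ≤ growth (orbitMap k n v) m := by
  rcases n with _ | d
  · have := le_growth (orbitMap k 0 v) ∅ (fun p hp h0 => ?_) m
    · simpa using this
    · rw [Finset.coe_empty, supported_empty, Algebra.mem_bot] at hp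
      obtain ⟨c, rfl⟩ := hp
      rw [MvPolynomial.algebraMap_eq] at h0 ⊢
      rw [orbitMap_apply, WeylRel.normalOrder_C, algebraMap_smul] at h0
      rw [(smul_eq_zero.1 h0).resolve_right hv, C_0]
  · rcases growth_dichotomy (orbitMap k (d + 1) v) (shiftStable_orbitMap v) d with
      ⟨I, hI, hinj⟩ | ⟨C, hC⟩
    · have := le_growth _ I hinj m
      rwa [hI] at this
    -- With `n = d + 1`, growth `O(m ^ d)` would make the right side of Bernstein's inequality `O(m
    -- ^ (2 d))`, against order `m ^ (2 d + 2)` on the left.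
    · exfalso
      have key : ∀ m, (m / (2 * (d + 1) + 1) + 1) ^ (2 * (d + 1)) ≤
          (C * (m + 1) ^ d) * (C * (m + m + 1) ^ d) := by
        intro m
        have h1 := le_growth (LinearMap.id : MvPolynomial (Fin (d + 1) ⊕ Fin (d + 1)) k →ₗ[k] _)
          Finset.univ (fun p _ h => h) m
        have h2 : (Finset.univ : Finset (Fin (d + 1) ⊕ Fin (d + 1))).card = 2 * (d + 1) := by
          simp; ring
        rw [h2, growth, Submodule.map_id] at h1
        exact h1.trans ((finrank_le_growth_mul_growth hv m).trans (Nat.mul_le_mul (hC _) (hC _)))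
      -- At `m = e t` the division by `e` is exact, and `t` gathers all constants, so the inequality
      -- becomes `(t + 1) ^ 2 ≤ t`.
      set e := 2 * (d + 1) + 1 with he
      set t := C ^ 2 * (e ^ d * (2 * e) ^ d) with ht
      have h1 := key (e * t)
      rw [Nat.mul_div_cancel_left _ (by omega)] at h1
      have h2 : (e * t + 1) ^ d ≤ (e * (t + 1)) ^ d := Nat.pow_le_pow_left (by nlinarith) d
      have h3 : (e * t + e * t + 1) ^ d ≤ (2 * e * (t + 1)) ^ d :=
        Nat.pow_le_pow_left (by nlinarith) d
      have h4 : (t + 1) ^ (2 * (d + 1)) ≤ t * (t + 1) ^ (2 * d) := by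
        calc (t + 1) ^ (2 * (d + 1)) ≤ C * (e * t + 1) ^ d * (C * (e * t + e * t + 1) ^ d) := h1
          _ ≤ C * (e * (t + 1)) ^ d * (C * (2 * e * (t + 1)) ^ d) :=
            Nat.mul_le_mul (Nat.mul_le_mul_left _ h2) (Nat.mul_le_mul_left _ h3)
          _ = t * (t + 1) ^ (2 * d) := by
            rw [mul_pow e, mul_pow (2 * e), two_mul d, pow_add]
            nth_rewrite 5 [ht]
            ring
      have h5 : (t + 1) ^ (2 * (d + 1)) = (t + 1) ^ 2 * (t + 1) ^ (2 * d) := by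
        rw [← pow_add]; congr 1; ring
      rw [h5] at h4
      have h6 := Nat.le_of_mul_le_mul_right h4 (by positivity)
      nlinarith

/-- If the growth of a vector has order less than `n + 1` then it has order at most `n`. -/
lemma growth_le_of_sq_le {v : V} {K m₀ : ℕ}
    (h : ∀ m ≥ m₀, growth (orbitMap k n v) m ^ 2 ≤ K * m ^ (2 * n + 1)) :
    ∃ C : ℕ, ∀ m, growth (orbitMap k n v) m ≤ C * (m + 1) ^ n := by
  rcases growth_dichotomy (orbitMap k n v) (shiftStable_orbitMap v) n with ⟨I, hI, hinj⟩ | hC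
  -- Injectivity on `n + 1` variables would force growth of order `m ^ (n + 1)`, while `h` allows
  -- only order `m ^ (n + 1/2)`.
  · exfalso
    set e := n + 2 with he
    -- At `m = e t` the division is exact; this `t` absorbs `K e ^ (2 n + 1)` and makes `m ≥ m₀`.
    set t := K * e ^ (2 * n + 1) + m₀ with ht
    have h0 : e * t ≥ m₀ :=
      (Nat.le_add_left _ _).trans (Nat.le_mul_of_pos_left t (by omega))
    have h1 := le_growth _ I hinj (e * t)
    rw [hI, show n + 1 + 1 = e from rfl, Nat.mul_div_cancel_left _ (by omega)] at h1
    have h2 := (Nat.pow_le_pow_left h1 2).trans (h _ h0)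
    have h3 : K * (e * t) ^ (2 * n + 1) ≤ t * (t + 1) ^ (2 * n + 1) := by
      rw [mul_pow, ← mul_assoc]
      exact Nat.mul_le_mul (by omega) (Nat.pow_le_pow_left (by omega) _)
    have h4 : ((t + 1) ^ (n + 1)) ^ 2 = (t + 1) * (t + 1) ^ (2 * n + 1) := by
      rw [← pow_mul, ← pow_succ']; congr 1; ring
    rw [h4] at h2
    have := Nat.le_of_mul_le_mul_right (h2.trans h3) (by positivity)
    omega
  · exact hC

/-- Rank–nullity for `F_{m+r} v → V ⧸ D w`: the range contains `F_m` of the class of `v`, and the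
kernel contains `F_m w`. Asymptotically this is superadditivity of leading coefficients. -/
lemma growth_add_growth_le {v w : V} {r : ℕ} (hw : w ∈ orbit k n v r) (m : ℕ) :
    growth (orbitMap k n w) m +
      growth (orbitMap k n (Submodule.Quotient.mk v : V ⧸ Submodule.span (WeylRing k n) {w})) m ≤
      growth (orbitMap k n v) (m + r) := by
  set E := Submodule.span (WeylRing k n) {w}
  let f : orbit k n v (m + r) →ₗ[k] V ⧸ E :=
    (E.mkQ.restrictScalars k).domRestrict _
  have hrange : orbit k n (Submodule.Quotient.mk v : V ⧸ E) m ≤ LinearMap.range f := by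
    intro x hx
    obtain ⟨a, ha, rfl⟩ := mem_orbit.1 hx
    exact ⟨⟨a • v, mem_orbit.2 ⟨a, WeylRing.bernstein_mono (Nat.le_add_right m r) ha, rfl⟩⟩, rfl⟩
  have hker : orbit k n w m ≤ (LinearMap.ker f).map (Submodule.subtype _) := by
    intro x hx
    have hx' := hx
    obtain ⟨a, ha, rfl⟩ := mem_orbit.1 hx
    refine ⟨⟨a • w, smul_mem_orbit ha hw⟩, ?_, rfl⟩
    exact (Submodule.Quotient.mk_eq_zero _).2
      (E.smul_mem a (Submodule.mem_span_singleton_self w))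
  rw [growth_orbitMap, growth_orbitMap, growth_orbitMap, ← LinearMap.finrank_range_add_finrank_ker f,
    add_comm]
  refine Nat.add_le_add (Submodule.finrank_mono hrange) ((Submodule.finrank_mono hker).trans ?_)
  exact (LinearEquiv.finrank_eq (Submodule.equivSubtypeMap _ _)).ge

lemma growth_bound_real [CharZero k] {v : V} (hv : v ≠ 0) (m : ℕ) :
    ((1 : ℝ) / (n + 1)) ^ n * m ^ n ≤ growth (orbitMap k n v) m := by
  have h1 : ((m / (n + 1) + 1 : ℕ) : ℝ) ^ n ≤ growth (orbitMap k n v) m := by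
    exact_mod_cast pow_le_growth (k := k) hv m
  refine le_trans ?_ h1
  rw [← mul_pow]
  refine pow_le_pow_left₀ (by positivity) ?_ n
  have h2 : m < (m / (n + 1) + 1) * (n + 1) := by
    rw [mul_comm]; exact Nat.lt_mul_div_succ m (Nat.succ_pos n)
  rw [div_mul_eq_mul_div, one_mul, div_le_iff₀ (by positivity)]
  exact_mod_cast h2.le

/-- A module over the Weyl algebra with a nonzero vector of minimal growth order has a vector that
is a nonzero multiple of each of its nonzero multiples. -/
theorem exists_simple_vector [CharZero k] (hV : ∃ v : V, v ≠ 0 ∧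
    ∃ C : ℕ, ∀ m, growth (orbitMap k n v) m ≤ C * (m + 1) ^ n) :
    ∃ v : V, v ≠ 0 ∧ (∃ c : ℝ, ∀ᶠ m : ℕ in atTop, (growth (orbitMap k n v) m : ℝ) ≤ c * m ^ n) ∧
      ∀ w ∈ Submodule.span (WeylRing k n) {v}, w ≠ 0 → v ∈ Submodule.span (WeylRing k n) {w} := by
  -- The universal lower bound for leading coefficients; it applies in quotients of `V` as well.
  set δ : ℝ := ((1 : ℝ) / (n + 1)) ^ n with hδ
  have hδ0 : 0 < δ := by positivity
  let S : Set ℝ := {c | ∃ v : V, v ≠ 0 ∧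
    ∀ᶠ m : ℕ in atTop, (growth (orbitMap k n v) m : ℝ) ≤ c * m ^ n}
  have hS : S.Nonempty := by
    obtain ⟨v, hv, C, hC⟩ := hV
    refine ⟨C * 2 ^ n, v, hv, ?_⟩
    filter_upwards [eventually_ge_atTop 1] with m hm
    have h1 : growth (orbitMap k n v) m ≤ C * (2 * m) ^ n :=
      (hC m).trans (Nat.mul_le_mul_left _ (Nat.pow_le_pow_left (by omega) _))
    have h2 : (growth (orbitMap k n v) m : ℝ) ≤ C * (2 * m) ^ n := by exact_mod_cast h1
    rwa [mul_pow, ← mul_assoc] at h2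
  have hbdd : BddBelow S := by
    refine ⟨0, ?_⟩
    rintro c ⟨v, -, hc⟩
    obtain ⟨m, h1, h2⟩ := (hc.and (eventually_ge_atTop 1)).exists
    by_contra! h
    have h3 : (0 : ℝ) < (m : ℝ) ^ n := by
      have : (0 : ℝ) < m := by exact_mod_cast h2
      positivity
    have h4 : (0 : ℝ) ≤ growth (orbitMap k n v) m := Nat.cast_nonneg _
    nlinarith
  obtain ⟨c, ⟨v, hv, hc⟩, hlt⟩ := exists_lt_of_csInf_lt hS
    (show sInf S < sInf S + δ / 4 by linarith)
  refine ⟨v, hv, ⟨c, hc⟩, fun w hw hw0 => ?_⟩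
  by_contra hvw
  obtain ⟨a, rfl⟩ := Submodule.mem_span_singleton.1 hw
  obtain ⟨r, hr⟩ := WeylRing.exists_mem_bernstein a
  have hadd := growth_add_growth_le (k := k) (n := n) (v := v) (mem_orbit.2 ⟨a, hr, rfl⟩)
  -- If `v ∉ D w`, the class of `v` in `V ⧸ D w` takes growth at least `δ m ^ n`. This leaves `w`
  -- with coefficient at most `c - δ / 2 < sInf S`.
  have hv0 : (Submodule.Quotient.mk v : V ⧸ Submodule.span (WeylRing k n) {a • v}) ≠ 0 := fun h =>
    hvw ((Submodule.Quotient.mk_eq_zero _).1 h)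
  -- The shift from `m` to `m + r` does not change the leading coefficient; eventually it costs less
  -- than `δ / 2`.
  have hlim : Tendsto (fun m : ℕ => c * (((m + r : ℕ) : ℝ) / m) ^ n) atTop (nhds (c * 1 ^ n)) := by
    refine Tendsto.const_mul _ (Tendsto.pow ?_ n)
    have h1 : Tendsto (fun m : ℕ => (1 : ℝ) + r / (m : ℝ)) atTop (nhds (1 + 0)) :=
      tendsto_const_nhds.add (tendsto_const_div_atTop_nhds_zero_nat _)
    rw [add_zero] at h1
    refine h1.congr' ?_
    filter_upwards [eventually_ge_atTop 1] with m hm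
    have : (m : ℝ) ≠ 0 := by positivity
    push_cast
    field_simp
  have hev := hlim.eventually_lt_const (show c * 1 ^ n < c + δ / 2 by rw [one_pow]; linarith)
  have hmem : c - δ / 2 ∈ S := by
    refine ⟨a • v, hw0, ?_⟩
    filter_upwards [hev, (tendsto_add_atTop_nat r).eventually hc, eventually_ge_atTop 1] with
      m h1 h2 hm
    have hm0 : (0 : ℝ) < m := by exact_mod_cast hm
    have h3 : (growth (orbitMap k n (a • v)) m : ℝ) + growth (orbitMap k n
        (Submodule.Quotient.mk v : V ⧸ Submodule.span (WeylRing k n) {a • v})) m ≤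
        growth (orbitMap k n v) (m + r) := by exact_mod_cast hadd m
    have h4 := growth_bound_real (k := k) (n := n) hv0 m
    rw [div_pow, ← mul_div_assoc, div_lt_iff₀ (by positivity)] at h1
    have h5 : (c - δ / 2) * (m : ℝ) ^ n = (c + δ / 2) * m ^ n - δ * m ^ n := by ring
    rw [h5]
    linarith
  have := csInf_le hbdd hmem
  linarith

end WeylGrowth

end AVMod

namespace AVMod

/-! ### Simple modules over the Weyl algebra -/

section Schur

open Polynomial

/-- Over an algebraically closed field `q` is a nonzero constant times linear factors, and each
factor acts injectively. -/
lemma aeval_injective_of_sub_injective {k : Type*} [Field k] [IsAlgClosed k] {P : Type*}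
    [AddCommGroup P] [Module k P] (φ : Module.End k P)
    (hφ : ∀ c : k, Function.Injective (φ - algebraMap k (Module.End k P) c)) (q : k[X]) (hq : q ≠ 0) :
    Function.Injective (aeval φ q) := by
  induction hd : q.natDegree generalizing q with
  | zero =>
    rw [natDegree_eq_zero] at hd
    obtain ⟨c, rfl⟩ := hd
    have hc : c ≠ 0 := fun h => hq (by rw [h, C_0])
    rw [aeval_C]
    intro x y hxy
    exact smul_right_injective P hc hxy
  | succ d ih =>
    obtain ⟨r, hr⟩ := IsAlgClosed.exists_root q (by
      rw [degree_eq_natDegree hq, hd]; exact_mod_cast Nat.succ_ne_zero d)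
    obtain ⟨q', rfl⟩ := dvd_iff_isRoot.2 hr
    have hq' : q' ≠ 0 := right_ne_zero_of_mul hq
    rw [natDegree_mul (X_sub_C_ne_zero r) hq', natDegree_X_sub_C] at hd
    rw [map_mul, map_sub, aeval_X, aeval_C]
    exact (hφ r).comp (ih q' hq' (by omega))

/-- Over an algebraically closed field, an endomorphism of a space whose dimension is less than the
cardinality of the field has a shift that is not bijective. -/
lemma exists_not_bijective_sub {k : Type u} [Field k] [IsAlgClosed k] {P : Type u}
    [AddCommGroup P] [Module k P] [Nontrivial P] (hP : Module.rank k P < Cardinal.mk k)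
    (φ : Module.End k P) : ∃ c : k, ¬ Function.Bijective (φ - algebraMap k (Module.End k P) c) := by
  classical
  by_contra! H
  have hinj := aeval_injective_of_sub_injective φ fun c => (H c).1
  obtain ⟨p, hp⟩ := exists_ne (0 : P)
  -- The vectors `w c = (φ - c)⁻¹ p` form a family indexed by `k`; their independence contradicts
  -- the bound on the dimension.
  choose w hw using fun c => (H c).2 p
  have hli : LinearIndependent k w := by
    rw [linearIndependent_iff']
    intro s a hs i hi
    -- Clearing denominators in `∑ a c (φ - c)⁻¹ p = 0` gives `q(φ) p = 0`, hence `q = 0`.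
    -- Evaluating at `i` isolates `a i`.
    let q : k[X] := ∑ c ∈ s, C (a c) * ∏ j ∈ s.erase c, (X - C j)
    have h1 : aeval φ q p = 0 := by
      have h2 : ∀ c ∈ s, aeval φ (C (a c) * ∏ j ∈ s.erase c, (X - C j)) p =
          aeval φ (∏ j ∈ s, (X - C j)) (a c • w c) := by
        intro c hc
        rw [← Finset.prod_erase_mul s _ hc, mul_comm (C (a c)), map_mul, map_mul,
          Module.End.mul_apply, Module.End.mul_apply, map_smul, map_sub, aeval_X, aeval_C, aeval_C,
          hw, Module.algebraMap_end_apply]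
      simp only [q, map_sum, LinearMap.sum_apply]
      rw [Finset.sum_congr rfl h2, ← map_sum, hs, map_zero]
    have hq : q = 0 := by
      by_contra hq
      exact hp (hinj q hq (by rw [h1, map_zero]))
    have h3 := congrArg (eval i) hq
    simp only [q, eval_finsetSum, eval_mul, eval_C, eval_prod, eval_sub, eval_X, eval_zero] at h3
    rw [Finset.sum_eq_single i] at h3
    · refine (mul_eq_zero.1 h3).resolve_right (Finset.prod_ne_zero_iff.2 fun j hj => ?_)
      exact sub_ne_zero.2 (Finset.ne_of_mem_erase hj).symm
    · intro c hc hci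
      rw [Finset.prod_eq_zero (Finset.mem_erase.2 ⟨hci.symm, hi⟩) (sub_self i), mul_zero]
    · intro h; exact absurd hi h
  exact (hli.cardinal_le_rank.trans_lt hP).false

variable {k : Type u} [Field k] {D : Type u} [Ring D] [Algebra k D] (I : Submodule D D)

/-- Schur's lemma for cyclic modules, in terms of idealizers. -/
lemma exists_sub_algebraMap_mem [IsAlgClosed k] [IsSimpleModule D (D ⧸ I)]
    (hP : Module.rank k (D ⧸ I) < Cardinal.mk k) (c : D) (hc : ∀ x ∈ I, x * c ∈ I) :
    ∃ l : k, c - algebraMap k D l ∈ I := by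
  -- Since `I c ⊆ I`, right multiplication by `c` is an endomorphism of the simple module `D ⧸ I`;
  -- some shift of it by a scalar is not bijective, hence zero.
  let f : D ⧸ I →ₗ[D] D ⧸ I := I.liftQ (I.mkQ ∘ₗ LinearMap.toSpanSingleton D D c) (by
    intro x hx
    exact (Submodule.Quotient.mk_eq_zero _).2 (hc x hx))
  have : Nontrivial (D ⧸ I) := IsSimpleModule.nontrivial D _
  obtain ⟨l, hl⟩ := exists_not_bijective_sub hP (f.restrictScalars k)
  let g : D ⧸ I →ₗ[D] D ⧸ I := I.liftQ
    (I.mkQ ∘ₗ LinearMap.toSpanSingleton D D (c - algebraMap k D l)) (by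
    intro x hx
    refine (Submodule.Quotient.mk_eq_zero _).2 ?_
    rw [LinearMap.toSpanSingleton_apply, smul_eq_mul, mul_sub]
    refine I.sub_mem (hc x hx) ?_
    rw [← Algebra.commutes]
    exact I.smul_mem _ hx)
  have hg : g = 0 := by
    rcases LinearMap.bijective_or_eq_zero g with h | h
    · refine absurd ?_ hl
      convert h using 1
      funext x
      obtain ⟨x, rfl⟩ := Submodule.Quotient.mk_surjective _ x
      change Submodule.Quotient.mk (x * c) - l • Submodule.Quotient.mk x =
        (Submodule.Quotient.mk (x * (c - algebraMap k D l)) : D ⧸ I)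
      rw [mul_sub, Submodule.Quotient.mk_sub, ← Algebra.commutes, ← Algebra.smul_def]
      rfl
    · exact h
  refine ⟨l, (Submodule.Quotient.mk_eq_zero _).1 ?_⟩
  have h1 := DFunLike.congr_fun hg (Submodule.Quotient.mk 1)
  change Submodule.Quotient.mk (1 * (c - algebraMap k D l)) = (0 : D ⧸ I) at h1
  rwa [one_mul] at h1

variable {V : Type*} [AddCommGroup V] [Module k V] [Module D V] [IsScalarTower k D V]

/-- Vectors annihilated by a maximal left ideal `I` that are independent over `k` are independent
over `D` modulo `I`. -/
lemma mem_of_sum_smul_eq_zero [IsAlgClosed k] [IsSimpleModule D (D ⧸ I)]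
    (hP : Module.rank k (D ⧸ I) < Cardinal.mk k) {ι : Type*} {q : ι → V}
    (hq : LinearIndependent k q) (hI : ∀ j, ∀ x ∈ I, x • q j = 0) (s : Finset ι) (a : ι → D)
    (ha : ∑ j ∈ s, a j • q j = 0) : ∀ j ∈ s, a j ∈ I := by
  classical
  induction s using Finset.induction_on generalizing a with
  | empty => simp
  | insert j₀ s hj₀ ih =>
    rw [Finset.sum_insert hj₀] at ha
    by_cases hmem : a j₀ ∈ I
    · rw [hI _ _ hmem, zero_add] at ha
      intro j hj
      rcases Finset.mem_insert.1 hj with rfl | hj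
      · exact hmem
      · exact ih a ha j hj
    exfalso
    have hne : (Submodule.Quotient.mk (a j₀) : D ⧸ I) ≠ 0 := fun h =>
      hmem ((Submodule.Quotient.mk_eq_zero _).1 h)
    -- Simplicity of `D ⧸ I` allows the coefficient of `q j₀` to be normalised to `1` modulo `I`.
    obtain ⟨b, hb⟩ := IsSimpleModule.toSpanSingleton_surjective D hne (Submodule.Quotient.mk 1)
    have hb' : 1 - b * a j₀ ∈ I := by
      rw [← Submodule.Quotient.mk_eq_zero, Submodule.Quotient.mk_sub, ← hb]
      exact sub_self _
    have h1 : q j₀ = ∑ j ∈ s, (-(b * a j)) • q j := by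
      have h2 := hI j₀ _ hb'
      rw [sub_smul, one_smul, mul_smul, sub_eq_zero, eq_neg_of_add_eq_zero_left ha, smul_neg,
        Finset.smul_sum] at h2
      rw [h2, ← Finset.sum_neg_distrib]
      exact Finset.sum_congr rfl fun j _ => by rw [neg_smul, mul_smul]
    -- Multiplying the normalised relation by `x ∈ I` gives a shorter relation, so by induction `x`
    -- times each coefficient lies in `I`. Schur's lemma then makes each coefficient a scalar modulo
    -- `I`, and the relation becomes one over `k`.
    have h3 : ∀ j ∈ s, ∃ l : k, -(b * a j) - algebraMap k D l ∈ I := by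
      intro j hj
      refine exists_sub_algebraMap_mem I hP _ fun x hx => ?_
      refine ih (fun j => x * -(b * a j)) ?_ j hj
      simp only [mul_smul x]
      rw [← Finset.smul_sum, ← h1, hI _ _ hx]
    choose! l hl using h3
    have h4 : q j₀ = ∑ j ∈ s, l j • q j := by
      rw [h1]
      refine Finset.sum_congr rfl fun j hj => ?_
      have h5 := hI j _ (hl j hj)
      rwa [sub_smul, algebraMap_smul, sub_eq_zero] at h5
    have h6 := linearIndependent_iff'.1 hq (insert j₀ s) (fun j => if j = j₀ then -1 else l j)
      (by
        rw [Finset.sum_insert hj₀, if_pos rfl, neg_smul, one_smul, h4, neg_add_eq_zero]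
        refine Finset.sum_congr rfl fun j hj => ?_
        rw [if_neg (fun h : j = j₀ => hj₀ (h ▸ hj))]) j₀ (Finset.mem_insert_self _ _)
    simp at h6

/-- The map `(D ⧸ I) ⊗ Q → V` for a space `Q` of vectors annihilated by `I`. -/
def actMap (Q : Submodule k V) (hQ : ∀ q ∈ Q, ∀ x ∈ I, x • q = 0) :
    (D ⧸ I) ⊗[k] Q →ₗ[k] V :=
  TensorProduct.lift (LinearMap.mk₂ k
    (fun p q => I.liftQ (LinearMap.toSpanSingleton D V (q : V)) (fun x hx => hQ q q.2 x hx) p)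
    (fun p p' q => map_add _ _ _)
    (fun c p q => LinearMap.map_smul_of_tower _ _ _)
    (fun p q q' => by
      obtain ⟨a, rfl⟩ := Submodule.Quotient.mk_surjective _ p
      exact smul_add a (q : V) q')
    (fun c p q => by
      obtain ⟨a, rfl⟩ := Submodule.Quotient.mk_surjective _ p
      exact smul_algebra_smul_comm c a (q : V)))

lemma actMap_tmul (Q : Submodule k V) (hQ : ∀ q ∈ Q, ∀ x ∈ I, x • q = 0) (a : D) (q : Q) :
    actMap I Q hQ (Submodule.Quotient.mk a ⊗ₜ q) = a • (q : V) := rfl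

/-- Expand a tensor along a basis of `Q`; basis vectors are independent over `D` modulo `I`, so
every coefficient vanishes in `D ⧸ I`. -/
lemma actMap_injective [IsAlgClosed k] [IsSimpleModule D (D ⧸ I)]
    (hP : Module.rank k (D ⧸ I) < Cardinal.mk k) (Q : Submodule k V)
    (hQ : ∀ q ∈ Q, ∀ x ∈ I, x • q = 0) : Function.Injective (actMap I Q hQ) := by
  classical
  rw [injective_iff_map_eq_zero]
  intro t ht
  let b := Module.Basis.ofVectorSpace k Q
  let e := TensorProduct.equivFinsuppOfBasisRight (M := D ⧸ I) b
  obtain ⟨f, rfl⟩ := e.symm.surjective t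
  have hf : e.symm f = f.sum fun j p => p ⊗ₜ[k] b j :=
    TensorProduct.equivFinsuppOfBasisRight_symm_apply b f
  choose a ha using fun j => Submodule.Quotient.mk_surjective I (f j)
  have h1 : ∑ j ∈ f.support, a j • ((b j : Q) : V) = 0 := by
    rw [← ht, hf, Finsupp.sum, map_sum]
    refine Finset.sum_congr rfl fun j _ => ?_
    rw [← ha, actMap_tmul]
  have hli : LinearIndependent k fun j => ((b j : Q) : V) :=
    b.linearIndependent.map' Q.subtype (Submodule.ker_subtype Q)
  have h2 := mem_of_sum_smul_eq_zero I hP hli (fun j x hx => hQ _ (b j).2 x hx) _ a h1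
  have h3 : f = 0 := by
    ext j
    by_cases hj : j ∈ f.support
    · rw [← ha, Finsupp.zero_apply]
      exact (Submodule.Quotient.mk_eq_zero _).2 (h2 j hj)
    · exact Finsupp.notMem_support_iff.1 hj
  rw [h3, map_zero]

/-- The injective map on `(D ⧸ I) ⊗ Q` restricts to `B ⊗ Q → Z`. With `B` a filtration piece, bounds
on the growth in `V` become bounds on `dim Q`. -/
lemma finrank_mul_finrank_le [IsAlgClosed k] [IsSimpleModule D (D ⧸ I)]
    (hP : Module.rank k (D ⧸ I) < Cardinal.mk k) (Q Z : Submodule k V) [FiniteDimensional k Z]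
    (hQ : ∀ q ∈ Q, ∀ x ∈ I, x • q = 0) (B : Submodule k (D ⧸ I))
    (hZ : ∀ a, Submodule.Quotient.mk a ∈ B → ∀ q ∈ Q, a • q ∈ Z) :
    Module.finrank k B * Module.finrank k Q ≤ Module.finrank k Z := by
  let f : B ⊗[k] Q →ₗ[k] V := actMap I Q hQ ∘ₗ LinearMap.rTensor Q B.subtype
  have hf : Function.Injective f := (actMap_injective I hP Q hQ).comp
    (Module.Flat.rTensor_preserves_injective_linearMap _ B.injective_subtype)
  have hfZ : ∀ t, f t ∈ Z := by
    intro t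
    induction t with
    | zero => rw [map_zero]; exact Z.zero_mem
    | add x y hx hy => rw [map_add]; exact Z.add_mem hx hy
    | tmul p q =>
      obtain ⟨a, ha⟩ := Submodule.Quotient.mk_surjective I (p : D ⧸ I)
      have : f (p ⊗ₜ q) = a • (q : V) := by
        change actMap I Q hQ ((p : D ⧸ I) ⊗ₜ q) = _
        rw [← ha, actMap_tmul]
      rw [this]
      exact hZ a (ha ▸ p.2) q q.2
  have := LinearMap.finrank_le_finrank_of_injective (f := f.codRestrict Z hfZ)
    (fun x y h => hf (congrArg Subtype.val h))
  rwa [Module.finrank_tensorProduct] at this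

end Schur

/-! ### Cyclic modules: simplicity, countable dimension and holonomicity -/

section SimpleQuotient

open MvPolynomial Filter

variable {k : Type u} [Field k] {n : ℕ} {V : Type*} [AddCommGroup V] [Module k V]
  [Module (WeylRing k n) V] [IsScalarTower k (WeylRing k n) V]

lemma growth_map_of_injective {V' : Type*} [AddCommGroup V'] [Module k V']
    [Module (WeylRing k n) V'] [IsScalarTower k (WeylRing k n) V'] (f : V →ₗ[WeylRing k n] V')
    (hf : Function.Injective f) (v : V) (m : ℕ) :
    growth (orbitMap k n (f v)) m = growth (orbitMap k n v) m := by
  have h1 : orbit k n (f v) m = Submodule.map (f.restrictScalars k) (orbit k n v m) := by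
    ext x
    simp only [mem_orbit, Submodule.mem_map]
    constructor
    · rintro ⟨a, ha, rfl⟩
      exact ⟨a • v, ⟨a, ha, rfl⟩, map_smul f a v⟩
    · rintro ⟨_, ⟨a, ha, rfl⟩, rfl⟩
      exact ⟨a, ha, (map_smul f a v).symm⟩
  rw [growth_orbitMap, growth_orbitMap, h1]
  exact (Submodule.equivMapOfInjective (f.restrictScalars k) hf _).finrank_eq.symm

section Cyclic

variable {V : Type*} [AddCommGroup V] [Module (WeylRing k n) V]

variable (k n) in
/-- The annihilator of a vector in the Weyl algebra. -/
def annVec (v : V) : Submodule (WeylRing k n) (WeylRing k n) :=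
  LinearMap.ker (LinearMap.toSpanSingleton (WeylRing k n) V v)

lemma mem_annVec {v : V} {a : WeylRing k n} : a ∈ annVec k n v ↔ a • v = 0 := Iff.rfl

variable (k n) in
/-- The embedding of the cyclic module `D ⧸ Ann v`. -/
def cyclicMap (v : V) : (WeylRing k n ⧸ annVec k n v) →ₗ[WeylRing k n] V :=
  (annVec k n v).liftQ (LinearMap.toSpanSingleton (WeylRing k n) V v) le_rfl

lemma cyclicMap_mk (v : V) (a : WeylRing k n) :
    cyclicMap k n v (Submodule.Quotient.mk a) = a • v := rfl

lemma cyclicMap_injective (v : V) : Function.Injective (cyclicMap k n v) := by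
  rw [← LinearMap.ker_eq_bot]
  exact Submodule.ker_liftQ_eq_bot _ _ _ le_rfl

lemma isSimpleModule_quotient_annVec {v : V} (hv : v ≠ 0)
    (h : ∀ w ∈ Submodule.span (WeylRing k n) {v}, w ≠ 0 →
      v ∈ Submodule.span (WeylRing k n) {w}) :
    IsSimpleModule (WeylRing k n) (WeylRing k n ⧸ annVec k n v) := by
  rw [isSimpleModule_iff_toSpanSingleton_surjective]
  refine ⟨⟨Submodule.Quotient.mk 1, 0, fun h0 => hv ?_⟩, fun x hx y => ?_⟩
  · have := (Submodule.Quotient.mk_eq_zero _).1 h0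
    rwa [mem_annVec, one_smul] at this
  · obtain ⟨a, rfl⟩ := Submodule.Quotient.mk_surjective _ x
    obtain ⟨c, rfl⟩ := Submodule.Quotient.mk_surjective _ y
    have hav : a • v ≠ 0 := fun h0 => hx ((Submodule.Quotient.mk_eq_zero _).2 h0)
    obtain ⟨b, hb⟩ := Submodule.mem_span_singleton.1
      (h (a • v) (Submodule.mem_span_singleton.2 ⟨a, rfl⟩) hav)
    refine ⟨c * b, cyclicMap_injective v ?_⟩
    rw [LinearMap.toSpanSingleton_apply, map_smul, cyclicMap_mk, cyclicMap_mk, mul_smul, hb]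

end Cyclic

/-- The monomial symbols span `D`, and there are countably many of them. For uncountable `k` this
gives the cardinality hypothesis in Schur's lemma. -/
lemma rank_quotient_le (I : Submodule (WeylRing k n) (WeylRing k n)) :
    Module.rank k (WeylRing k n ⧸ I) ≤ Cardinal.aleph0 := by
  have h1 : Function.Surjective
      ((I.mkQ.restrictScalars k) ∘ₗ WeylRing.normalOrder k n) :=
    (Submodule.Quotient.mk_surjective I).comp WeylRing.normalOrder_surjective
  refine (LinearMap.rank_le_of_surjective _ h1).trans ?_
  have h2 := (basisMonomials (Fin n ⊕ Fin n) k).mk_eq_rank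
  rw [Cardinal.lift_uzero] at h2
  rw [← h2, Cardinal.lift_le_aleph0]
  exact Cardinal.mk_le_aleph0

/-- A constant factor `a` changes `log_m` by `log a / log m`, which tends to zero. -/
lemma tendsto_logb_of_bounds {g : ℕ → ℕ} {c δ : ℝ} (hδ : 0 < δ)
    (h1 : ∀ m : ℕ, δ * (m : ℝ) ^ n ≤ g m) (h2 : ∀ᶠ m : ℕ in atTop, (g m : ℝ) ≤ c * m ^ n) :
    Tendsto (fun m : ℕ => Real.logb m (g m)) atTop (nhds n) := by
  have hc : 0 < c := by
    obtain ⟨m, hm, hm1⟩ := (h2.and (eventually_ge_atTop 1)).exists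
    have h3 : (0 : ℝ) < (m : ℝ) ^ n := by
      have : (0 : ℝ) < m := by exact_mod_cast hm1
      positivity
    have := (h1 m).trans hm
    exact hδ.trans_le (le_of_mul_le_mul_right this h3)
  have hlim : ∀ a : ℝ, 0 < a →
      Tendsto (fun m : ℕ => Real.logb m (a * (m : ℝ) ^ n)) atTop (nhds n) := by
    intro a ha
    have h3 : Tendsto (fun m : ℕ => Real.log a / Real.log m + n) atTop (nhds (0 + n)) :=
      (tendsto_const_nhds.div_atTop
        (Real.tendsto_log_atTop.comp tendsto_natCast_atTop_atTop)).add tendsto_const_nhds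
    rw [zero_add] at h3
    refine h3.congr' ?_
    filter_upwards [eventually_ge_atTop 2] with m hm
    have hm1 : (1 : ℝ) < m := by exact_mod_cast hm
    have hl : Real.log m ≠ 0 := (Real.log_pos hm1).ne'
    rw [Real.logb, Real.log_mul ha.ne' (by positivity), Real.log_pow]
    field_simp
  refine tendsto_of_tendsto_of_tendsto_of_le_of_le' (hlim δ hδ) (hlim c hc) ?_ ?_
  · filter_upwards [eventually_ge_atTop 2] with m hm
    have hm1 : (1 : ℝ) < m := by exact_mod_cast hm
    exact Real.logb_le_logb_of_le hm1 (by positivity) (h1 m)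
  · filter_upwards [eventually_ge_atTop 2, h2] with m hm hg
    have hm1 : (1 : ℝ) < m := by exact_mod_cast hm
    exact Real.logb_le_logb_of_le hm1 (lt_of_lt_of_le (by positivity) (h1 m)) hg

lemma isHolonomic_of_growth [CharZero k] {v : V} (hv : v ≠ 0)
    (hspan : Submodule.span (WeylRing k n) {v} = ⊤) {c : ℝ}
    (hc : ∀ᶠ m : ℕ in atTop, (growth (orbitMap k n v) m : ℝ) ≤ c * m ^ n) :
    IsHolonomic k (WeylRing k n) V n := by
  refine ⟨⟨⟨{v}, by rw [Finset.coe_singleton, hspan]⟩⟩, Or.inr ?_⟩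
  refine ⟨WeylRing.gens k n, Submodule.span k {v}, inferInstance, WeylRing.one_mem_gens,
    WeylRing.adjoin_gens, inferInstance, ?_, ?_⟩
  · rw [Submodule.span_span_of_tower, hspan]
  · refine Tendsto.limsup_eq ?_
    refine ((continuous_coe_real_ereal.tendsto _).comp
      (tendsto_logb_of_bounds (by positivity) (growth_bound_real hv) hc)).congr fun m => ?_
    rw [Function.comp_apply, growth_orbitMap, orbit_eq_smul]

variable (k n) in
/-- The polynomials form a module over the Weyl algebra. -/
instance : Module (WeylRing k n) (Poly k n) :=
  Module.compHom (Poly k n) ((Weyl k n).val.toRingHom : Weyl k n →+* Module.End k (Poly k n))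

instance : IsScalarTower k (WeylRing k n) (Poly k n) := ⟨fun _ _ _ => rfl⟩

/-- The module of polynomials contains a vector of growth of order `n`. -/
lemma growth_one_le : ∃ C : ℕ, ∀ m, growth (orbitMap k n (1 : Poly k n)) m ≤ C * (m + 1) ^ n := by
  rcases growth_dichotomy (orbitMap k n (1 : Poly k n)) (shiftStable_orbitMap _) n with
    ⟨I, hI, hinj⟩ | h
  · exfalso
    -- Among `n + 1` of the `2 n` variables at least one stands for a derivative, and `∂ᵢ` kills
    -- `1`.
    obtain ⟨i, hi⟩ : ∃ i, Sum.inr i ∈ I := by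
      by_contra! H
      have h1 : I ⊆ Finset.univ.map (Function.Embedding.inl : Fin n ↪ Fin n ⊕ Fin n) := by
        rintro (i | i) hi
        · simp
        · exact absurd hi (H i)
      have := Finset.card_le_card h1
      simp [hI] at this
    refine X_ne_zero (R := k) (Sum.inr i : Fin n ⊕ Fin n) (hinj _ ?_ ?_)
    · exact X_mem_supported.2 hi
    · have h1 := weylRing_rel.normalOrder_mul (k := k) (n := n) i 1
      rw [WeylRel.normalOrder_one, one_mul, mul_one] at h1
      rw [orbitMap_apply, ← h1]
      exact pderiv_one
  · exact h

end SimpleQuotient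

end AVMod

namespace AVMod

/-! ### Relations in the smash product -/

section SmashRelations

attribute [local instance 100] LieRing.ofAssociativeRing

variable {k : Type u} [Field k] {A : Type u} [CommRing A] [Algebra k A]

lemma Smash.ofFun_mul_mk (f g : A) (u : UV k A) :
    Smash.ofFun f * Smash.mk g u = Smash.mk (f * g) u := by
  change smashMul k A (f ⊗ₜ 1) (g ⊗ₜ u) = (f * g) ⊗ₜ u
  rw [smashMul_tmul, map_one, mul_one, polyAct_tmul]

lemma Smash.ofVF_mul_mk (η : VF k A) (g : A) (u : UV k A) :
    Smash.ofVF η * Smash.mk g u =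
      Smash.mk (η g) u + Smash.mk g (UniversalEnvelopingAlgebra.ι k η * u) := by
  have := Smash.mk_mul_mk 1 g η u
  rwa [one_mul, one_mul] at this

variable (k A) in
/-- The inclusion of `A` into the smash product. -/
def Smash.funHom : A →ₐ[k] Smash k A where
  toFun := Smash.ofFun
  map_one' := rfl
  map_mul' f g := (Smash.ofFun_mul_mk f g 1).symm
  map_zero' := TensorProduct.zero_tmul _ _
  map_add' f g := TensorProduct.add_tmul _ _ _
  commutes' c := by
    rw [Algebra.algebraMap_eq_smul_one, Algebra.algebraMap_eq_smul_one]
    exact (TensorProduct.smul_tmul' c (1 : A) (1 : UV k A)).symm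

variable (k A) in
/-- The inclusion of the vector fields into the smash product. -/
def Smash.vfHom : VF k A →ₗ[k] Smash k A where
  toFun := Smash.ofVF
  map_add' η μ := by
    change (1 : A) ⊗ₜ[k] (UniversalEnvelopingAlgebra.ι k (η + μ) : UV k A) = _
    rw [map_add, TensorProduct.tmul_add]
    rfl
  map_smul' c η := by
    change (1 : A) ⊗ₜ[k] (UniversalEnvelopingAlgebra.ι k (c • η) : UV k A) = _
    rw [map_smul, TensorProduct.tmul_smul]
    rfl

lemma Smash.funHom_apply (f : A) : Smash.funHom k A f = Smash.ofFun f := rfl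

lemma Smash.vfHom_mul_funHom (η : VF k A) (f : A) : Smash.vfHom k A η * Smash.funHom k A f =
    Smash.funHom k A f * Smash.vfHom k A η + Smash.funHom k A (η f) := by
  have h1 := Smash.ofVF_mul_mk η f 1
  have h2 := Smash.ofFun_mul_mk f 1 (UniversalEnvelopingAlgebra.ι k η)
  rw [mul_one] at h1 h2
  rw [add_comm]
  refine h1.trans ?_
  rw [← h2]
  rfl

lemma Smash.mk_zero (u : UV k A) : Smash.mk (0 : A) u = 0 := TensorProduct.zero_tmul _ _

lemma Smash.ofVF_mul_mk_one (η : VF k A) (u : UV k A) :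
    Smash.ofVF η * Smash.mk 1 u = Smash.mk 1 (UniversalEnvelopingAlgebra.ι k η * u) := by
  rw [Smash.ofVF_mul_mk, Derivation.map_one_eq_zero, Smash.mk_zero, zero_add]

lemma Smash.vfHom_lie (η μ : VF k A) : Smash.vfHom k A ⁅η, μ⁆ =
    Smash.vfHom k A η * Smash.vfHom k A μ - Smash.vfHom k A μ * Smash.vfHom k A η := by
  have h1 := Smash.ofVF_mul_mk_one η (UniversalEnvelopingAlgebra.ι k μ)
  have h2 := Smash.ofVF_mul_mk_one μ (UniversalEnvelopingAlgebra.ι k η)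
  change (1 : A) ⊗ₜ[k] (UniversalEnvelopingAlgebra.ι k ⁅η, μ⁆ : UV k A) =
    Smash.ofVF η * Smash.mk 1 (UniversalEnvelopingAlgebra.ι k μ) -
      Smash.ofVF μ * Smash.mk 1 (UniversalEnvelopingAlgebra.ι k η)
  rw [h1, h2, LieHom.map_lie, LieRing.of_associative_ring_bracket, TensorProduct.tmul_sub]
  rfl

/-- A subspace of a module over the smash product that is stable under functions and vector fields
is a submodule. -/
lemma Smash.smul_mem_of_stable {M : Type*} [AddCommGroup M] [Module k M] [Module (Smash k A) M]
    [IsScalarTower k (Smash k A) M] (N : Submodule k M)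
    (hf : ∀ (f : A), ∀ x ∈ N, (Smash.funHom k A f) • x ∈ N)
    (hv : ∀ (η : VF k A), ∀ x ∈ N, (Smash.vfHom k A η) • x ∈ N) (s : Smash k A) {x : M}
    (hx : x ∈ N) : s • x ∈ N := by
  have hu : ∀ u : UV k A, ∀ x ∈ N, (Smash.mk 1 u : Smash k A) • x ∈ N := by
    intro u
    induction u using env_induction with
    | h1 => intro x hx; exact (one_smul (Smash k A) x).symm ▸ hx
    | hadd u w hu hw =>
      intro x hx
      have : (Smash.mk 1 (u + w) : Smash k A) = Smash.mk 1 u + Smash.mk 1 w :=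
        TensorProduct.tmul_add _ _ _
      rw [this, add_smul]
      exact N.add_mem (hu x hx) (hw x hx)
    | hsmul c u hu =>
      intro x hx
      have : (Smash.mk 1 (c • u) : Smash k A) = c • Smash.mk 1 u := TensorProduct.tmul_smul _ _ _
      rw [this, smul_assoc]
      exact N.smul_mem c (hu x hx)
    | hι η u hu =>
      intro x hx
      rw [← Smash.ofVF_mul_mk_one, mul_smul]
      exact hv η _ (hu x hx)
  refine TensorProduct.induction_on
    (motive := fun t => HSMul.hSMul (α := Smash k A) (β := M) (γ := M) t x ∈ N) s ?_ ?_ ?_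
  · exact (zero_smul (Smash k A) x).symm ▸ N.zero_mem
  · intro f u
    have h1 := Smash.ofFun_mul_mk f 1 u
    rw [mul_one] at h1
    have h2 : (Smash.mk f u : Smash k A) • x =
        Smash.funHom k A f • (Smash.mk 1 u : Smash k A) • x := by
      rw [smul_smul, Smash.funHom_apply, h1]
    exact h2 ▸ hf f _ (hu u x hx)
  · exact fun s t hs ht =>
      (congrArg (· ∈ N) (add_smul (R := Smash k A) s t x)).mpr (N.add_mem hs ht)

end SmashRelations

/-! ### The copies of the Weyl algebra and of `L₊` in the smash product -/

section Splitting

open MvPolynomial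

variable {k : Type u} [Field k] {n : ℕ}

lemma pderiv_lie (i j : Fin n) :
    ⁅(pderiv i : VF k (Poly k n)), (pderiv j : VF k (Poly k n))⁆ = 0 := by
  ext1 f
  rw [Derivation.commutator_apply]
  exact sub_eq_zero.2 (pderiv_comm i j _)

/-- The partial derivatives commute already in `V`. In the resulting copy of `D` the operator `x^a
∂ᵢ` is the product `x^a # ∂ᵢ`, in general different from `1 # x^a ∂ᵢ`; the discrepancy is carried by
the jets. -/
lemma smash_weylRel :
    WeylRel (Smash.funHom k (Poly k n)) (fun i => Smash.vfHom k (Poly k n) (pderiv i)) where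
  comm i j := by
    rw [← sub_eq_zero, ← Smash.vfHom_lie, pderiv_lie, map_zero]
  rel i f := Smash.vfHom_mul_funHom _ _

lemma smul_pderiv_lie (f g : Poly k n) (i j : Fin n) :
    ⁅f • (pderiv i : VF k (Poly k n)), g • (pderiv j : VF k (Poly k n))⁆ =
      (f * pderiv i g) • (pderiv j : VF k (Poly k n)) -
        (g * pderiv j f) • (pderiv i : VF k (Poly k n)) := by
  ext1 h
  simp only [Derivation.commutator_apply, Derivation.smul_apply, Derivation.sub_apply,
    Derivation.leibniz, smul_eq_mul]
  rw [pderiv_comm i j]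
  ring

variable (k) in
/-- The map `f ⊗ g ↦ f # g ∂ᵢ`. -/
def coeffVF (i : Fin n) : Poly k n ⊗[k] Poly k n →ₗ[k] AVAlg k n :=
  TensorProduct.lift ((LinearMap.mul k (AVAlg k n)).compl₁₂ (Smash.funHom k (Poly k n)).toLinearMap
    (Smash.vfHom k (Poly k n) ∘ₗ
      ((LinearMap.toSpanSingleton (Poly k n) (VF k (Poly k n)) (pderiv i)).restrictScalars k)))

lemma coeffVF_tmul (i : Fin n) (f g : Poly k n) : coeffVF k i (f ⊗ₜ g) =
    Smash.funHom k (Poly k n) f * Smash.vfHom k (Poly k n) (g • pderiv i) := by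
  simp only [coeffVF, TensorProduct.lift.tmul]
  rfl

lemma coeffVF_tmul_one_mul (i : Fin n) (f : Poly k n) (t : Poly k n ⊗[k] Poly k n) :
    coeffVF k i ((f ⊗ₜ 1) * t) = Smash.funHom k (Poly k n) f * coeffVF k i t := by
  induction t with
  | zero => simp
  | add x y hx hy => simp only [mul_add, map_add, hx, hy]
  | tmul a b =>
    rw [Algebra.TensorProduct.tmul_mul_tmul, one_mul, coeffVF_tmul, coeffVF_tmul, map_mul, mul_assoc]

variable (k n) in
/-- Multiplication `A ⊗ A → A`, restriction to the diagonal. -/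
abbrev diagRestrict : Poly k n ⊗[k] Poly k n →ₐ[k] Poly k n := Algebra.TensorProduct.lmul' k

/-- The element `f # g ∂ᵢ` differentiates functions through the product `f g` only, so coefficients
vanishing on the diagonal give elements commuting with `A`. -/
lemma coeffVF_mul_funHom (i : Fin n) (t : Poly k n ⊗[k] Poly k n) (g : Poly k n) :
    coeffVF k i t * Smash.funHom k (Poly k n) g = Smash.funHom k (Poly k n) g * coeffVF k i t +
      Smash.funHom k (Poly k n) (diagRestrict k n t * pderiv i g) := by
  induction t with
  | zero => simp
  | add x y hx hy => simp only [map_add, add_mul, mul_add, hx, hy]; abel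
  | tmul a b =>
    rw [coeffVF_tmul, mul_assoc, Smash.vfHom_mul_funHom, mul_add, ← mul_assoc, ← mul_assoc,
      ← map_mul, ← map_mul, ← map_mul, mul_comm g, Algebra.TensorProduct.lmul'_apply_tmul,
      Derivation.smul_apply, smul_eq_mul, mul_assoc a]

/-- The commutator with `∂ⱼ` differentiates both tensor factors, so translation-invariant
coefficients give elements commuting with `∂ⱼ`. -/
lemma vfHom_pderiv_mul_coeffVF (i j : Fin n) (t : Poly k n ⊗[k] Poly k n) :
    Smash.vfHom k (Poly k n) (pderiv j) * coeffVF k i t =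
      coeffVF k i t * Smash.vfHom k (Poly k n) (pderiv j) +
        coeffVF k i (pderivLeft j t + pderivRight j t) := by
  induction t with
  | zero => simp
  | add x y hx hy =>
    simp only [map_add, add_mul, mul_add] at hx hy ⊢
    rw [hx, hy]; abel
  | tmul a b =>
    have h1 : Smash.vfHom k (Poly k n) (pderiv j) * Smash.vfHom k (Poly k n) (b • pderiv i) =
        Smash.vfHom k (Poly k n) (b • pderiv i) * Smash.vfHom k (Poly k n) (pderiv j) +
          Smash.vfHom k (Poly k n) (pderiv j b • pderiv i) := by
      have h2 := smul_pderiv_lie 1 b j i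
      rw [pderiv_one, mul_zero, zero_smul, sub_zero, one_smul, one_mul] at h2
      rw [← h2, Smash.vfHom_lie]
      abel
    rw [pderivLeft_tmul, pderivRight_tmul, map_add, coeffVF_tmul, coeffVF_tmul, coeffVF_tmul,
      ← mul_assoc, Smash.vfHom_mul_funHom, add_mul, mul_assoc, h1, mul_add, mul_assoc]
    abel

/-- Derivatives of right factors come from brackets in `V`; derivatives of left factors come from
vector fields acting on functions and carry a restriction to the diagonal. The latter drop out when
both coefficients vanish there. -/
lemma coeffVF_commutator (i j : Fin n) (s t : Poly k n ⊗[k] Poly k n) :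
    coeffVF k i s * coeffVF k j t - coeffVF k j t * coeffVF k i s =
      coeffVF k j (s * pderivRight i t) - coeffVF k i (t * pderivRight j s) +
        (Smash.funHom k (Poly k n) (diagRestrict k n s) * coeffVF k j (pderivLeft i t) -
          Smash.funHom k (Poly k n) (diagRestrict k n t) * coeffVF k i (pderivLeft j s)) := by
  induction s with
  | zero => simp
  | add x y hx hy =>
    calc _ = (coeffVF k i x * coeffVF k j t - coeffVF k j t * coeffVF k i x) +
          (coeffVF k i y * coeffVF k j t - coeffVF k j t * coeffVF k i y) := by
          rw [map_add, add_mul, mul_add]; abel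
      _ = _ := by
          rw [hx, hy]
          simp only [map_add, add_mul, mul_add]
          abel
  | tmul f g =>
    induction t with
    | zero => simp
    | add x y hx hy =>
      calc _ = (coeffVF k i (f ⊗ₜ g) * coeffVF k j x - coeffVF k j x * coeffVF k i (f ⊗ₜ g)) +
            (coeffVF k i (f ⊗ₜ g) * coeffVF k j y - coeffVF k j y * coeffVF k i (f ⊗ₜ g)) := by
            rw [map_add, add_mul, mul_add]; abel
        _ = _ := by
            rw [hx, hy]
            simp only [map_add, add_mul, mul_add]
            abel
    | tmul a b =>
      have h1 := Smash.vfHom_lie (g • (pderiv i : VF k (Poly k n))) (b • pderiv j)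
      rw [smul_pderiv_lie, map_sub] at h1
      simp only [pderivRight_tmul, pderivLeft_tmul, Algebra.TensorProduct.tmul_mul_tmul,
        coeffVF_tmul, Algebra.TensorProduct.lmul'_apply_tmul]
      have h2 := Smash.vfHom_mul_funHom (g • (pderiv i : VF k (Poly k n))) a
      have h3 := Smash.vfHom_mul_funHom (b • (pderiv j : VF k (Poly k n))) f
      rw [Derivation.smul_apply, smul_eq_mul] at h2 h3
      generalize Smash.vfHom k (Poly k n) (g • pderiv i) = Vg at *
      generalize Smash.vfHom k (Poly k n) (b • pderiv j) = Vb at *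
      generalize Smash.vfHom k (Poly k n) ((g * pderiv i b) • pderiv j) = V1 at *
      generalize Smash.vfHom k (Poly k n) ((b * pderiv j g) • pderiv i) = V2 at *
      set φ := Smash.funHom k (Poly k n)
      have e1 : φ f * Vg * (φ a * Vb) = φ (f * a) * (Vg * Vb) + φ (f * g) * (φ (pderiv i a) * Vb) := by
        calc _ = φ f * (Vg * φ a) * Vb := by noncomm_ring
          _ = _ := by rw [h2, map_mul φ g, map_mul, map_mul]; noncomm_ring
      have e2 : φ a * Vb * (φ f * Vg) = φ (a * f) * (Vb * Vg) + φ (a * b) * (φ (pderiv j f) * Vg) := by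
        calc _ = φ a * (Vb * φ f) * Vg := by noncomm_ring
          _ = _ := by rw [h3, map_mul φ b, map_mul, map_mul]; noncomm_ring
      have e3 : φ (f * a) * (Vg * Vb) - φ (f * a) * (Vb * Vg) = φ (f * a) * V1 - φ (f * a) * V2 := by
        rw [← mul_sub, ← mul_sub, h1]
      rw [e1, e2, mul_comm a f, add_sub_add_comm, e3]

variable (k n) in
/-- The Taylor shift `f ↦ f(1 ⊗ x - x ⊗ 1)`. -/
def shift : Poly k n →ₐ[k] Poly k n ⊗[k] Poly k n :=
  aeval fun i => 1 ⊗ₜ X i - X i ⊗ₜ 1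

@[simp] lemma shift_X (i : Fin n) : shift k n (X i) = 1 ⊗ₜ X i - X i ⊗ₜ 1 := by simp [shift]

/-- On the diagonal the differences vanish, so the shift becomes evaluation at the origin. This is
why the fields must vanish there, that is, lie in `L₊`. -/
lemma diagRestrict_shift (f : Poly k n) : diagRestrict k n (shift k n f) = C (constantCoeff f) := by
  induction f using MvPolynomial.induction_on with
  | C c => simp
  | add p q hp hq => simp only [map_add, hp, hq]
  | mul_X p i _ => simp

lemma pderivRight_shift (i : Fin n) (f : Poly k n) :
    pderivRight i (shift k n f) = shift k n (pderiv i f) := by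
  induction f using MvPolynomial.induction_on with
  | C c => simp
  | add p q hp hq => simp only [map_add, hp, hq]
  | mul_X p j hp =>
    rw [pderiv_mul, map_add, map_mul (shift k n), map_mul (shift k n), map_mul (shift k n),
      pderivRight_mul, hp]
    congr 2
    by_cases h : j = i
    · subst h; simp [Algebra.TensorProduct.one_def]
    · simp [pderiv_X_of_ne h]

/-- Functions of `1 ⊗ x - x ⊗ 1` are translation invariant: the derivatives in the two factors
cancel. -/
lemma pderivLeft_shift (i : Fin n) (f : Poly k n) :
    pderivLeft i (shift k n f) = -shift k n (pderiv i f) := by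
  rw [eq_neg_iff_add_eq_zero]
  induction f using MvPolynomial.induction_on with
  | C c => simp
  | add p q hp hq =>
    simp only [map_add]
    rw [add_add_add_comm, hp, hq, add_zero]
  | mul_X p j hp =>
    have h1 : pderivLeft i (shift k n (X j)) + shift k n (pderiv i (X j)) = 0 := by
      by_cases h : j = i
      · subst h; simp [Algebra.TensorProduct.one_def]
      · simp [pderiv_X_of_ne h]
    rw [pderiv_mul, map_add, map_mul (shift k n), map_mul (shift k n), map_mul (shift k n),
      pderivLeft_mul, add_add_add_comm, ← add_mul, ← mul_add, hp, h1, zero_mul, mul_zero, add_zero]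

variable (k n) in
/-- The map from vector fields to the smash product that sends `f ∂ᵢ` to the Taylor shift
of `f` applied to `∂ᵢ`. -/
def jetMap : VF k (Poly k n) →ₗ[k] AVAlg k n where
  toFun η := ∑ i, coeffVF k i (shift k n (η (X i)))
  map_add' η μ := by simp only [Derivation.add_apply, map_add, Finset.sum_add_distrib]
  map_smul' c η := by
    simp only [Derivation.smul_apply, map_smul, Finset.smul_sum, RingHom.id_apply]

lemma jetMap_apply (η : VF k (Poly k n)) :
    jetMap k n η = ∑ i, coeffVF k i (shift k n (η (X i))) := rfl

lemma jetMap_smul_pderiv (f : Poly k n) (i : Fin n) :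
    jetMap k n (f • pderiv i) = coeffVF k i (shift k n f) := by
  rw [jetMap_apply, Finset.sum_eq_single i]
  · simp
  · intro j _ hj
    simp [pderiv_X_of_ne hj]
  · simp

lemma constantCoeff_of_mem_maxIdeal {f : Poly k n} (hf : f ∈ maxIdeal k n) :
    constantCoeff f = 0 := by
  have : maxIdeal k n ≤ RingHom.ker (constantCoeff : Poly k n →+* k) := by
    rw [maxIdeal, Ideal.span_le]
    rintro _ ⟨i, rfl⟩
    simp
  exact this hf

lemma diagRestrict_shift_apply {η : VF k (Poly k n)} (hη : η ∈ LPlus k n) (f : Poly k n) :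
    diagRestrict k n (shift k n (η f)) = 0 := by
  rw [diagRestrict_shift, constantCoeff_of_mem_maxIdeal (apply_mem_maxIdeal hη f), C_0]

lemma commute_jetMap_funHom {η : VF k (Poly k n)} (hη : η ∈ LPlus k n) (f : Poly k n) :
    Commute (jetMap k n η) (Smash.funHom k (Poly k n) f) := by
  rw [jetMap_apply]
  refine Commute.sum_left _ _ _ fun i _ => ?_
  rw [Commute, SemiconjBy, coeffVF_mul_funHom, diagRestrict_shift_apply hη, zero_mul, map_zero,
    add_zero]

lemma commute_jetMap_pderiv (η : VF k (Poly k n)) (j : Fin n) :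
    Commute (jetMap k n η) (Smash.vfHom k (Poly k n) (pderiv j)) := by
  rw [jetMap_apply]
  refine Commute.sum_left _ _ _ fun i _ => ?_
  rw [Commute, SemiconjBy, vfHom_pderiv_mul_coeffVF, pderivLeft_shift, pderivRight_shift,
    neg_add_cancel, map_zero, add_zero]

lemma apply_eq_sum (η : VF k (Poly k n)) (f : Poly k n) : η f = ∑ i, η (X i) * pderiv i f := by
  conv_lhs => rw [derivation_eq_sum η, derivation_sum_apply]
  rfl

/-- For coefficients vanishing on the diagonal only the derivatives of right factors survive in the
commutator. These pass through the shift and assemble to the bracket of vector fields. -/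
lemma jetMap_lie {η μ : VF k (Poly k n)} (hη : η ∈ LPlus k n) (hμ : μ ∈ LPlus k n) :
    jetMap k n ⁅η, μ⁆ = jetMap k n η * jetMap k n μ - jetMap k n μ * jetMap k n η := by
  have h1 : ∀ i j, coeffVF k i (shift k n (η (X i))) * coeffVF k j (shift k n (μ (X j))) -
      coeffVF k j (shift k n (μ (X j))) * coeffVF k i (shift k n (η (X i))) =
      coeffVF k j (shift k n (η (X i) * pderiv i (μ (X j)))) -
        coeffVF k i (shift k n (μ (X j) * pderiv j (η (X i)))) := by
    intro i j
    rw [coeffVF_commutator, diagRestrict_shift_apply hη, diagRestrict_shift_apply hμ, map_zero,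
      zero_mul, zero_mul, sub_zero, add_zero, pderivRight_shift, pderivRight_shift,
      map_mul (shift k n), map_mul (shift k n)]
  have h2 : jetMap k n η * jetMap k n μ - jetMap k n μ * jetMap k n η =
      ∑ i, ∑ j, (coeffVF k j (shift k n (η (X i) * pderiv i (μ (X j)))) -
        coeffVF k i (shift k n (μ (X j) * pderiv j (η (X i))))) := by
    rw [jetMap_apply, jetMap_apply, Finset.sum_mul_sum, Finset.sum_mul_sum,
      Finset.sum_comm (f := fun j i => coeffVF k j (shift k n (μ (X j))) *
        coeffVF k i (shift k n (η (X i)))), ← Finset.sum_sub_distrib]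
    refine Finset.sum_congr rfl fun i _ => ?_
    rw [← Finset.sum_sub_distrib]
    exact Finset.sum_congr rfl fun j _ => h1 i j
  rw [h2]
  simp only [Finset.sum_sub_distrib]
  rw [Finset.sum_comm]
  simp only [← map_sum]
  simp only [← apply_eq_sum]
  rw [← Finset.sum_sub_distrib, jetMap_apply]
  refine Finset.sum_congr rfl fun i _ => ?_
  rw [Derivation.commutator_apply, map_sub, map_sub]

/-- The multi-index binomial theorem. -/
lemma prod_add_pow_eq_sum {R : Type*} [CommRing R] (x y : Fin n → R) (a : Fin n →₀ ℕ) :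
    ∏ i, (x i + y i) ^ a i =
      ∑ b ∈ Finset.Icc 0 a, multiChoose a b • ((∏ i, x i ^ (a - b) i) * ∏ i, y i ^ b i) := by
  have h1 : ∀ i, (x i + y i) ^ a i =
      ∑ c ∈ Finset.range (a i + 1), (y i) ^ c * x i ^ (a i - c) * ((a i).choose c : R) := by
    intro i; rw [add_comm, add_pow]
  simp only [h1, Finset.prod_univ_sum]
  refine Finset.sum_nbij' (fun f => Finsupp.equivFunOnFinite.symm f) (fun b => ⇑b) ?_ ?_ ?_ ?_ ?_
  · intro f hf
    rw [Fintype.mem_piFinset] at hf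
    refine Finset.mem_Icc.2 ⟨zero_le, fun i => ?_⟩
    exact Nat.lt_succ_iff.1 (Finset.mem_range.1 (hf i))
  · intro b hb
    rw [Fintype.mem_piFinset]
    exact fun i => Finset.mem_range.2 (Nat.lt_succ_iff.2 ((Finset.mem_Icc.1 hb).2 i))
  · intro f _; rfl
  · intro b _; ext i; rfl
  · intro f _
    rw [Finset.prod_mul_distrib, Finset.prod_mul_distrib, nsmul_eq_mul, multiChoose, Nat.cast_prod,
      mul_comm]
    congr 1
    rw [mul_comm]
    rfl

lemma mono_eq_prod (a : Fin n →₀ ℕ) : mono k a = ∏ i, X i ^ a i := by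
  rw [mono, monomial_eq, C_1, one_mul, Finsupp.prod_fintype _ _ fun i => pow_zero _]

/-- The expansion of `x^a ∂ᵢ` in terms of the copies of the Weyl algebra and of `L₊`. -/
lemma vfHom_monoVF (a : Fin n →₀ ℕ) (i : Fin n) : Smash.vfHom k (Poly k n) (monoVF k a i) =
    ∑ b ∈ Finset.Icc 0 a, multiChoose a b •
      (Smash.funHom k (Poly k n) (mono k (a - b)) * jetMap k n (monoVF k b i)) := by
  -- Taylor expansion: write `1 ⊗ x` as `x ⊗ 1 + (1 ⊗ x - x ⊗ 1)` and apply the binomial theorem to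
  -- its powers.
  have h1 : (1 : Poly k n) ⊗ₜ[k] mono k a = ∑ b ∈ Finset.Icc 0 a, multiChoose a b •
      ((mono k (a - b) ⊗ₜ[k] 1) * shift k n (mono k b)) := by
    have h2 := prod_add_pow_eq_sum (fun i : Fin n => (X i : Poly k n) ⊗ₜ[k] (1 : Poly k n))
      (fun i => shift k n (X i)) a
    have h3 : ∀ b : Fin n →₀ ℕ, mono k b ⊗ₜ[k] (1 : Poly k n) =
        ∏ i, ((X i : Poly k n) ⊗ₜ[k] (1 : Poly k n)) ^ b i := by
      intro b
      have := map_prod (Algebra.TensorProduct.includeLeft : Poly k n →ₐ[k] Poly k n ⊗[k] Poly k n)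
        (fun i => X i ^ b i) Finset.univ
      rw [← mono_eq_prod] at this
      simpa only [map_pow, Algebra.TensorProduct.includeLeft_apply] using this
    have h4 : (1 : Poly k n) ⊗ₜ[k] mono k a =
        ∏ i, ((1 : Poly k n) ⊗ₜ[k] (X i : Poly k n)) ^ a i := by
      have := map_prod (Algebra.TensorProduct.includeRight : Poly k n →ₐ[k] Poly k n ⊗[k] Poly k n)
        (fun i => X i ^ a i) Finset.univ
      rw [← mono_eq_prod] at this
      simpa only [map_pow, Algebra.TensorProduct.includeRight_apply] using this
    have h5 : ∀ b : Fin n →₀ ℕ, shift k n (mono k b) = ∏ i, shift k n (X i) ^ b i := by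
      intro b
      rw [mono_eq_prod, map_prod]
      simp only [map_pow]
    simp only [h3, h4, h5]
    rw [← h2]
    refine Finset.prod_congr rfl fun i _ => ?_
    rw [shift_X, add_sub_cancel]
  have h6 := congrArg (coeffVF k i) h1
  rw [coeffVF_tmul, map_one, one_mul, map_sum] at h6
  refine h6.trans (Finset.sum_congr rfl fun b _ => ?_)
  rw [map_nsmul, coeffVF_tmul_one_mul, monoVF, jetMap_smul_pderiv]

variable [CharZero k]

variable (k n) in
/-- The embedding of the Weyl algebra into the smash product. -/
def weylToSmash : WeylRing k n →ₐ[k] AVAlg k n := smash_weylRel.exists_weylRing_algHom.choose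

lemma weylToSmash_funHom (f : Poly k n) :
    weylToSmash k n (WeylRing.funHom k n f) = Smash.funHom k (Poly k n) f :=
  smash_weylRel.exists_weylRing_algHom.choose_spec.1 f

lemma weylToSmash_deriv (i : Fin n) :
    weylToSmash k n (WeylRing.deriv k i) = Smash.vfHom k (Poly k n) (pderiv i) :=
  smash_weylRel.exists_weylRing_algHom.choose_spec.2 i

lemma commute_jetMap_weylToSmash {η : VF k (Poly k n)} (hη : η ∈ LPlus k n) (a : WeylRing k n) :
    Commute (jetMap k n η) (weylToSmash k n a) := by
  induction WeylRing.mem_adjoin a using Algebra.adjoin_induction with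
  | mem x hx =>
    rcases hx with ⟨i, rfl⟩ | ⟨i, rfl⟩
    · change Commute _ (weylToSmash k n (WeylRing.funHom k n (X i)))
      rw [weylToSmash_funHom]; exact commute_jetMap_funHom hη _
    · rw [weylToSmash_deriv]; exact commute_jetMap_pderiv _ _
  | algebraMap c => rw [AlgHom.commutes]; exact (Algebra.commutes c _).symm
  | add x y _ _ hx hy => rw [map_add]; exact hx.add_right hy
  | mul x y _ _ hx hy => rw [map_mul]; exact hx.mul_right hy

end Splitting

end AVMod

namespace AVMod

/-! ### Generators of `L₊` -/

section Generators

open MvPolynomial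

variable {k : Type u} [Field k] {n : ℕ}

lemma mono_add (a b : Fin n →₀ ℕ) : mono k (a + b) = mono k a * mono k b := by
  rw [mono, mono, mono, monomial_mul, one_mul]

lemma mono_single (j : Fin n) : mono k (Finsupp.single j 1) = X j := rfl

lemma smul_pderiv_sub (f g : Poly k n) (i : Fin n) :
    f • (pderiv i : VF k (Poly k n)) - g • (pderiv i : VF k (Poly k n)) = (f - g) • pderiv i := by
  ext1 h
  simp only [Derivation.sub_apply, Derivation.smul_apply, smul_eq_mul, sub_mul]

/-- Bracketing with `x_j x_l ∂_l` raises the exponent of `x_j` by one, up to a scalar. The freedom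
in `l` serves to make the scalar nonzero. -/
lemma lie_quadratic_of_ne {i j : Fin n} (hij : j ≠ i) (l : Fin n) (a : Fin n →₀ ℕ) :
    ⁅monoVF k (Finsupp.single j 1 + Finsupp.single l 1) l, monoVF k a i⁆ =
      ((a l : k) - if l = i then 1 else 0) • monoVF k (Finsupp.single j 1 + a) i := by
  rw [monoVF, monoVF, monoVF, smul_pderiv_lie, mono_add, mono_add, mono_single, mono_single,
    mul_assoc, X_mul_pderiv_monomial, pderiv_mul, pderiv_X_of_ne hij, zero_mul, zero_add,
    ← smul_assoc, mul_smul_comm, ← Nat.cast_smul_eq_nsmul k, ← mono]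
  split_ifs with h
  · subst h
    rw [pderiv_X_self, mul_one, smul_pderiv_sub, sub_smul (a l : k), one_smul, mul_comm (mono k a)]
  · rw [pderiv_X_of_ne h, mul_zero, mul_zero, zero_smul, sub_zero, sub_zero]

lemma lie_quadratic_self (i : Fin n) (a : Fin n →₀ ℕ) :
    ⁅monoVF k (Finsupp.single i 1 + Finsupp.single i 1) i, monoVF k a i⁆ =
      ((a i : k) - 2) • monoVF k (Finsupp.single i 1 + a) i := by
  rw [monoVF, monoVF, monoVF, smul_pderiv_lie, mono_add, mono_add, mono_single,
    mul_assoc, X_mul_pderiv_monomial, pderiv_mul, pderiv_X_self, one_mul, mul_one,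
    ← smul_assoc, mul_smul_comm, ← Nat.cast_smul_eq_nsmul k, ← mono, smul_pderiv_sub,
    sub_smul (a i : k), ← two_mul, mul_left_comm, mul_comm (mono k a), two_mul, two_smul]

/-- Induction on the degree: from degree four on, `x^b ∂ᵢ` is a nonzero multiple of the bracket of a
quadratic field with a monomial field of degree one less. -/
lemma monoVF_mem_of_closed [CharZero k] (W : Submodule k (VF k (Poly k n)))
    (hW : ∀ η ∈ LPlus k n, ∀ μ ∈ LPlus k n, η ∈ W → μ ∈ W → ⁅η, μ⁆ ∈ W)
    (hgen : ∀ (a : Fin n →₀ ℕ) (i : Fin n), a ≠ 0 → a.degree ≤ 3 → monoVF k a i ∈ W)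
    (b : Fin n →₀ ℕ) (i : Fin n) (hb : b ≠ 0) : monoVF k b i ∈ W := by
  induction hd : b.degree using Nat.strong_induction_on generalizing b with
  | _ d ih =>
  by_cases hd3 : d ≤ 3
  · exact hgen b i hb (by omega)
  have hquad : ∀ j l : Fin n,
      (Finsupp.single j 1 + Finsupp.single l 1 : Fin n →₀ ℕ) ≠ 0 ∧
        (Finsupp.single j 1 + Finsupp.single l 1 : Fin n →₀ ℕ).degree ≤ 3 := by
    intro j l
    constructor
    · intro h
      have := congrArg Finsupp.degree h
      simp at this
    · simp
  have key : ∀ j l : Fin n, ∀ c : k, c ≠ 0 → b j ≠ 0 →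
      ⁅monoVF k (Finsupp.single j 1 + Finsupp.single l 1) l, monoVF k (b - Finsupp.single j 1) i⁆ =
        c • monoVF k (Finsupp.single j 1 + (b - Finsupp.single j 1)) i → monoVF k b i ∈ W := by
    intro j l c hc hj heq
    have h2 : Finsupp.single j 1 + (b - Finsupp.single j 1) = b :=
      add_tsub_cancel_of_le (by rw [Finsupp.single_le_iff]; omega)
    have h3 := congrArg Finsupp.degree h2
    rw [map_add, Finsupp.degree_single] at h3
    have h4 : b - Finsupp.single j 1 ≠ 0 := by
      intro h0
      rw [h0, map_zero] at h3
      omega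
    rw [h2] at heq
    have h5 : ⁅monoVF k (Finsupp.single j 1 + Finsupp.single l 1) l,
        monoVF k (b - Finsupp.single j 1) i⁆ ∈ W :=
      hW _ (monoVF_mem k _ (hquad j l).1 l) _ (monoVF_mem k _ h4 i)
        (hgen _ _ (hquad j l).1 (hquad j l).2) (ih _ (by omega) _ h4 rfl)
    rw [heq] at h5
    exact (W.smul_mem_iff hc).1 h5
  by_cases hj : ∃ j, j ≠ i ∧ b j ≠ 0
  · obtain ⟨j, hji, hbj⟩ := hj
    -- If the scalar vanished for every `l`, then `b - e_j = e_i` and `b` would have degree two.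
    obtain ⟨l, hl⟩ : ∃ l, (((b - Finsupp.single j 1 : Fin n →₀ ℕ) l : k) -
        if l = i then 1 else 0) ≠ 0 := by
      by_contra! H
      have hi := H i
      rw [if_pos rfl, sub_eq_zero] at hi
      have hi' : (b - Finsupp.single j 1 : Fin n →₀ ℕ) i = 1 := by exact_mod_cast hi
      have h0 : b - Finsupp.single j 1 = Finsupp.single i 1 := by
        ext l
        by_cases hli : l = i
        · subst hli; simpa using hi'
        · have := H l
          rw [if_neg hli, sub_zero, Nat.cast_eq_zero] at this
          rw [this, Finsupp.single_eq_of_ne hli]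
      have h2 : Finsupp.single j 1 + (b - Finsupp.single j 1) = b :=
        add_tsub_cancel_of_le (by rw [Finsupp.single_le_iff]; omega)
      have h3 := congrArg Finsupp.degree h2
      rw [h0, map_add, Finsupp.degree_single, Finsupp.degree_single] at h3
      omega
    exact key j l _ hl hbj (lie_quadratic_of_ne hji l _)
  · push Not at hj
    have hbi : b = Finsupp.single i (b i) := by
      ext l
      by_cases hli : l = i
      · subst hli; simp
      · rw [hj l hli, Finsupp.single_eq_of_ne hli]
    have hdi : b i = d := by
      have := congrArg Finsupp.degree hbi
      rw [Finsupp.degree_single] at this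
      omega
    -- For a pure power of `x_i` the scalar is `(d - 1) - 2`, nonzero as `d ≥ 4`; it vanishes at `d
    -- = 3`, so this bracket needs degree three among the generators.
    refine key i i _ ?_ (by omega) (lie_quadratic_self i _)
    have : (b - Finsupp.single i 1 : Fin n →₀ ℕ) i = d - 1 := by simp [hdi]
    rw [this, sub_ne_zero]
    have h2 : d - 1 ≠ 2 := by omega
    exact_mod_cast h2

lemma eq_sum_monoVF (η : VF k (Poly k n)) :
    η = ∑ i, ∑ s ∈ (η (X i)).support, coeff s (η (X i)) • monoVF k s i := by
  conv_lhs => rw [derivation_eq_sum η]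
  refine Finset.sum_congr rfl fun i _ => ?_
  conv_lhs => rw [(η (X i)).as_sum, Finset.sum_smul]
  refine Finset.sum_congr rfl fun s _ => ?_
  rw [monoVF, ← smul_assoc, smul_monomial, smul_eq_mul, mul_one]

/-- The Lie algebra `L₊` is generated by monomial vector fields of degree at most two, that is with
coefficients of degree at most three. -/
lemma mem_of_mem_LPlus [CharZero k] (W : Submodule k (VF k (Poly k n)))
    (hW : ∀ η ∈ LPlus k n, ∀ μ ∈ LPlus k n, η ∈ W → μ ∈ W → ⁅η, μ⁆ ∈ W)
    (hgen : ∀ (a : Fin n →₀ ℕ) (i : Fin n), a ≠ 0 → a.degree ≤ 3 → monoVF k a i ∈ W)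
    {η : VF k (Poly k n)} (hη : η ∈ LPlus k n) : η ∈ W := by
  rw [eq_sum_monoVF η]
  refine W.sum_mem fun i _ => W.sum_mem fun s hs => W.smul_mem _ ?_
  refine monoVF_mem_of_closed W hW hgen s i ?_
  rintro rfl
  exact mem_support_iff.1 hs (constantCoeff_of_mem_maxIdeal (apply_mem_maxIdeal hη _))

end Generators

/-! ### Growth in modules of bounded Gelfand–Kirillov dimension -/

section GKBound

open Filter

variable {k : Type u} [Field k] {R : Type u} [Ring R] [Algebra k R]

lemma Submodule.pow_mono_of_one_mem {C : Submodule k R} (h1 : (1 : R) ∈ C) {a b : ℕ} (h : a ≤ b) :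
    C ^ a ≤ C ^ b := by
  induction h with
  | refl => exact le_rfl
  | step _ ih =>
    refine ih.trans fun x hx => ?_
    rw [pow_succ, ← mul_one x]
    exact Submodule.mul_mem_mul hx h1

lemma exists_mem_pow_of_adjoin_eq_top {C : Submodule k R} (h1 : (1 : R) ∈ C)
    (hC : Algebra.adjoin k (C : Set R) = ⊤) (x : R) : ∃ r, x ∈ C ^ r := by
  have hx : x ∈ Algebra.adjoin k (C : Set R) := hC ▸ Algebra.mem_top
  induction hx using Algebra.adjoin_induction with
  | mem x hx => exact ⟨1, by rwa [pow_one]⟩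
  | algebraMap c => exact ⟨0, by rw [pow_zero]; exact Submodule.algebraMap_mem c⟩
  | add x y _ _ hx hy =>
    obtain ⟨r, hr⟩ := hx
    obtain ⟨s, hs⟩ := hy
    exact ⟨max r s, Submodule.add_mem _
      (Submodule.pow_mono_of_one_mem h1 (le_max_left _ _) hr)
      (Submodule.pow_mono_of_one_mem h1 (le_max_right _ _) hs)⟩
  | mul x y _ _ hx hy =>
    obtain ⟨r, hr⟩ := hx
    obtain ⟨s, hs⟩ := hy
    exact ⟨r + s, by rw [pow_add]; exact Submodule.mul_mem_mul hr hs⟩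

lemma exists_le_pow_of_adjoin_eq_top {C : Submodule k R} (h1 : (1 : R) ∈ C)
    (hC : Algebra.adjoin k (C : Set R) = ⊤) (E : Submodule k R) [FiniteDimensional k E] :
    ∃ r, E ≤ C ^ r := by
  obtain ⟨t, ht⟩ := (Submodule.fg_iff_finiteDimensional E).2 inferInstance
  choose r hr using exists_mem_pow_of_adjoin_eq_top h1 hC
  refine ⟨t.sup r, ?_⟩
  rw [← ht, Submodule.span_le]
  exact fun x hx => Submodule.pow_mono_of_one_mem h1 (Finset.le_sup hx) (hr x)

variable {M : Type*} [AddCommGroup M] [Module k M] [Module R M] [IsScalarTower k R M]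

lemma finiteDimensional_smul (E : Submodule k R) (N : Submodule k M) [FiniteDimensional k E]
    [FiniteDimensional k N] : FiniteDimensional k ↥(E • N) := by
  let f : E ⊗[k] N →ₗ[k] M := TensorProduct.lift
    (LinearMap.mk₂ k (fun e x => (e : R) • (x : M)) (fun e e' x => by simp [add_smul])
      (fun c e x => by simp) (fun e x x' => by simp)
      (fun c e x => by simp [smul_algebra_smul_comm]))
  have : E • N ≤ LinearMap.range f := by
    rw [Submodule.smul_le]
    exact fun e he x hx => ⟨(⟨e, he⟩ : E) ⊗ₜ (⟨x, hx⟩ : N), rfl⟩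
  exact Submodule.finiteDimensional_of_le this

instance finiteDimensional_pow (E : Submodule k R) [FiniteDimensional k E] (m : ℕ) :
    FiniteDimensional k ↥(E ^ m) :=
  (Submodule.fg_iff_finiteDimensional _).1
    (((Submodule.fg_iff_finiteDimensional E).2 inferInstance).pow m)

lemma exists_mem_pow_smul {C : Submodule k R} (h1 : (1 : R) ∈ C)
    (hC : Algebra.adjoin k (C : Set R) = ⊤) {M₀ : Submodule k M}
    (hM₀ : Submodule.span R (M₀ : Set M) = ⊤) (x : M) : ∃ s, x ∈ C ^ s • M₀ := by
  have hx : x ∈ Submodule.span R (M₀ : Set M) := hM₀ ▸ Submodule.mem_top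
  induction hx using Submodule.span_induction with
  | mem x hx =>
    refine ⟨0, ?_⟩
    rw [← one_smul R x, pow_zero]
    exact Submodule.smul_mem_smul (Submodule.one_le.1 le_rfl) hx
  | zero => exact ⟨0, Submodule.zero_mem _⟩
  | add x y _ _ hx hy =>
    obtain ⟨r, hr⟩ := hx
    obtain ⟨s, hs⟩ := hy
    exact ⟨max r s, Submodule.add_mem _
      (Submodule.smul_mono_left (Submodule.pow_mono_of_one_mem h1 (le_max_left _ _)) hr)
      (Submodule.smul_mono_left (Submodule.pow_mono_of_one_mem h1 (le_max_right _ _)) hs)⟩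
  | smul a x _ hx =>
    obtain ⟨s, hs⟩ := hx
    obtain ⟨r, hr⟩ := exists_mem_pow_of_adjoin_eq_top h1 hC a
    refine ⟨r + s, ?_⟩
    rw [pow_add, ← smul_eq_mul, Submodule.smul_assoc]
    exact Submodule.smul_mem_smul hr hs

/-- A limsup equal to `n` is below `n + 1/2`, so eventually `g m < m ^ (n + 1/2)`; squaring keeps
the exponents integral. Any order strictly between `n` and `n + 1` would serve. -/
lemma eventually_sq_le_of_limsup {g : ℕ → ℕ} {n : ℕ}
    (h : limsup (fun m : ℕ => ((Real.logb m (g m) : ℝ) : EReal)) atTop = ((n : ℝ) : EReal)) :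
    ∃ m₀, ∀ m ≥ m₀, g m ^ 2 ≤ m ^ (2 * n + 1) := by
  have h1 : limsup (fun m : ℕ => ((Real.logb m (g m) : ℝ) : EReal)) atTop <
      ((n + 1 / 2 : ℝ) : EReal) := by
    rw [h, EReal.coe_lt_coe_iff]; linarith
  have h2 := (eventually_lt_of_limsup_lt h1).and (eventually_ge_atTop 2)
  obtain ⟨m₀, hm₀⟩ := eventually_atTop.1 h2
  refine ⟨m₀, fun m hm => ?_⟩
  obtain ⟨h3, h4⟩ := hm₀ m hm
  -- `Real.logb m 0` is `0` by convention, so a zero value of `g` is treated apart.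
  rcases Nat.eq_zero_or_pos (g m) with h0 | h0
  · rw [h0]; simp
  rw [EReal.coe_lt_coe_iff] at h3
  have hm1 : (1 : ℝ) < m := by exact_mod_cast h4
  have hg : (0 : ℝ) < g m := by exact_mod_cast h0
  have h5 : Real.logb m ((g m : ℝ) ^ 2) < (2 * n + 1 : ℕ) := by
    rw [Real.logb_pow]; push_cast; linarith
  rw [Real.logb_lt_iff_lt_rpow hm1 (by positivity), Real.rpow_natCast] at h5
  exact_mod_cast h5.le

/-- The growth of a vector under any finite-dimensional subspace of the algebra is bounded by the
Gelfand–Kirillov dimension. -/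
lemma HasGKDim.exists_bound {n : ℕ} (hM : HasGKDim k R M ((n : ℝ) : EReal)) (E : Submodule k R)
    [FiniteDimensional k E] (v : M) :
    ∃ K m₀ : ℕ, ∀ m ≥ m₀,
      Module.finrank k ↥(E ^ m • Submodule.span k {v}) ^ 2 ≤ K * m ^ (2 * n + 1) := by
  obtain ⟨C, M₀, hCf, h1, hC, hM₀f, hM₀, hlim⟩ := hM
  obtain ⟨m₀, hm₀⟩ := eventually_sq_le_of_limsup hlim
  obtain ⟨r, hr⟩ := exists_le_pow_of_adjoin_eq_top h1 hC E
  obtain ⟨s, hs⟩ := exists_mem_pow_smul h1 hC hM₀ v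
  -- Words of length `m` in `E` applied to `v` lie in `C ^ ((r + 1) m + s) • M₀`. Using `r + 1`
  -- keeps the exponent at least `m` even if `r = 0`, and `m ≥ 1` gives `(r + 1) m + s ≤ (r + 1 + s)
  -- m`.
  refine ⟨(r + 1 + s) ^ (2 * n + 1), m₀ + 1, fun m hm => ?_⟩
  have hle : E ^ m • Submodule.span k {v} ≤ C ^ ((r + 1) * m + s) • M₀ := by
    rw [pow_add, ← smul_eq_mul, Submodule.smul_assoc, pow_mul]
    refine Submodule.smul_mono ?_ ?_
    · exact pow_le_pow_left'
        (hr.trans (Submodule.pow_mono_of_one_mem h1 (Nat.le_succ r))) m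
    · rwa [Submodule.span_le, Set.singleton_subset_iff]
  have := finiteDimensional_smul (C ^ ((r + 1) * m + s)) M₀
  have h2 : m₀ ≤ (r + 1) * m + s := by nlinarith
  calc _ ≤ Module.finrank k ↥(C ^ ((r + 1) * m + s) • M₀) ^ 2 :=
        Nat.pow_le_pow_left (Submodule.finrank_mono hle) 2
    _ ≤ ((r + 1) * m + s) ^ (2 * n + 1) := hm₀ _ h2
    _ ≤ ((r + 1 + s) * m) ^ (2 * n + 1) := Nat.pow_le_pow_left (by nlinarith) _
    _ = _ := mul_pow _ _ _

end GKBound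

end AVMod

namespace AVMod

/-! ### Finite-dimensional jet modules -/

section JetModules

open MvPolynomial Filter

variable {k : Type u} [Field k] {n : ℕ}

variable (k n) in
/-- The span of `1` and of the images of the generators of `L₊` in the smash product. -/
def jetGens : Submodule k (AVAlg k n) :=
  Submodule.span k (insert 1 ((fun p : (Fin n →₀ ℕ) × Fin n => jetMap k n (monoVF k p.1 p.2)) ''
    {p | p.1 ≠ 0 ∧ p.1.degree ≤ 3}))

instance : FiniteDimensional k (jetGens k n) := by
  refine FiniteDimensional.span_of_finite k (Set.Finite.insert _ (Set.Finite.image _ ?_))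
  refine ((Finsupp.finite_of_degree_le (σ := Fin n) 3).prod (Set.finite_univ (α := Fin n))).subset ?_
  exact fun p hp => ⟨hp.2, Set.mem_univ _⟩

lemma one_mem_jetGens : (1 : AVAlg k n) ∈ jetGens k n :=
  Submodule.subset_span (Set.mem_insert _ _)

lemma jetMap_mem_jetGens {a : Fin n →₀ ℕ} (ha : a ≠ 0) (h : a.degree ≤ 3) (i : Fin n) :
    jetMap k n (monoVF k a i) ∈ jetGens k n :=
  Submodule.subset_span (Set.mem_insert_of_mem _ ⟨(a, i), ⟨ha, h⟩, rfl⟩)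

variable {M : Type v} [AddCommGroup M] [Module k M] [Module (AVAlg k n) M]
  [IsScalarTower k (AVAlg k n) M]

/-- The chain `J^m v` starts in dimension one. If it never stabilised it would gain a dimension at
each step, so that `dim J^m v ≥ m + 1` for all `m`. -/
lemma exists_jetGens_stable {v : M} (h : ∃ m, Module.finrank k
    ↥(jetGens k n ^ m • Submodule.span k {v}) ≤ m) (hv : v ≠ 0) :
    ∃ m, jetGens k n • (jetGens k n ^ m • Submodule.span k {v}) ≤
      jetGens k n ^ m • Submodule.span k {v} := by
  by_contra! H
  obtain ⟨m, hm⟩ := h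
  have hU : ∀ m, jetGens k n • (jetGens k n ^ m • Submodule.span k {v}) =
      jetGens k n ^ (m + 1) • Submodule.span k {v} := by
    intro m
    rw [pow_succ', ← smul_eq_mul, Submodule.smul_assoc]
  have key : ∀ m, m + 1 ≤ Module.finrank k ↥(jetGens k n ^ m • Submodule.span k {v}) := by
    intro m
    have hfin := finiteDimensional_smul (jetGens k n ^ m) (Submodule.span k {v})
    induction m with
    | zero =>
      rw [zero_add, Nat.one_le_iff_ne_zero, Submodule.finrank_eq_zero.ne, Submodule.ne_bot_iff]
      refine ⟨v, ?_, hv⟩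
      rw [← one_smul (AVAlg k n) v]
      exact Submodule.smul_mem_smul (by rw [pow_zero]; exact Submodule.one_le.1 le_rfl)
        (by rw [one_smul]; exact Submodule.mem_span_singleton_self v)
    | succ m ih =>
      have := ih (finiteDimensional_smul _ _)
      have hlt : jetGens k n ^ m • Submodule.span k {v} <
          jetGens k n ^ (m + 1) • Submodule.span k {v} := by
        refine lt_of_le_not_ge (Submodule.smul_mono_left
          (Submodule.pow_mono_of_one_mem one_mem_jetGens (Nat.le_succ m))) ?_
        rw [← hU]
        exact H m
      have := Submodule.finrank_lt_finrank_of_lt hlt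
      omega
  have := key m
  omega

variable [CharZero k]

lemma commute_of_mem_jetGens_pow (m : ℕ) {x : AVAlg k n} (hx : x ∈ jetGens k n ^ m)
    (a : WeylRing k n) : Commute x (weylToSmash k n a) := by
  let C : Subalgebra k (AVAlg k n) := Subalgebra.centralizer k {weylToSmash k n a}
  have h1 : jetGens k n ≤ Subalgebra.toSubmodule C := by
    refine Submodule.span_le.2 (Set.insert_subset C.one_mem ?_)
    rintro _ ⟨p, ⟨hp, -⟩, rfl⟩
    refine Subalgebra.mem_centralizer_iff k |>.2 ?_
    rintro _ rfl
    exact (commute_jetMap_weylToSmash (monoVF_mem k p.1 hp p.2) a).eq.symm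
  have h2 : ∀ m, jetGens k n ^ m ≤ Subalgebra.toSubmodule C := by
    intro m
    induction m with
    | zero => rw [pow_zero, Submodule.one_le]; exact C.one_mem
    | succ m ih =>
      rw [pow_succ, Submodule.mul_le]
      exact fun y hy z hz => C.mul_mem (ih hy) (h1 hz)
  exact ((Subalgebra.mem_centralizer_iff k).1 (h2 m hx) _ rfl).symm

/-- With `f` of order at least `m ^ n` and `g = O(m ^ (n + 1/2))`, the bound on `f u` leaves `u =
O(m ^ (1/2))`. -/
lemma exists_le_self_of_growth {f u g : ℕ → ℕ} {K m₀ : ℕ} (h1 : ∀ m, f m * u m ≤ g (m + m))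
    (h2 : ∀ m, (m / (n + 1) + 1) ^ n ≤ f m) (h3 : ∀ m ≥ m₀, g m ^ 2 ≤ K * m ^ (2 * n + 1)) :
    ∃ m, u m ≤ m := by
  by_contra! H
  -- Squaring `m ^ n * m ≤ (n + 1) ^ n * f m * u m` and inserting the bounds gives `m ≤ L`, which `m
  -- ≥ L + 1` contradicts.
  set L := (n + 1) ^ (2 * n) * K * 2 ^ (2 * n + 1) with hL
  set m := max m₀ (L + 1) with hm
  have hm1 : 0 < m := lt_of_lt_of_le (Nat.succ_pos L) (le_max_right _ _)
  have hf : m ^ n ≤ (n + 1) ^ n * f m :=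
    calc m ^ n ≤ ((n + 1) * (m / (n + 1) + 1)) ^ n := by
          refine Nat.pow_le_pow_left ?_ n
          have := Nat.lt_mul_div_succ m (Nat.succ_pos n)
          exact this.le
      _ ≤ _ := by rw [mul_pow]; exact Nat.mul_le_mul_left _ (h2 m)
  have h4 : m ^ (2 * n) * (m * m) ≤ m ^ (2 * n) * (L * m) :=
    calc m ^ (2 * n) * (m * m) = (m ^ n * m) ^ 2 := by ring
      _ ≤ ((n + 1) ^ n * f m * u m) ^ 2 :=
          Nat.pow_le_pow_left (Nat.mul_le_mul hf (H m).le) 2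
      _ = ((n + 1) ^ n) ^ 2 * (f m * u m) ^ 2 := by ring
      _ ≤ ((n + 1) ^ n) ^ 2 * (K * (m + m) ^ (2 * n + 1)) :=
          Nat.mul_le_mul_left _ ((Nat.pow_le_pow_left (h1 m) 2).trans
            (h3 _ ((le_max_left _ _).trans (Nat.le_add_right _ _))))
      _ = _ := by rw [← two_mul, mul_pow 2 m, hL]; ring
  have h5 := Nat.le_of_mul_le_mul_right (Nat.le_of_mul_le_mul_left h4 (by positivity)) hm1
  have : L + 1 ≤ m := le_max_right _ _
  omega

/-- A subspace closed under the generators of `L₊` is closed under `L₊`. -/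
lemma jetMap_smul_mem {Q : Submodule k M} (hQ : jetGens k n • Q ≤ Q) {η : VF k (Poly k n)}
    (hη : η ∈ LPlus k n) {q : M} (hq : q ∈ Q) : jetMap k n η • q ∈ Q := by
  let W : Submodule k (VF k (Poly k n)) :=
    { carrier := {η | ∀ q ∈ Q, jetMap k n η • q ∈ Q}
      add_mem' := fun ha hb q hq => by
        rw [map_add, add_smul]; exact Q.add_mem (ha q hq) (hb q hq)
      zero_mem' := fun q _ => by rw [map_zero, zero_smul]; exact Q.zero_mem
      smul_mem' := fun c x hx q hq => by
        rw [map_smul, smul_assoc]; exact Q.smul_mem c (hx q hq) }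
  refine mem_of_mem_LPlus W ?_ ?_ hη q hq
  · intro η hη μ hμ h1 h2 q hq
    rw [jetMap_lie hη hμ, sub_smul, mul_smul, mul_smul]
    exact Q.sub_mem (h1 _ (h2 q hq)) (h2 _ (h1 q hq))
  · intro a i ha hd q hq
    exact hQ (Submodule.smul_mem_smul (jetMap_mem_jetGens ha hd i) hq)

variable [Module (WeylRing k n) M] [IsScalarTower k (WeylRing k n) M]

/-- Jets commute with the copy of `D`, so whatever annihilates `v` annihilates every vector obtained
from `v` by jets. -/
lemma smul_eq_zero_of_mem_jetGens_pow_smul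
    (hact : ∀ (a : WeylRing k n) (x : M), a • x = weylToSmash k n a • x) {v : M} (m : ℕ) :
    ∀ q ∈ jetGens k n ^ m • Submodule.span k {v}, ∀ x ∈ annVec k n v, x • q = 0 := by
  intro q hq x hx
  induction hq using Submodule.smul_induction_on' with
  | smul r hr y hy =>
    obtain ⟨c, rfl⟩ := Submodule.mem_span_singleton.1 hy
    have h : x • r • c • v = r • x • c • v := by
      rw [hact, hact x (c • v), ← mul_smul, ← mul_smul, (commute_of_mem_jetGens_pow m hr x).eq]
    rw [h, smul_comm x c v, mem_annVec.1 hx, smul_zero, smul_zero]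
  | add y _ z _ hy hz => rw [smul_add, hy, hz, add_zero]

/-- The growth allowed in `M` is spent twice: its order `n` is used up by the simple module `D v`,
and the remaining order `1/2` is too small for an infinite chain `J^m v`. -/
lemma exists_jet_submodule [IsAlgClosed k] [Uncountable k] [Nontrivial M]
    (hact : ∀ (a : WeylRing k n) (x : M), a • x = weylToSmash k n a • x)
    (hM : HasGKDim k (AVAlg k n) M ((n : ℝ) : EReal)) :
    ∃ v : M, v ≠ 0 ∧
      (∃ c : ℝ, ∀ᶠ m : ℕ in atTop, (growth (orbitMap k n v) m : ℝ) ≤ c * m ^ n) ∧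
      (∀ w ∈ Submodule.span (WeylRing k n) {v}, w ≠ 0 →
        v ∈ Submodule.span (WeylRing k n) {w}) ∧
      ∃ Q : Submodule k M, FiniteDimensional k Q ∧ v ∈ Q ∧
        (∀ q ∈ Q, ∀ x ∈ annVec k n v, x • q = 0) ∧
        ∀ η ∈ LPlus k n, ∀ q ∈ Q, jetMap k n η • q ∈ Q := by
  -- One finite-dimensional space containing the generators of `D` and the jets, so that a single
  -- growth bound controls both.
  let E : Submodule k (AVAlg k n) :=
    (WeylRing.gens k n).map (weylToSmash k n).toLinearMap ⊔ jetGens k n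
  have hE : ∀ (m : ℕ) (a : WeylRing k n), a ∈ WeylRing.gens k n ^ m → weylToSmash k n a ∈ E ^ m := by
    intro m a ha
    refine pow_le_pow_left' (le_sup_left : (WeylRing.gens k n).map _ ≤ E) m ?_
    rw [← Submodule.map_pow]
    exact ⟨a, ha, rfl⟩
  have hJ : ∀ m, jetGens k n ^ m ≤ E ^ m := pow_le_pow_left' le_sup_right
  have horbit : ∀ (v : M) (m : ℕ), orbit k n v m ≤ E ^ m • Submodule.span k {v} := by
    intro v m
    rw [orbit_eq_smul, Submodule.smul_le]
    intro a ha x hx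
    rw [hact]
    exact Submodule.smul_mem_smul (hE m a ha) hx
  have hgrowth : ∀ v : M, ∃ C, ∀ m, growth (orbitMap k n v) m ≤ C * (m + 1) ^ n := by
    intro v
    obtain ⟨K, m₀, hK⟩ := hM.exists_bound E v
    refine growth_le_of_sq_le (K := K) (m₀ := m₀) fun m hm => ?_
    have := finiteDimensional_smul (E ^ m) (Submodule.span k {v})
    rw [growth_orbitMap]
    exact (Nat.pow_le_pow_left (Submodule.finrank_mono (horbit v m)) 2).trans (hK m hm)
  obtain ⟨w, hw⟩ := exists_ne (0 : M)
  obtain ⟨v, hv, hc, hs⟩ := exists_simple_vector (k := k) (n := n) (V := M) ⟨w, hw, hgrowth w⟩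
  refine ⟨v, hv, hc, hs, ?_⟩
  have := isSimpleModule_quotient_annVec hv hs
  have hrank : Module.rank k (WeylRing k n ⧸ annVec k n v) < Cardinal.mk k :=
    (rank_quotient_le _).trans_lt (Cardinal.aleph0_lt_mk_iff.2 inferInstance)
  obtain ⟨K, m₀, hK⟩ := hM.exists_bound E v
  have hle := exists_le_self_of_growth (n := n) (f := growth (orbitMap k n v))
    (u := fun m => Module.finrank k ↥(jetGens k n ^ m • Submodule.span k {v}))
    (g := fun m => Module.finrank k ↥(E ^ m • Submodule.span k {v})) (K := K) (m₀ := m₀)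
    (fun m => by
      have := finiteDimensional_smul (E ^ (m + m)) (Submodule.span k {v})
      have h1 : growth (orbitMap k n v) m = Module.finrank k
          (orbit k n (Submodule.Quotient.mk 1 : WeylRing k n ⧸ annVec k n v) m) := by
        rw [← growth_orbitMap, ← growth_map_of_injective _ (cyclicMap_injective v), cyclicMap_mk,
          one_smul]
      rw [h1]
      refine finrank_mul_finrank_le _ hrank _ _ (smul_eq_zero_of_mem_jetGens_pow_smul hact m) _ ?_
      intro a ha q hq
      obtain ⟨b, hb, hba⟩ := mem_orbit.1 ha
      -- A representative `a` of a class in `F_m (D ⧸ I)` may be replaced by an operator `b` of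
      -- degree at most `m`: their difference annihilates `q`.
      have h2 : a - b ∈ annVec k n v := by
        rw [← Submodule.Quotient.eq, ← hba, ← Submodule.Quotient.mk_smul, smul_eq_mul, mul_one]
      have h3 := smul_eq_zero_of_mem_jetGens_pow_smul hact m q hq _ h2
      rw [sub_smul, sub_eq_zero] at h3
      rw [h3, hact, pow_add, ← smul_eq_mul, Submodule.smul_assoc]
      exact Submodule.smul_mem_smul (hE m b (by rwa [WeylRing.gens_pow]))
        (Submodule.smul_mono_left (hJ m) hq))
    (fun m => pow_le_growth hv m) hK
  obtain ⟨m, hm⟩ := exists_jetGens_stable hle hv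
  refine ⟨_, finiteDimensional_smul (jetGens k n ^ m) (Submodule.span k {v}), ?_,
    smul_eq_zero_of_mem_jetGens_pow_smul hact m, fun η hη q hq => jetMap_smul_mem hm hη hq⟩
  rw [← one_smul (AVAlg k n) v]
  exact Submodule.smul_mem_smul
    (Submodule.pow_mono_of_one_mem one_mem_jetGens (Nat.zero_le m)
      (by rw [pow_zero]; exact Submodule.one_le.1 le_rfl))
    (by rw [one_smul]; exact Submodule.mem_span_singleton_self v)

end JetModules

end AVMod

namespace AVMod

/-! ### The tensor product submodule -/

section TensorSubmodule

open MvPolynomial Filter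

variable {k : Type u} [Field k] {n : ℕ}

instance (I : Submodule (WeylRing k n) (WeylRing k n)) :
    Module (Weyl k n) (WeylRing k n ⧸ I) :=
  inferInstanceAs (Module (WeylRing k n) (WeylRing k n ⧸ I))

instance (I : Submodule (WeylRing k n) (WeylRing k n)) :
    IsScalarTower k (Weyl k n) (WeylRing k n ⧸ I) :=
  inferInstanceAs (IsScalarTower k (WeylRing k n) (WeylRing k n ⧸ I))

/-- The cyclic module generated by a vector of growth of order `n` is holonomic. -/
lemma isHolonomic_quotient_annVec [CharZero k] {V : Type*} [AddCommGroup V] [Module k V]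
    [Module (WeylRing k n) V] [IsScalarTower k (WeylRing k n) V] {v : V} (hv : v ≠ 0)
    (hc : ∃ c : ℝ, ∀ᶠ m : ℕ in atTop, (growth (orbitMap k n v) m : ℝ) ≤ c * m ^ n) :
    IsHolonomic k (WeylRing k n) (WeylRing k n ⧸ annVec k n v) n := by
  obtain ⟨c, hc⟩ := hc
  have h1 : cyclicMap k n v (Submodule.Quotient.mk 1) = v := by rw [cyclicMap_mk, one_smul]
  refine isHolonomic_of_growth (v := (Submodule.Quotient.mk 1 : WeylRing k n ⧸ annVec k n v))
    (c := c) ?_ ?_ ?_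
  · intro h
    rw [h, map_zero] at h1
    exact hv h1.symm
  · rw [eq_top_iff]
    rintro p -
    obtain ⟨a, rfl⟩ := Submodule.Quotient.mk_surjective _ p
    refine Submodule.mem_span_singleton.2 ⟨a, ?_⟩
    rw [← Submodule.Quotient.mk_smul, smul_eq_mul, mul_one]
  · filter_upwards [hc] with m hm
    rwa [← growth_map_of_injective _ (cyclicMap_injective v), h1]

lemma funHom_smul_smul [CharZero k] {M : Type*} [AddCommGroup M] [Module (AVAlg k n) M]
    [Module (WeylRing k n) M] (hact : ∀ (a : WeylRing k n) (x : M), a • x = weylToSmash k n a • x)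
    (f : Poly k n) (α : WeylRing k n) (x : M) :
    Smash.funHom k (Poly k n) f • α • x = (WeylRing.funHom k n f * α) • x := by
  rw [mul_smul, hact (WeylRing.funHom k n f), weylToSmash_funHom]

/-- The term `b = 0` of the expansion is the Weyl operator `x^a ∂ᵢ`. In the other terms the jet lies
in the image of `L₊` and moves past `α` to act on `x`; this is the shape of the action on `P ⊗ Q`.
-/
lemma vfHom_monoVF_smul_smul [CharZero k] {M : Type*} [AddCommGroup M] [Module (AVAlg k n) M]
    [Module (WeylRing k n) M] (hact : ∀ (a : WeylRing k n) (x : M), a • x = weylToSmash k n a • x)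
    (a : Fin n →₀ ℕ) (i : Fin n) (α : WeylRing k n) (x : M) :
    Smash.vfHom k (Poly k n) (monoVF k a i) • α • x =
      (WeylRing.funHom k n (mono k a) * WeylRing.deriv k i * α) • x +
        ∑ b ∈ Finset.Ioc 0 a, multiChoose a b • (WeylRing.funHom k n (mono k (a - b)) * α) •
          jetMap k n (monoVF k b i) • x := by
  rw [vfHom_monoVF, Finset.Icc_eq_cons_Ioc (zero_le (a := a)), Finset.sum_cons, add_smul,
    Finset.sum_smul]
  congr 1
  · have h1 : multiChoose a 0 = 1 := by simp [multiChoose]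
    have h2 : jetMap k n (monoVF k 0 i) = Smash.vfHom k (Poly k n) (pderiv i) := by
      rw [monoVF, jetMap_smul_pderiv, mono, monomial_zero', C_1, map_one,
        Algebra.TensorProduct.one_def, coeffVF_tmul, map_one, one_mul, one_smul]
    rw [h1, one_smul, h2, tsub_zero, mul_smul, hact, hact, map_mul, map_mul, weylToSmash_funHom,
      weylToSmash_deriv, mul_smul, mul_smul]
  · refine Finset.sum_congr rfl fun b hb => ?_
    have hb0 : b ≠ 0 := (Finset.mem_Ioc.1 hb).1.ne'
    rw [smul_assoc, mul_smul, hact, ← mul_smul (jetMap k n _),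
      (commute_jetMap_weylToSmash (monoVF_mem k b hb0 i) α).eq, hact, map_mul,
      weylToSmash_funHom, mul_smul, mul_smul]

section TensorAct

variable {M : Type v} [AddCommGroup M] [Module k M] [Module (WeylRing k n) M]
  [IsScalarTower k (WeylRing k n) M] {Q₀ : Submodule k M} {Q : Type u} [AddCommGroup Q] [Module k Q]
  (e : Q ≃ₗ[k] Q₀) (I : Submodule (WeylRing k n) (WeylRing k n))
  (hI : ∀ q ∈ Q₀, ∀ x ∈ I, x • q = 0)

/-- The map `P ⊗ Q → M` induced by the action. -/
def tensorAct : (WeylRing k n ⧸ I) ⊗[k] Q →ₗ[k] M :=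
  actMap I Q₀ hI ∘ₗ TensorProduct.map LinearMap.id e.toLinearMap

lemma tensorAct_tmul (α : WeylRing k n) (q : Q) :
    tensorAct e I hI (Submodule.Quotient.mk α ⊗ₜ q) = α • (e q : M) := rfl

lemma tensorAct_injective (h : Function.Injective (actMap I Q₀ hI)) :
    Function.Injective (tensorAct e I hI) :=
  h.comp (TensorProduct.congr (LinearEquiv.refl k _) e).injective

end TensorAct

lemma tensorAct_mono [CharZero k] {M : Type v} [AddCommGroup M] [Module k M]
    [Module (AVAlg k n) M] [Module (WeylRing k n) M] [IsScalarTower k (WeylRing k n) M]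
    {Q₀ : Submodule k M} {Q : Type u} [AddCommGroup Q] [Module k Q] (e : Q ≃ₗ[k] Q₀)
    (hact : ∀ (a : WeylRing k n) (x : M), a • x = weylToSmash k n a • x)
    (I : Submodule (WeylRing k n) (WeylRing k n)) (hI : ∀ q ∈ Q₀, ∀ x ∈ I, x • q = 0)
    (f : Poly k n) (p : WeylRing k n ⧸ I) (q : Q) :
    tensorAct e I hI ((Weyl.ofFun f • p) ⊗ₜ q) =
      Smash.funHom k (Poly k n) f • tensorAct e I hI (p ⊗ₜ q) := by
  obtain ⟨α, rfl⟩ := Submodule.Quotient.mk_surjective _ p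
  rw [tensorAct_tmul, funHom_smul_smul hact]
  exact tensorAct_tmul e I hI (WeylRing.funHom k n f * α) q

variable {M : Type v} [AddCommGroup M] [Module k M] [Module (AVAlg k n) M]
  {Q₀ : Submodule k M} (hjet : ∀ η ∈ LPlus k n, ∀ q ∈ Q₀, jetMap k n η • q ∈ Q₀)
  {Q : Type u} [AddCommGroup Q] [Module k Q] (e : Q ≃ₗ[k] Q₀)

/-- The action of `L₊` on a space stable under the jet map. -/
abbrev jetLieRingModule : LieRingModule (LPlus k n) Q where
  bracket x q := e.symm ⟨jetMap k n x.1 • (e q : M), hjet _ x.2 _ (e q).2⟩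
  add_lie x y q := by
    rw [← map_add]
    congr 1
    ext
    change jetMap k n (x.1 + y.1) • (e q : M) = _
    rw [map_add, add_smul]
    rfl
  lie_add x q q' := by
    rw [← map_add]
    congr 1
    ext
    simp only [map_add, Submodule.coe_add, smul_add]
  leibniz_lie x y q := by
    rw [← map_add]
    congr 1
    ext
    simp only [LinearEquiv.apply_symm_apply, LieSubalgebra.coe_bracket, Submodule.coe_add,
      jetMap_lie x.2 y.2, sub_smul, mul_smul, sub_add_cancel]

lemma coe_jet_lie (x : LPlus k n) (q : Q) :
    letI := jetLieRingModule hjet e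
    (e ⁅x, q⁆ : M) = jetMap k n x.1 • (e q : M) :=
  congrArg Subtype.val (e.apply_symm_apply _)

lemma jetLieModule [IsScalarTower k (AVAlg k n) M] : letI := jetLieRingModule hjet e; LieModule k (LPlus k n) Q := by
  let := jetLieRingModule hjet e
  refine ⟨fun c x q => ?_, fun c x q => ?_⟩
  · apply e.injective
    ext
    rw [coe_jet_lie, LinearEquiv.map_smul e]
    change jetMap k n (c • x.1) • (e q : M) = c • (e ⁅x, q⁆ : M)
    rw [coe_jet_lie, map_smul, smul_assoc]
  · apply e.injective
    ext
    rw [coe_jet_lie, map_smul, map_smul, Submodule.coe_smul, Submodule.coe_smul, coe_jet_lie,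
      smul_algebra_smul_comm]

variable [CharZero k] [Module (WeylRing k n) M]
  (hact : ∀ (a : WeylRing k n) (x : M), a • x = weylToSmash k n a • x)
  [IsScalarTower k (WeylRing k n) M] (I : Submodule (WeylRing k n) (WeylRing k n))
  (hI : ∀ q ∈ Q₀, ∀ x ∈ I, x • q = 0)

include hact in
lemma tensorAct_monoVF (a : Fin n →₀ ℕ) (i : Fin n) (p : WeylRing k n ⧸ I) (q : Q) :
    letI := jetLieRingModule hjet e
    tensorAct e I hI ((Weyl.ofVF (monoVF k a i) • p) ⊗ₜ q +
        ∑ b ∈ (Finset.Ioc 0 a).attach,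
          multiChoose a b.1 •
            ((Weyl.ofFun (mono k (a - b.1)) • p) ⊗ₜ
              ⁅monoLPlus k b.1 (Finset.mem_Ioc.1 b.2).1.ne' i, q⁆)) =
      Smash.vfHom k (Poly k n) (monoVF k a i) • tensorAct e I hI (p ⊗ₜ q) := by
  let := jetLieRingModule hjet e
  obtain ⟨α, rfl⟩ := Submodule.Quotient.mk_surjective _ p
  rw [tensorAct_tmul, vfHom_monoVF_smul_smul hact, map_add, map_sum]
  refine congrArg₂ (· + ·) ?_ ?_
  · rw [monoVF, Weyl.ofVF_smul]
    exact tensorAct_tmul e I hI (WeylRing.funHom k n (mono k a) * WeylRing.deriv k i * α) q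
  · rw [← Finset.sum_attach (Finset.Ioc 0 a)]
    refine Finset.sum_congr rfl fun b _ => ?_
    rw [map_nsmul]
    congr 1
    refine (tensorAct_tmul e I hI (WeylRing.funHom k n (mono k (a - b.1)) * α) _).trans ?_
    rw [coe_jet_lie]
    rfl

variable [IsScalarTower k (AVAlg k n) M]

include hact hjet in
-- The monomial fields span `V`, and for these the tensor product formula exhibits a preimage.
lemma vfHom_smul_mem_range (η : VF k (Poly k n)) (x : M)
    (hx : x ∈ LinearMap.range (tensorAct e I hI)) :
    Smash.vfHom k (Poly k n) η • x ∈ LinearMap.range (tensorAct e I hI) := by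
  obtain ⟨t, rfl⟩ := hx
  induction t with
  | zero => rw [map_zero, smul_zero]; exact Submodule.zero_mem _
  | add s t hs ht => rw [map_add, smul_add]; exact Submodule.add_mem _ hs ht
  | tmul p q =>
    rw [eq_sum_monoVF η, map_sum, Finset.sum_smul]
    refine Submodule.sum_mem _ fun i _ => ?_
    rw [map_sum, Finset.sum_smul]
    refine Submodule.sum_mem _ fun a _ => ?_
    rw [map_smul, smul_assoc]
    exact Submodule.smul_mem _ _ ⟨_, tensorAct_monoVF hjet e hact I hI a i p q⟩

/-- The image of `P ⊗ Q` in `M` as a module over the smash product. -/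
def tensorRange : Submodule (AVAlg k n) M where
  carrier := LinearMap.range (tensorAct e I hI)
  add_mem' := Submodule.add_mem _
  zero_mem' := Submodule.zero_mem _
  smul_mem' s x hx := by
    refine Smash.smul_mem_of_stable (LinearMap.range (tensorAct e I hI)) ?_
      (vfHom_smul_mem_range hjet e hact I hI) s hx
    rintro f _ ⟨t, rfl⟩
    induction t with
    | zero => rw [map_zero, smul_zero]; exact Submodule.zero_mem _
    | add s t hs ht => rw [map_add, smul_add]; exact Submodule.add_mem _ hs ht
    | tmul p q => exact ⟨_, tensorAct_mono e hact I hI f p q⟩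

/-- The isomorphism of `P ⊗ Q` with its image. -/
def tensorIsoRange (hinj : Function.Injective (tensorAct e I hI)) :
    letI := jetLieRingModule hjet e
    TensorIso k n (WeylRing k n ⧸ I) Q (tensorRange hjet e hact I hI) :=
  letI := jetLieRingModule hjet e
  { (LinearEquiv.ofInjective (tensorAct e I hI) hinj :
      (WeylRing k n ⧸ I) ⊗[k] Q ≃ₗ[k] LinearMap.range (tensorAct e I hI)) with
    map_mono := fun a p q => Subtype.ext (tensorAct_mono e hact I hI (mono k a) p q)
    map_monoVF := fun a i p q => Subtype.ext (tensorAct_monoVF hjet e hact I hI a i p q) }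

end TensorSubmodule

end AVMod

namespace AVMod

/-! ### Existence of the tensor product submodule, and the case of the zero module -/

section Existence

variable {k : Type u} [Field k] {n : ℕ}

/-- On trivial modules the conclusion holds with the zero module over `L₊`. -/
lemma exists_tensorIso_bot {M : Type v} [AddCommGroup M] [Module k M] [Module (AVAlg k n) M]
    [IsScalarTower k (AVAlg k n) M] (P : Type u) [AddCommGroup P] [Module k P] [Module (Weyl k n) P] :
    ∃ (_ : LieRingModule (LPlus k n) (Fin 0 → k)) (_ : LieModule k (LPlus k n) (Fin 0 → k)),
      Nonempty (TensorIso k n P (Fin 0 → k) (⊥ : Submodule (AVAlg k n) M)) := by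
  let i₁ : LieRingModule (LPlus k n) (Fin 0 → k) :=
    { bracket := fun _ _ => 0
      add_lie := fun _ _ _ => Subsingleton.elim _ _
      lie_add := fun _ _ _ => Subsingleton.elim _ _
      leibniz_lie := fun _ _ _ => Subsingleton.elim _ _ }
  have : Subsingleton (P ⊗[k] (Fin 0 → k)) := by
    refine subsingleton_of_forall_eq 0 fun t => ?_
    induction t with
    | zero => rfl
    | tmul p q => rw [Subsingleton.elim q 0, TensorProduct.tmul_zero]
    | add s t hs ht => rw [hs, ht, add_zero]
  exact ⟨i₁, ⟨fun _ _ _ => Subsingleton.elim _ _, fun _ _ _ => Subsingleton.elim _ _⟩,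
    ⟨{ (0 : P ⊗[k] (Fin 0 → k) →ₗ[k] (⊥ : Submodule (AVAlg k n) M)) with
      invFun := 0
      left_inv := fun _ => Subsingleton.elim _ _
      right_inv := fun _ => Subsingleton.elim _ _
      map_mono := fun _ _ _ => Subsingleton.elim _ _
      map_monoVF := fun _ _ _ _ => Subsingleton.elim _ _ }⟩⟩

variable [CharZero k]

/-- There is a simple holonomic module over the Weyl algebra. -/
lemma exists_simple_holonomic : ∃ I : Submodule (WeylRing k n) (WeylRing k n),
    IsSimpleModule (Weyl k n) (WeylRing k n ⧸ I) ∧ IsHolonomic k (Weyl k n) (WeylRing k n ⧸ I) n := by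
  obtain ⟨v, hv, hc, hs⟩ := exists_simple_vector (k := k) (n := n) (V := Poly k n)
    ⟨1, one_ne_zero, growth_one_le⟩
  exact ⟨annVec k n v, isSimpleModule_quotient_annVec hv hs, isHolonomic_quotient_annVec hv hc⟩

variable [IsAlgClosed k] [Uncountable k]

/-- A nonzero module of Gelfand–Kirillov dimension `n` contains a nonzero tensor product. -/
lemma exists_tensorIso {M : Type v} [AddCommGroup M] [Module k M] [Module (AVAlg k n) M]
    [IsScalarTower k (AVAlg k n) M] [Nontrivial M]
    (hM : HasGKDim k (AVAlg k n) M ((n : ℝ) : EReal)) :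
    ∃ I : Submodule (WeylRing k n) (WeylRing k n),
      IsSimpleModule (Weyl k n) (WeylRing k n ⧸ I) ∧
      IsHolonomic k (Weyl k n) (WeylRing k n ⧸ I) n ∧
      ∃ (d : ℕ) (_ : LieRingModule (LPlus k n) (Fin d → k)) (_ : LieModule k (LPlus k n) (Fin d → k))
        (N : Submodule (AVAlg k n) M),
        N ≠ ⊥ ∧ Nonempty (TensorIso k n (WeylRing k n ⧸ I) (Fin d → k) N) := by
  let : Module (WeylRing k n) M := Module.compHom M (weylToSmash k n).toRingHom
  have hact : ∀ (a : WeylRing k n) (x : M), a • x = weylToSmash k n a • x := fun _ _ => rfl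
  have : IsScalarTower k (WeylRing k n) M :=
    ⟨fun c a x => by rw [hact, hact, map_smul, smul_assoc]⟩
  obtain ⟨v, hv, hc, hs, Q₀, hfin, hvQ, hI, hjet⟩ := exists_jet_submodule hact hM
  have hsimple := isSimpleModule_quotient_annVec hv hs
  have hrank : Module.rank k (WeylRing k n ⧸ annVec k n v) < Cardinal.mk k :=
    (rank_quotient_le _).trans_lt (Cardinal.aleph0_lt_mk_iff.2 inferInstance)
  -- The space `Q₀` lives in the universe of `M`; coordinates move it to the universe of `k`.
  let e : (Fin (Module.finrank k Q₀) → k) ≃ₗ[k] Q₀ := (Module.finBasis k Q₀).equivFun.symm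
  have hinj := tensorAct_injective e (annVec k n v) hI (actMap_injective _ hrank Q₀ hI)
  refine ⟨annVec k n v, hsimple, isHolonomic_quotient_annVec hv hc, Module.finrank k Q₀,
    jetLieRingModule hjet e, jetLieModule hjet e, tensorRange hjet e hact _ hI, ?_,
    ⟨tensorIsoRange hjet e hact _ hI hinj⟩⟩
  rw [Submodule.ne_bot_iff]
  -- The image contains `v`, as that of the class of `1` tensored with `v`.
  refine ⟨v, ⟨Submodule.Quotient.mk 1 ⊗ₜ e.symm ⟨v, hvQ⟩, ?_⟩, hv⟩
  rw [tensorAct_tmul, LinearEquiv.apply_symm_apply, one_smul]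

end Existence

end AVMod

end

theorem mainTheorem5 (k : Type u) [Field k] [IsAlgClosed k] [CharZero k] [Uncountable k]
    (n : ℕ) (M : Type v) [AddCommGroup M] [Module k M] [Module (AVMod.AVAlg k n) M]
    [IsScalarTower k (AVMod.AVAlg k n) M]
    (hM : AVMod.IsHolonomic k (AVMod.AVAlg k n) M n) :
    ∃ (P : Type u) (_ : AddCommGroup P) (_ : Module k P) (_ : Module (AVMod.Weyl k n) P)
      (_ : IsScalarTower k (AVMod.Weyl k n) P)
      (Q : Type u) (_ : AddCommGroup Q) (_ : Module k Q) (_ : LieRingModule (AVMod.LPlus k n) Q)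
      (_ : LieModule k (AVMod.LPlus k n) Q)
      (N : Submodule (AVMod.AVAlg k n) M),
      IsSimpleModule (AVMod.Weyl k n) P ∧
      AVMod.IsHolonomic k (AVMod.Weyl k n) P n ∧
      FiniteDimensional k Q ∧
      (Nontrivial M → N ≠ ⊥) ∧
      Nonempty (AVMod.TensorIso k n P Q N) := by
  -- For `M = 0` a simple holonomic `P` is still required; a cyclic submodule of `k[x₁, …, xₙ]`
  -- provides one, with `Q = 0`.
  rcases subsingleton_or_nontrivial M with hs | hn
  · obtain ⟨I, h1, h2⟩ := AVMod.exists_simple_holonomic (k := k) (n := n)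
    obtain ⟨i₁, i₂, h3⟩ := AVMod.exists_tensorIso_bot (k := k) (n := n) (M := M)
      (AVMod.WeylRing k n ⧸ I)
    exact ⟨AVMod.WeylRing k n ⧸ I, inferInstance, inferInstance, inferInstance, inferInstance,
      Fin 0 → k, inferInstance, inferInstance, i₁, i₂, ⊥, h1, h2, inferInstance,
      fun h => absurd hs (not_subsingleton_iff_nontrivial.2 h), h3⟩
  · have hd := hM.2.resolve_left (not_subsingleton_iff_nontrivial.2 hn)
    obtain ⟨I, h1, h2, d, i₁, i₂, N, hN, h3⟩ := AVMod.exists_tensorIso hd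
    exact ⟨AVMod.WeylRing k n ⧸ I, inferInstance, inferInstance, inferInstance, inferInstance,
      Fin d → k, inferInstance, inferInstance, i₁, i₂, N, h1, h2, inferInstance, fun _ => hN, h3⟩
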